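/- Let $d\ge 2$ and let $\Omega\subset\mathbb{R}^d$ be a bounded Lipschitz domain (nonempty, open, connected). All function spaces are real. Let $-\Delta^{\rm Dir}$ be the Dirichlet Laplacian in $L^2(\Omega)$ and let $\lambda_1^{\rm Dir}$ be its lowest eigenvalue. For $\Lambda\in\mathbb{R}\setminus\operatorname{Spec}(-\Delta^{\rm Dir})$ and $u\in H^{1/2}(\partial\Omega)$ let $U=\mathcal{E}_\Lambda u\in H^1(\Omega)$ be the unique solution of $-\Delta U=\Lambda U$ in $\Omega$, $U|_{\partial\Omega}=u$, and let $\mathcal{D}_\Lambda u=\partial_n(\mathcal{E}_\Lambda u)\in H^{-1/2}(\partial\Omega)$ be the Dirichlet-to-Neumann operator, where $\partial_n$ is the outward normal derivative. Let $\sigma_1^{(\Lambda)}\le\sigma_2^{(\Lambda)}\le\dots\nearrow+\infty$ be the eigenvalues of $\mathcal{D}_\Lambda$, listed in increasing order with multiplicities. Let $\Lambda_0\in\mathbb{R}\setminus\operatorname{Spec}(-\Delta^{\rm Dir})$, let $u_j^{(\Lambda_0)}$, $j=1,2,\dots$, be eigenfunctions, $\mathcal{D}_{\Lambda_0}u_j^{(\Lambda_0)}=\sigma_j^{(\Lambda_0)}u_j^{(\Lambda_0)}$,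 orthonormal in $L^2(\partial\Omega)$, and let $U_j^{(\Lambda_0)}=\mathcal{E}_{\Lambda_0}u_j^{(\Lambda_0)}$. Let $k\ge 1$ be such that $\sigma_k^{(\Lambda_0)}$ is a simple eigenvalue of $\mathcal{D}_{\Lambda_0}$. Then $\Lambda\mapsto\sigma_k^{(\Lambda)}$ is differentiable in a neighbourhood of $\Lambda_0$ and twice differentiable at $\Lambda_0$, with $$\left.\frac{\mathrm{d}\sigma_k^{(\Lambda)}}{\mathrm{d}\Lambda}\right|_{\Lambda=\Lambda_0}=-\left\|U_k^{(\Lambda_0)}\right\|^2_{L^2(\Omega)},$$ $$\left.\frac{\mathrm{d}^2\sigma_k^{(\Lambda)}}{\mathrm{d}\Lambda^2}\right|_{\Lambda=\Lambda_0}=-2\left(\left\langle\left(-\Delta^{\rm Dir}-\Lambda_0\right)^{-1}U_k^{(\Lambda_0)},U_k^{(\Lambda_0)}\right\rangle_{L^2(\Omega)}+\sum_{j\ne k}\frac{\left\langle U_j^{(\Lambda_0)},U_k^{(\Lambda_0)}\right\rangle^2_{L^2(\Omega)}}{\sigma_j^{(\Lambda_0)}-\sigma_k^{(\Lambda_0)}}\right),$$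 where the series converges absolutely. Moreover, the function $\Lambda\mapsto\sigma_1^{(\Lambda)}$ is concave on $(-\infty,\lambda_1^{\rm Dir})$. -/

import Mathlib

open MeasureTheory Filter Topology
open scoped ContDiff RealInnerProductSpace

noncomputable section

namespace DtN

/-- Euclidean space `ℝ^d`. -/
abbrev Euc (d : ℕ) : Type := EuclideanSpace ℝ (Fin d)

variable {d : ℕ}

/-! ### Bounded Lipschitz domains -/

/-- A bounded Lipschitz domain: a (nonempty) bounded connected open set which near each of its
boundary points `p` is the strict subgraph of a Lipschitz function, in the direction of some unit
vector `e`.  Here `⟪e, x⟫` is the coordinate of `x` along `e` and `x - ⟪e, x⟫ • e` is the component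
of `x` in the hyperplane orthogonal to `e`; only the values of `g` on that hyperplane are used. -/
structure IsBoundedLipschitzDomain (Ω : Set (Euc d)) : Prop where
  isOpen : IsOpen Ω
  isConnected : IsConnected Ω
  isBounded : Bornology.IsBounded Ω
  lipschitz_boundary : ∀ p ∈ frontier Ω, ∃ N : Set (Euc d), IsOpen N ∧ p ∈ N ∧
    ∃ e : Euc d, ‖e‖ = 1 ∧ ∃ (K : NNReal) (g : Euc d → ℝ), LipschitzWith K g ∧
      Ω ∩ N = {x ∈ N | ⟪e, x⟫ < g (x - ⟪e, x⟫ • e)}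

/-! ### Lebesgue and Sobolev spaces (real-valued functions) -/

/-- `L²(Ω)`. -/
abbrev L2 (Ω : Set (Euc d)) : Type := Lp ℝ 2 (volume.restrict Ω)

/-- `L²(Ω; ℝ^d)`. -/
abbrev L2Vec (Ω : Set (Euc d)) : Type := Lp (Euc d) 2 (volume.restrict Ω)

/-- The surface measure of `∂Ω`: the `(d-1)`-dimensional Hausdorff measure, normalised so that it
agrees with the Lebesgue measure on `ℝ^(d-1)`, restricted to `∂Ω`. -/
def surfaceMeasure (Ω : Set (Euc d)) : Measure (Euc d) :=
  (Measure.euclideanHausdorffMeasure (d - 1)).restrict (frontier Ω)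

/-- `L²(∂Ω)`. -/
abbrev L2Bdry (Ω : Set (Euc d)) : Type := Lp ℝ 2 (surfaceMeasure Ω)

lemma integrable_mul_of_test {Ω : Set (Euc d)} (u : L2 Ω) {ψ : Euc d → ℝ} (hψ : Continuous ψ)
    (hc : HasCompactSupport ψ) : Integrable (fun x => u x * ψ x) (volume.restrict Ω) :=
  (Lp.memLp u).integrable_mul
    ((hψ.memLp_of_hasCompactSupport (μ := volume) (p := 2) hc).restrict Ω)

/-- The Sobolev space `H¹(Ω)`: the pairs `(U, ∇U)` of a function `U ∈ L²(Ω)` and its weak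
(distributional) gradient `∇U ∈ L²(Ω; ℝ^d)`.  As the second component is determined by the first,
this is the usual space; it carries the `H¹` topology. -/
def H1 (Ω : Set (Euc d)) : Submodule ℝ (L2 Ω × L2Vec Ω) where
  carrier := {p | ∀ φ : Euc d → ℝ, ContDiff ℝ ∞ φ → HasCompactSupport φ → tsupport φ ⊆ Ω →
    ∀ v : Euc d, ∫ x in Ω, p.1 x * fderiv ℝ φ x v = - ∫ x in Ω, ⟪p.2 x, v⟫ * φ x}
  zero_mem' := by
    intro φ hφ hc hs v
    have h1 : ∀ᵐ x ∂(volume.restrict Ω), ((0 : L2 Ω) : Euc d → ℝ) x * fderiv ℝ φ x v = 0 := by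
      filter_upwards [Lp.coeFn_zero ℝ 2 (volume.restrict Ω)] with x hx
      rw [hx, Pi.zero_apply, zero_mul]
    have h2 : ∀ᵐ x ∂(volume.restrict Ω), ⟪((0 : L2Vec Ω) : Euc d → Euc d) x, v⟫ * φ x = 0 := by
      filter_upwards [Lp.coeFn_zero (Euc d) 2 (volume.restrict Ω)] with x hx
      rw [hx, Pi.zero_apply, inner_zero_left, zero_mul]
    simp only [Prod.fst_zero, Prod.snd_zero]
    rw [integral_congr_ae h1, integral_congr_ae h2]
    simp
  add_mem' := by
    intro p q hp hq φ hφ hc hs v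
    have cd : Continuous (fun x => fderiv ℝ φ x v) :=
      (hφ.continuous_fderiv (by simp)).clm_apply continuous_const
    have cc : HasCompactSupport (fun x => fderiv ℝ φ x v) := hc.fderiv_apply ℝ v
    have i : ∀ w : L2Vec Ω, Integrable (fun x => ⟪w x, v⟫ * φ x) (volume.restrict Ω) := fun w =>
      ((Lp.memLp w).inner_const v).integrable_mul
        ((hφ.continuous.memLp_of_hasCompactSupport (μ := volume) (p := 2) hc).restrict Ω)
    have h1 : ∀ᵐ x ∂(volume.restrict Ω), (p + q).1 x * fderiv ℝ φ x v
        = p.1 x * fderiv ℝ φ x v + q.1 x * fderiv ℝ φ x v := by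
      filter_upwards [Lp.coeFn_add p.1 q.1] with x hx
      rw [Prod.fst_add, hx, Pi.add_apply, add_mul]
    have h2 : ∀ᵐ x ∂(volume.restrict Ω), ⟪(p + q).2 x, v⟫ * φ x
        = ⟪p.2 x, v⟫ * φ x + ⟪q.2 x, v⟫ * φ x := by
      filter_upwards [Lp.coeFn_add p.2 q.2] with x hx
      rw [Prod.snd_add, hx, Pi.add_apply, inner_add_left, add_mul]
    rw [integral_congr_ae h1, integral_congr_ae h2,
      integral_add (integrable_mul_of_test _ cd cc) (integrable_mul_of_test _ cd cc),
      integral_add (i _) (i _), hp φ hφ hc hs v, hq φ hφ hc hs v]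
    ring
  smul_mem' := by
    intro c p hp φ hφ hc hs v
    have h1 : ∀ᵐ x ∂(volume.restrict Ω), (c • p).1 x * fderiv ℝ φ x v
        = c * (p.1 x * fderiv ℝ φ x v) := by
      filter_upwards [Lp.coeFn_smul c p.1] with x hx
      rw [Prod.smul_fst, hx, Pi.smul_apply, smul_eq_mul, mul_assoc]
    have h2 : ∀ᵐ x ∂(volume.restrict Ω), ⟪(c • p).2 x, v⟫ * φ x = c * (⟪p.2 x, v⟫ * φ x) := by
      filter_upwards [Lp.coeFn_smul c p.2] with x hx
      rw [Prod.smul_snd, hx, Pi.smul_apply, real_inner_smul_left, mul_assoc]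
    rw [integral_congr_ae h1, integral_congr_ae h2, integral_const_mul, integral_const_mul,
      hp φ hφ hc hs v]
    ring

/-- The underlying function `U ∈ L²(Ω)` of an element of `H¹(Ω)`. -/
def fn {Ω : Set (Euc d)} (U : H1 Ω) : L2 Ω := (U : L2 Ω × L2Vec Ω).1

/-- The weak gradient `∇U ∈ L²(Ω; ℝ^d)` of an element of `H¹(Ω)`. -/
def grad {Ω : Set (Euc d)} (U : H1 Ω) : L2Vec Ω := (U : L2 Ω × L2Vec Ω).2

/-- `U ∈ H¹(Ω)` is represented by the smooth function `φ` on `ℝ^d` (and `∇U` by the classical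
gradient of `φ`). -/
def IsRepr {Ω : Set (Euc d)} (U : H1 Ω) (φ : Euc d → ℝ) : Prop :=
  ((fn U) =ᵐ[volume.restrict Ω] φ) ∧ ((grad U) =ᵐ[volume.restrict Ω] fun x => gradient φ x)

lemma IsRepr.zero {Ω : Set (Euc d)} : IsRepr (0 : H1 Ω) (fun _ => 0) := by
  refine ⟨?_, ?_⟩
  · filter_upwards [Lp.coeFn_zero ℝ 2 (volume.restrict Ω)] with x hx
    simpa [fn] using hx
  · filter_upwards [Lp.coeFn_zero (Euc d) 2 (volume.restrict Ω)] with x hx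
    simpa [grad, gradient] using hx

lemma IsRepr.add {Ω : Set (Euc d)} {U V : H1 Ω} {φ ψ : Euc d → ℝ} (hU : IsRepr U φ)
    (hV : IsRepr V ψ) (hφ : ContDiff ℝ ∞ φ) (hψ : ContDiff ℝ ∞ ψ) :
    IsRepr (U + V) (fun x => φ x + ψ x) := by
  refine ⟨?_, ?_⟩
  · filter_upwards [Lp.coeFn_add (fn U) (fn V), hU.1, hV.1] with x hx h1 h2
    exact hx.trans (by simp [h1, h2])
  · filter_upwards [Lp.coeFn_add (grad U) (grad V), hU.2, hV.2] with x hx h1 h2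
    refine hx.trans ?_
    have e : fderiv ℝ (fun x => φ x + ψ x) x = fderiv ℝ φ x + fderiv ℝ ψ x :=
      fderiv_add (hφ.differentiable (by simp) x) (hψ.differentiable (by simp) x)
    simp [h1, h2, gradient, e]

lemma IsRepr.smul {Ω : Set (Euc d)} {U : H1 Ω} {φ : Euc d → ℝ} (c : ℝ) (hU : IsRepr U φ)
    (hφ : ContDiff ℝ ∞ φ) : IsRepr (c • U) (fun x => c * φ x) := by
  refine ⟨?_, ?_⟩
  · filter_upwards [Lp.coeFn_smul c (fn U), hU.1] with x hx h1
    exact hx.trans (by simp [h1])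
  · filter_upwards [Lp.coeFn_smul c (grad U), hU.2] with x hx h1
    refine hx.trans ?_
    have e : fderiv ℝ (fun x => c * φ x) x = c • fderiv ℝ φ x :=
      fderiv_const_mul (hφ.differentiable (by simp) x) c
    simp [h1, gradient, e]

/-- The space `C_c^∞(Ω)`, as a subspace of `H¹(Ω)`. -/
def testSpace (Ω : Set (Euc d)) : Submodule ℝ (H1 Ω) where
  carrier := {U | ∃ φ : Euc d → ℝ, ContDiff ℝ ∞ φ ∧ HasCompactSupport φ ∧ tsupport φ ⊆ Ω ∧
    IsRepr U φ}
  zero_mem' := ⟨fun _ => 0, contDiff_const, HasCompactSupport.zero, by simp [tsupport],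
    IsRepr.zero⟩
  add_mem' := by
    rintro U V ⟨φ, h1, h2, h3, h4⟩ ⟨ψ, k1, k2, k3, k4⟩
    exact ⟨_, h1.add k1, h2.add k2, (tsupport_add φ ψ).trans (Set.union_subset h3 k3),
      h4.add k4 h1 k1⟩
  smul_mem' := by
    rintro c U ⟨φ, h1, h2, h3, h4⟩
    exact ⟨_, contDiff_const.mul h1, h2.mul_left (f := fun _ => c),
      (tsupport_mul_subset_right (f := fun _ => c)).trans h3, h4.smul c h1⟩

/-- `H¹₀(Ω)`: the closure of `C_c^∞(Ω)` in `H¹(Ω)`. -/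
def H10 (Ω : Set (Euc d)) : Submodule ℝ (H1 Ω) := (testSpace Ω).topologicalClosure

/-! ### The Dirichlet Laplacian -/

/-- `(-Δ^Dir - Λ) V = f`, where `-Δ^Dir` is the Dirichlet Laplacian in `L²(Ω)`, the self-adjoint
operator associated with the form `∫ ∇V·∇W` on `H¹₀(Ω)`: that is, `V ∈ H¹₀(Ω)` and
`⟪∇V, ∇W⟫ = ⟪f + Λ V, W⟫` for all `W ∈ H¹₀(Ω)`. -/
def DirichletEq (Ω : Set (Euc d)) (Λ : ℝ) (V f : L2 Ω) : Prop :=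
  ∃ W ∈ H10 Ω, (fn W) = V ∧ ∀ Z ∈ H10 Ω, ⟪grad W, grad Z⟫ = ⟪f + Λ • V, fn Z⟫

/-- `Spec (-Δ^Dir)`: the complement of the set of those `Λ` for which `-Δ^Dir - Λ` is a bijection
of the operator domain onto `L²(Ω)` (the inverse is then automatically bounded, `-Δ^Dir` being
closed). -/
def dirichletSpectrum (Ω : Set (Euc d)) : Set ℝ :=
  {Λ | ¬ ∀ f : L2 Ω, ∃! V : L2 Ω, DirichletEq Ω Λ V f}

open Classical in
/-- The resolvent `(-Δ^Dir - Λ)⁻¹ : L²(Ω) → L²(Ω)` for `Λ ∉ Spec (-Δ^Dir)`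
(and `0` by convention otherwise). -/
def dirichletResolvent (Ω : Set (Euc d)) (Λ : ℝ) (f : L2 Ω) : L2 Ω :=
  if h : ∀ f : L2 Ω, ∃! V : L2 Ω, DirichletEq Ω Λ V f then (h f).choose else 0

/-- `λ₁^Dir`, the lowest point of the Dirichlet spectrum. -/
def firstDirichletEigenvalue (Ω : Set (Euc d)) : ℝ := sInf (dirichletSpectrum Ω)

/-! ### Traces and normal derivatives -/

/-- The smooth functions on `ℝ^d` (with compact support), seen as pairs of their restriction to
`Ω`, in `H¹(Ω)`, and their restriction to `∂Ω`, in `L²(∂Ω)`. -/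
def smoothTraceGraph (Ω : Set (Euc d)) : Submodule ℝ (H1 Ω × L2Bdry Ω) where
  carrier := {p | ∃ φ : Euc d → ℝ, ContDiff ℝ ∞ φ ∧ HasCompactSupport φ ∧
    IsRepr p.1 φ ∧ p.2 =ᵐ[surfaceMeasure Ω] φ}
  zero_mem' := by
    refine ⟨fun _ => 0, contDiff_const, HasCompactSupport.zero, IsRepr.zero, ?_⟩
    filter_upwards [Lp.coeFn_zero ℝ 2 (surfaceMeasure Ω)] with x hx
    simpa using hx
  add_mem' := by
    rintro p q ⟨φ, h1, h2, h3, h4⟩ ⟨ψ, k1, k2, k3, k4⟩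
    refine ⟨_, h1.add k1, h2.add k2, h3.add k3 h1 k1, ?_⟩
    filter_upwards [Lp.coeFn_add p.2 q.2, h4, k4] with x hx e1 e2
    exact hx.trans (by simp [e1, e2])
  smul_mem' := by
    rintro c p ⟨φ, h1, h2, h3, h4⟩
    refine ⟨_, contDiff_const.mul h1, h2.mul_left (f := fun _ => c), h3.smul c h1, ?_⟩
    filter_upwards [Lp.coeFn_smul c p.2, h4] with x hx e1
    exact hx.trans (by simp [e1])

/-- The graph of the trace operator `H¹(Ω) → L²(∂Ω)`, `U ↦ U|_∂Ω`: the continuous extension of the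
restriction of smooth functions to `∂Ω`, i.e. the closure of the graph of the latter. -/
def traceGraph (Ω : Set (Euc d)) : Submodule ℝ (H1 Ω × L2Bdry Ω) :=
  (smoothTraceGraph Ω).topologicalClosure

/-- `U|_∂Ω = u` in the sense of traces. -/
def HasTrace {Ω : Set (Euc d)} (U : H1 Ω) (u : L2Bdry Ω) : Prop := (U, u) ∈ traceGraph Ω

/-- `H^{1/2}(∂Ω)`, the space of traces of `H¹(Ω)` functions; as a subspace of `L²(∂Ω)` it carries
the inner product of `L²(∂Ω)`. -/
def Hhalf (Ω : Set (Euc d)) : Submodule ℝ (L2Bdry Ω) :=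
  (traceGraph Ω).map (LinearMap.snd ℝ (H1 Ω) (L2Bdry Ω))

/-- `-ΔU = f` in `Ω` in the sense of distributions, for `U ∈ H¹(Ω)`, `f ∈ L²(Ω)`. -/
def HasNegLaplacian {Ω : Set (Euc d)} (U : H1 Ω) (f : L2 Ω) : Prop :=
  ∀ Φ ∈ testSpace Ω, ⟪grad U, grad Φ⟫ = ⟪f, fn Φ⟫

/-- `U` is `Λ`-harmonic: `U ∈ H¹(Ω)` and `-ΔU = ΛU` in `Ω`. -/
def IsHarmonic {Ω : Set (Euc d)} (Λ : ℝ) (U : H1 Ω) : Prop := HasNegLaplacian U (Λ • (fn U))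

/-- `U = ℰ_Λ u`: `U` is a `Λ`-harmonic extension of `u` (unique for `Λ ∉ Spec (-Δ^Dir)`). -/
def IsHarmonicExtension {Ω : Set (Euc d)} (Λ : ℝ) (u : Hhalf Ω) (U : H1 Ω) : Prop :=
  IsHarmonic Λ U ∧ HasTrace U (u : L2Bdry Ω)

/-- `ℓ` is the (outward) normal derivative `∂_n U`, defined for `U ∈ H¹(Ω)` with `ΔU ∈ L²(Ω)` as a
functional on `H^{1/2}(∂Ω)` through Green's formula
`⟪∂_n U, V|_∂Ω⟫ = ⟪∇U, ∇V⟫ + ⟪ΔU, V⟫` for all `V ∈ H¹(Ω)`.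
(Such a functional is automatically bounded by `‖V‖_{H¹}`, so that it belongs to
`H^{-1/2}(∂Ω)`.) -/
def IsNormalDerivative {Ω : Set (Euc d)} (U : H1 Ω) (ℓ : Module.Dual ℝ (Hhalf Ω)) : Prop :=
  ∃ f : L2 Ω, HasNegLaplacian U f ∧ ∀ (V : H1 Ω) (v : Hhalf Ω), HasTrace V (v : L2Bdry Ω) →
    ℓ v = ⟪grad U, grad V⟫ - ⟪f, fn V⟫

/-! ### The Dirichlet-to-Neumann operator and its eigenvalues -/

lemma HasNegLaplacian.zero {Ω : Set (Euc d)} : HasNegLaplacian (0 : H1 Ω) 0 := by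
  intro Φ _
  simp [grad]

lemma HasNegLaplacian.add {Ω : Set (Euc d)} {U V : H1 Ω} {f g : L2 Ω} (h : HasNegLaplacian U f)
    (k : HasNegLaplacian V g) : HasNegLaplacian (U + V) (f + g) := by
  intro Φ hΦ
  have e : grad (U + V) = (grad U) + (grad V) := rfl
  rw [e, inner_add_left, inner_add_left, h Φ hΦ, k Φ hΦ]

lemma HasNegLaplacian.smul {Ω : Set (Euc d)} {U : H1 Ω} {f : L2 Ω} (c : ℝ)
    (h : HasNegLaplacian U f) : HasNegLaplacian (c • U) (c • f) := by
  intro Φ hΦ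
  have e : grad (c • U) = c • (grad U) := rfl
  rw [e, real_inner_smul_left, real_inner_smul_left, h Φ hΦ]

/-- The graph of the Dirichlet-to-Neumann operator `D_Λ : H^{1/2}(∂Ω) → H^{-1/2}(∂Ω)`,
`u ↦ ∂_n (ℰ_Λ u)`. -/
def dtnGraph (Ω : Set (Euc d)) (Λ : ℝ) : Submodule ℝ (Hhalf Ω × Module.Dual ℝ (Hhalf Ω)) where
  carrier := {p | ∃ U : H1 Ω, IsHarmonicExtension Λ p.1 U ∧ IsNormalDerivative U p.2}
  zero_mem' := by
    refine ⟨0, ⟨?_, (traceGraph Ω).zero_mem⟩, 0, HasNegLaplacian.zero, ?_⟩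
    · have := HasNegLaplacian.zero (Ω := Ω)
      simpa [IsHarmonic, fn] using this
    · intro V v _
      simp [grad]
  add_mem' := by
    rintro p q ⟨U, ⟨h1, h2⟩, f, h3, h4⟩ ⟨V, ⟨k1, k2⟩, g, k3, k4⟩
    refine ⟨U + V, ⟨?_, (traceGraph Ω).add_mem h2 k2⟩, f + g, h3.add k3, ?_⟩
    · have e : Λ • fn (U + V) = Λ • (fn U) + Λ • (fn V) := smul_add Λ (fn U) (fn V)
      simpa only [IsHarmonic, e] using HasNegLaplacian.add h1 k1
    · intro Z z hz
      have e : grad (U + V) = (grad U) + (grad V) := rfl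
      simp only [Prod.snd_add, LinearMap.add_apply, h4 Z z hz, k4 Z z hz, e, inner_add_left]
      ring
  smul_mem' := by
    rintro c p ⟨U, ⟨h1, h2⟩, f, h3, h4⟩
    refine ⟨c • U, ⟨?_, (traceGraph Ω).smul_mem c h2⟩, c • f, h3.smul c, ?_⟩
    · have e : Λ • fn (c • U) = c • (Λ • (fn U)) := smul_comm Λ c (fn U)
      simpa only [IsHarmonic, e] using HasNegLaplacian.smul c h1
    · intro Z z hz
      have e : grad (c • U) = c • (grad U) := rfl
      simp only [Prod.smul_snd, LinearMap.smul_apply, h4 Z z hz, e, real_inner_smul_left,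
        smul_eq_mul]
      ring

/-- The embedding `H^{1/2}(∂Ω) → H^{-1/2}(∂Ω)`, `u ↦ ⟪u, ·⟫_{L²(∂Ω)}`. -/
def bdryPairing (Ω : Set (Euc d)) : Hhalf Ω →ₗ[ℝ] Module.Dual ℝ (Hhalf Ω) := innerₗ (Hhalf Ω)

/-- The space of solutions `u ∈ H^{1/2}(∂Ω)` of `D_Λ u = σ u`. -/
def dtnEigenspace (Ω : Set (Euc d)) (Λ σ : ℝ) : Submodule ℝ (Hhalf Ω) :=
  (dtnGraph Ω Λ).comap (LinearMap.prod LinearMap.id (σ • bdryPairing Ω))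

/-- `σ_k^{(Λ)}`, `k = 1, 2, …`: the `k`-th eigenvalue of `D_Λ`, in increasing order and with account
of multiplicities, i.e. the least `s` for which the eigenspaces of `D_Λ` for the eigenvalues
`τ ≤ s` together span a space of dimension at least `k`. -/
def dtnEigenvalue (Ω : Set (Euc d)) (Λ : ℝ) (k : ℕ+) : ℝ :=
  sInf {s : ℝ | ((k : ℕ) : Cardinal) ≤
    Module.rank ℝ (⨆ τ ∈ Set.Iic s, dtnEigenspace Ω Λ τ : Submodule ℝ (Hhalf Ω))}

end DtN

end

/-! Take the Hilbert space of `H¹` functions together with their trace, with squared norm ‖U‖² +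
‖∇U‖² + ‖U|∂Ω‖², and let J and γ send such a pair to the function and to the trace. The form ⟪∇U,
∇V⟫ - Λ⟪U, V⟫ - σ⟪U, V⟫_∂Ω is then represented by the bounded self-adjoint operator P(Λ, σ) = 1 - (1
+ Λ) J†J - (1 + σ) γ†γ, and by Green's formula the eigenspace of the Dirichlet-to-Neumann operator
at σ is γ(ker P(Λ, σ)) (`mem_dtnEigenspace_iff`). Both parameters enter affinely. The abstract
argument only needs J and γ to be completely continuous (`IsBoundedLipschitzDomain.cc_fnL`,
`IsBoundedLipschitzDomain.cc_traceL`) and ker γ to be `H¹₀`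
(`IsBoundedLipschitzDomain.mem_H10_of_hasTrace_zero`).

Continuity. Off the Dirichlet spectrum the Robin form P(Λ, -s) is coercive on Λ-harmonic elements,
with one large s for all Λ near Λ₀. So (D_Λ + s)⁻¹ = γ P(Λ, -s)⁻¹ γ† is a compact self-adjoint
operator that is norm continuous in Λ, and counting its eigenvalues shows that each σ_k is
continuous (`tendsto_eigVal`).

Derivatives. Near a simple eigenvalue (Λ₀, σ₀) with eigenfunction U₀, add to P the rank one operator
⟪w, ·⟫ w with w = γ†γU₀; the sum B is invertible. Eigenvalue pairs near (Λ₀, σ₀) satisfy F = ⟪B⁻¹w,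
w⟫ = 1, where F is smooth with partial derivatives ‖J S‖² and ‖γ S‖² for S = B⁻¹w. The implicit
function theorem gives a smooth curve, which continuity identifies with σ_k, so σ_k' = -‖J S‖²/‖γ
S‖². A further differentiation gives σ_k'' = -2⟪J Z, J U₀⟫, where Z is the derivative of S along the
curve (`eigVal_derivatives`). Subtracting from Z the Dirichlet resolvent applied to J U₀ leaves a
Λ₀-harmonic element. Its expansion in the U_j (`hasSum_eigenfunctions`) has coefficients ⟪J U_j, J
U_k⟫/(σ_j - σ_k), which is the stated series (`eigVal_derivatives_series`).

Concavity. Below the first Dirichlet eigenvalue, σ₁ is the minimum of ‖∇U‖² - Λ‖U‖² over U with unit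
trace (`exists_minimizer`), hence a minimum of affine functions of Λ. -/

noncomputable section

namespace DtN

/-! ### Weak limits along an ultrafilter and completely continuous operators -/

section WeakLimits

variable {X Y Z : Type*} [NormedAddCommGroup X] [InnerProductSpace ℝ X]
  [NormedAddCommGroup Y] [InnerProductSpace ℝ Y]
  [NormedAddCommGroup Z] [InnerProductSpace ℝ Z]

/-- A bounded sequence which converges weakly to `x₀` along a fixed free ultrafilter on `ℕ`. -/
def WeakLim (x : ℕ → X) (x₀ : X) : Prop :=
  (∃ C, ∀ n, ‖x n‖ ≤ C) ∧
    ∀ v, Tendsto (fun n => ⟪x n, v⟫) (hyperfilter ℕ : Filter ℕ) (𝓝 ⟪x₀, v⟫)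

/-- An ultrafilter on a compact interval converges. Working along one fixed ultrafilter makes every
bounded sequence converge, so no subsequences are ever extracted. -/
lemma exists_tendsto_hyperfilter {f : ℕ → ℝ} {C : ℝ} (h : ∀ n, |f n| ≤ C) :
    ∃ l, Tendsto f (hyperfilter ℕ : Filter ℕ) (𝓝 l) := by
  have hc : IsCompact (Set.Icc (-C) C) := isCompact_Icc
  obtain ⟨l, -, hl⟩ := hc.ultrafilter_le_nhds ((hyperfilter ℕ).map f) (by
    rw [Ultrafilter.coe_map, le_principal_iff, mem_map]
    exact univ_mem' fun n => abs_le.1 (h n))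
  exact ⟨l, hl⟩

/-- The pointwise limits of the functionals ⟪x n, ·⟫ form a linear functional bounded by C, which
the Riesz theorem represents by a vector. -/
lemma exists_weakLim [CompleteSpace X] {x : ℕ → X} {C : ℝ} (h : ∀ n, ‖x n‖ ≤ C) :
    ∃ x₀, WeakLim x x₀ := by
  have hb : ∀ v n, |⟪x n, v⟫| ≤ C * ‖v‖ := fun v n =>
    (abs_real_inner_le_norm _ _).trans (mul_le_mul_of_nonneg_right (h n) (norm_nonneg _))
  choose l hl using fun v => exists_tendsto_hyperfilter (hb v)
  let f : X →ₗ[ℝ] ℝ :=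
    { toFun := l
      map_add' := fun v w => tendsto_nhds_unique (hl (v + w)) <| by
        simpa only [inner_add_right] using (hl v).add (hl w)
      map_smul' := fun c v => tendsto_nhds_unique (hl (c • v)) <| by
        simpa only [inner_smul_right, smul_eq_mul, RingHom.id_apply] using (hl v).const_mul c }
  let F : X →L[ℝ] ℝ := f.mkContinuous C fun v => by
    refine le_of_tendsto (hl v).abs (Eventually.of_forall fun n => ?_)
    exact hb v n
  refine ⟨(InnerProductSpace.toDual ℝ X).symm F, ⟨C, h⟩, fun v => ?_⟩
  rw [InnerProductSpace.toDual_symm_apply]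
  exact hl v

lemma WeakLim.norm_le {x : ℕ → X} {x₀ : X} (h : WeakLim x x₀) {C : ℝ} (hC : ∀ n, ‖x n‖ ≤ C) :
    ‖x₀‖ ≤ C := by
  have h1 : ⟪x₀, x₀⟫ ≤ C * ‖x₀‖ := le_of_tendsto (h.2 x₀) (Eventually.of_forall fun n =>
    (real_inner_le_norm _ _).trans (mul_le_mul_of_nonneg_right (hC n) (norm_nonneg _)))
  rw [real_inner_self_eq_norm_sq] at h1
  by_contra! hlt
  have : 0 ≤ C := (norm_nonneg _).trans (hC 0)
  nlinarith

lemma WeakLim.mem {x : ℕ → X} {x₀ : X} (h : WeakLim x x₀) {P : Submodule ℝ X}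
    [P.HasOrthogonalProjection] (hP : ∀ n, x n ∈ P) : x₀ ∈ P := by
  rw [← P.orthogonal_orthogonal, Submodule.mem_orthogonal']
  intro v hv
  refine tendsto_nhds_unique (h.2 v) ?_
  simp_rw [fun n => (Submodule.mem_orthogonal P v).1 hv _ (hP n)]
  exact tendsto_const_nhds

lemma WeakLim.eq_of_tendsto {x : ℕ → X} {x₀ y : X} (h : WeakLim x x₀)
    (hy : Tendsto x (hyperfilter ℕ : Filter ℕ) (𝓝 y)) : x₀ = y := by
  refine ext_inner_right ℝ fun v => tendsto_nhds_unique (h.2 v) ?_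
  exact hy.inner tendsto_const_nhds

lemma WeakLim.tendsto_inner {x y : ℕ → X} {x₀ y₀ : X} (h : WeakLim x x₀)
    (hy : Tendsto y (hyperfilter ℕ : Filter ℕ) (𝓝 y₀)) :
    Tendsto (fun n => ⟪x n, y n⟫) (hyperfilter ℕ : Filter ℕ) (𝓝 ⟪x₀, y₀⟫) := by
  obtain ⟨C, hC⟩ := h.1
  have h1 : Tendsto (fun n => ⟪x n, y n - y₀⟫) (hyperfilter ℕ : Filter ℕ) (𝓝 0) := by
    refine squeeze_zero_norm (a := fun n => C * ‖y n - y₀‖) (fun n =>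
      (norm_inner_le_norm _ _).trans (mul_le_mul_of_nonneg_right (hC n) (norm_nonneg _))) ?_
    simpa using (tendsto_iff_norm_sub_tendsto_zero.1 hy).const_mul C
  have := h1.add (h.2 y₀)
  simpa [← inner_add_right] using this

lemma WeakLim.map [CompleteSpace X] [CompleteSpace Y] {x : ℕ → X} {x₀ : X} (h : WeakLim x x₀)
    (T : X →L[ℝ] Y) : WeakLim (fun n => T (x n)) (T x₀) := by
  refine ⟨?_, fun v => ?_⟩
  · obtain ⟨C, hC⟩ := h.1
    exact ⟨‖T‖ * C, fun n => (T.le_opNorm _).trans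
      (mul_le_mul_of_nonneg_left (hC n) (norm_nonneg _))⟩
  · simp_rw [← ContinuousLinearMap.adjoint_inner_right]
    exact h.2 _

/-- Completely continuous operators: they map weakly convergent bounded sequences to convergent
ones. -/
def CC (T : X →L[ℝ] Y) : Prop :=
  ∀ x x₀, WeakLim x x₀ → Tendsto (fun n => T (x n)) (hyperfilter ℕ : Filter ℕ) (𝓝 (T x₀))

lemma CC.comp_left {T : X →L[ℝ] Y} (hT : CC T) (A : Y →L[ℝ] Z) : CC (A ∘L T) :=
  fun x x₀ h => (A.continuous.tendsto _).comp (hT x x₀ h)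

lemma CC.comp_right [CompleteSpace X] [CompleteSpace Y] {T : Y →L[ℝ] Z} (hT : CC T)
    (A : X →L[ℝ] Y) : CC (T ∘L A) :=
  fun _ _ h => hT _ _ (h.map A)

lemma CC.add {T S : X →L[ℝ] Y} (hT : CC T) (hS : CC S) : CC (T + S) :=
  fun x x₀ h => (hT x x₀ h).add (hS x x₀ h)

lemma CC.smul {T : X →L[ℝ] Y} (hT : CC T) (c : ℝ) : CC (c • T) :=
  fun x x₀ h => (hT x x₀ h).const_smul c

lemma CC.rankOne (g : X) (w : Y) : CC ((innerSL ℝ g).smulRight w) := by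
  intro x x₀ h
  have := (h.2 g).smul_const w
  simpa [real_inner_comm] using this

/-- An operator is completely continuous if it is bounded, up to a small multiple of the norm, by
weakly sequentially continuous functions. -/
lemma CC.of_norm_sq_le_add {T : X →L[ℝ] Y} (h : ∀ ε > 0, ∃ q : X → ℝ,
    (∀ x x₀, WeakLim x x₀ →
      Tendsto (fun n => q (x n - x₀)) (hyperfilter ℕ : Filter ℕ) (𝓝 0)) ∧
    ∀ x, ‖T x‖ ^ 2 ≤ ε * ‖x‖ ^ 2 + q x) : CC T := by
  intro x x₀ hx
  obtain ⟨B, hB⟩ := hx.1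
  have hB0 : 0 ≤ B := (norm_nonneg _).trans (hB 0)
  rw [tendsto_iff_norm_sub_tendsto_zero]
  have key : Tendsto (fun n => ‖T (x n) - T x₀‖ ^ 2) (hyperfilter ℕ : Filter ℕ) (𝓝 0) := by
    rw [Metric.tendsto_nhds]
    intro ε hε
    -- Since ‖x n - x₀‖ ≤ 2B, this weight makes the norm term at most ε/2; the `+ 1` only keeps the
    -- denominator positive.
    obtain ⟨q, hq, hC⟩ := h (ε / (2 * ((2 * B) ^ 2 + 1))) (by positivity)
    filter_upwards [Metric.tendsto_nhds.1 (hq x x₀ hx) (ε / 2) (by positivity)] with n hn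
    rw [Real.dist_eq, sub_zero] at hn ⊢
    rw [abs_of_nonneg (by positivity), ← map_sub]
    have h2 := hC (x n - x₀)
    have h3 : ‖x n - x₀‖ ^ 2 ≤ (2 * B) ^ 2 := by
      gcongr
      have := norm_sub_le (x n) x₀
      have := hB n
      have := hx.norm_le hB
      linarith
    have h4 : ε / (2 * ((2 * B) ^ 2 + 1)) * ‖x n - x₀‖ ^ 2 ≤ ε / 2 := by
      rw [div_mul_eq_mul_div, div_le_div_iff₀ (by positivity) (by positivity)]
      nlinarith
    have := (abs_lt.1 hn).2
    linarith
  have := key.sqrt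
  simpa [Real.sqrt_sq] using this

/-- Ehrling's inequality turned around: compactness passes from J to any T that J controls up to an
arbitrarily small multiple of the norm. The trace inherits compactness from the embedding into `L²`
in this way. -/
lemma CC.of_norm_sq_le {T : X →L[ℝ] Y} {J : X →L[ℝ] Z} (hJ : CC J)
    (h : ∀ ε > 0, ∃ C, ∀ x, ‖T x‖ ^ 2 ≤ ε * ‖x‖ ^ 2 + C * ‖J x‖ ^ 2) : CC T := by
  refine CC.of_norm_sq_le_add fun ε hε => ?_
  obtain ⟨C, hC⟩ := h ε hε
  refine ⟨fun x => C * ‖J x‖ ^ 2, fun x x₀ hx => ?_, hC⟩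
  simp only [map_sub]
  simpa using ((tendsto_iff_norm_sub_tendsto_zero.1 (hJ x x₀ hx)).pow 2).const_mul C

/-! ### Self-adjoint completely continuous operators: Fredholm alternative and Rayleigh quotients -/

lemma isSelfAdjoint_of_inner [CompleteSpace X] {A : X →L[ℝ] X}
    (h : ∀ x y, ⟪A x, y⟫ = ⟪x, A y⟫) : IsSelfAdjoint A :=
  ContinuousLinearMap.isSelfAdjoint_iff_isSymmetric.2 h

lemma _root_.IsSelfAdjoint.inner_map_comm [CompleteSpace X] {A : X →L[ℝ] X}
    (hA : IsSelfAdjoint A) (x y : X) : ⟪A x, y⟫ = ⟪x, A y⟫ :=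
  ContinuousLinearMap.isSelfAdjoint_iff_isSymmetric.1 hA x y

/-- A form which is nonnegative on a subspace and vanishes at `w` is degenerate at `w`. -/
lemma inner_eq_zero_of_nonneg [CompleteSpace X] {A : X →L[ℝ] X} (hA : IsSelfAdjoint A)
    {P : Submodule ℝ X} (h : ∀ x ∈ P, 0 ≤ ⟪A x, x⟫) {w : X} (hw : w ∈ P) (h0 : ⟪A w, w⟫ ≤ 0) :
    ∀ v ∈ P, ⟪A w, v⟫ = 0 := by
  intro v hv
  -- The quadratic polynomial t ↦ ⟪A(w + tv), w + tv⟫ is nonnegative and its constant term is at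
  -- most 0, so its discriminant forces the linear coefficient to vanish.
  have h1 : ∀ t : ℝ, 0 ≤ ⟪A v, v⟫ * (t * t) + 2 * ⟪A w, v⟫ * t + 0 := fun t => by
    have h2 := h (w + t • v) (P.add_mem hw (P.smul_mem t hv))
    have h3 : ⟪A v, w⟫ = ⟪A w, v⟫ := by
      rw [real_inner_comm, ← ContinuousLinearMap.adjoint_inner_left, hA.adjoint_eq]
    simp only [map_add, map_smul, inner_add_left, inner_add_right, inner_smul_left,
      inner_smul_right, h3, RCLike.conj_to_real] at h2
    linarith
  have := discrim_le_zero h1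
  simp only [discrim] at this
  nlinarith [sq_nonneg ⟪A w, v⟫]

/-- Completely continuous perturbations of the identity: Fredholm alternative. -/
lemma isUnit_one_sub_of_injective [CompleteSpace X] {C : X →L[ℝ] X} (hC : CC C)
    (hs : IsSelfAdjoint C) (hi : ∀ x, C x = x → x = 0) : IsUnit (1 - C) := by
  -- Injectivity improves to a lower bound: unit vectors y n with (1 - C) y n → 0 converge strongly
  -- to C y₀, where y₀ is their weak limit. Then y₀ = C y₀ = 0, which contradicts ‖y n‖ = 1.
  have hb : ∃ c > 0, ∀ x, c * ‖x‖ ≤ ‖(1 - C) x‖ := by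
    by_contra! hcon
    choose x hx using fun n : ℕ => hcon (1 / ((n : ℝ) + 1)) (by positivity)
    have hne : ∀ n, x n ≠ 0 := fun n h => by
      have := hx n
      simp [h] at this
    let y : ℕ → X := fun n => ‖x n‖⁻¹ • x n
    have hy : ∀ n, ‖y n‖ = 1 := fun n => norm_smul_inv_norm (𝕜 := ℝ) (hne n)
    obtain ⟨y₀, hy₀⟩ := exists_weakLim (x := y) (C := 1) fun n => (hy n).le
    have h1 : Tendsto (fun n => (1 - C) (y n)) (hyperfilter ℕ : Filter ℕ) (𝓝 0) := by
      have h0 : Tendsto (fun n : ℕ => 1 / ((n : ℝ) + 1)) (hyperfilter ℕ : Filter ℕ) (𝓝 0) :=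
        tendsto_one_div_add_atTop_nhds_zero_nat.mono_left Nat.hyperfilter_le_atTop
      refine squeeze_zero_norm (fun n => ?_) h0
      have := hx n
      have hpos : 0 < ‖x n‖ := norm_pos_iff.2 (hne n)
      simp only [y, map_smul, norm_smul, norm_inv, norm_norm]
      rw [inv_mul_le_iff₀ hpos]
      linarith
    have h2 : Tendsto y (hyperfilter ℕ : Filter ℕ) (𝓝 (C y₀)) := by
      have := h1.add (hC y y₀ hy₀)
      simpa using this
    have h3 : y₀ = 0 := hi _ (hy₀.eq_of_tendsto h2).symm
    have h4 := h2.norm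
    simp only [hy, h3, map_zero, norm_zero] at h4
    exact one_ne_zero (tendsto_nhds_unique tendsto_const_nhds h4)
  obtain ⟨c, hc, hb⟩ := hb
  rw [ContinuousLinearMap.isUnit_iff_bijective]
  have hanti : AntilipschitzWith (Real.toNNReal c⁻¹) (1 - C : X →L[ℝ] X) :=
    ContinuousLinearMap.antilipschitz_of_bound _ fun x => by
      rw [Real.coe_toNNReal _ (by positivity), ← div_eq_inv_mul, le_div_iff₀ hc, mul_comm]
      exact hb x
  refine ⟨hanti.injective, ?_⟩
  have hcl : IsClosed (Set.range (1 - C : X →L[ℝ] X)) :=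
    hanti.isClosed_range (1 - C : X →L[ℝ] X).uniformContinuous
  -- The orthogonal complement of the range is the kernel of the adjoint, which is 1 - C again.
  have hr : (1 - C : X →L[ℝ] X).range.topologicalClosure = ⊤ := by
    rw [Submodule.topologicalClosure_eq_top_iff, ContinuousLinearMap.orthogonal_range,
      LinearMap.ker_eq_bot]
    have : ContinuousLinearMap.adjoint (1 - C : X →L[ℝ] X) = 1 - C := by
      have h1 : IsSelfAdjoint (1 - C : X →L[ℝ] X) := (IsSelfAdjoint.one _).sub hs
      exact h1.adjoint_eq
    rw [this]
    exact hanti.injective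
  intro y
  have : y ∈ (1 - C : X →L[ℝ] X).range := by
    have h1 : IsClosed ((1 - C : X →L[ℝ] X).range : Set X) := hcl
    rw [← h1.submodule_topologicalClosure_eq, hr]
    trivial
  exact this

/-- A completely continuous self-adjoint operator with a positive value of the Rayleigh quotient
on a closed invariant subspace has an eigenvalue at least as large there. -/
lemma exists_eigenvector_ge [CompleteSpace X] {R : X →L[ℝ] X} (hR : CC R)
    (hs : IsSelfAdjoint R) {P : Submodule ℝ X} [P.HasOrthogonalProjection]
    (hP : ∀ x ∈ P, R x ∈ P) {t : ℝ} (ht : 0 < t) {x : X} (hx : x ∈ P) (hx0 : x ≠ 0)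
    (hxt : t * ‖x‖ ^ 2 ≤ ⟪R x, x⟫) : ∃ μ ≥ t, ∃ w ∈ P, w ≠ 0 ∧ R w = μ • w := by
  -- The supremum is taken over the unit ball and not the sphere, because the weak limit of a
  -- maximising sequence is only known to lie in the ball.
  obtain ⟨S, hS⟩ : ∃ S : Set ℝ, S = (fun y => ⟪R y, y⟫) '' {y | y ∈ P ∧ ‖y‖ ≤ 1} := ⟨_, rfl⟩
  have hbd : BddAbove S := by
    refine ⟨‖R‖, ?_⟩
    rw [hS]
    rintro _ ⟨y, ⟨-, hy⟩, rfl⟩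
    refine (real_inner_le_norm _ _).trans ?_
    have h1 := R.le_opNorm y
    have h2 := norm_nonneg R
    have h3 := norm_nonneg y
    calc ‖R y‖ * ‖y‖ ≤ ‖R‖ * ‖y‖ * ‖y‖ := by gcongr
      _ ≤ ‖R‖ * 1 * 1 := by gcongr
      _ = ‖R‖ := by ring
  have hle : ∀ y ∈ P, ⟪R y, y⟫ ≤ sSup S * ‖y‖ ^ 2 := by
    intro y hy
    by_cases h0 : y = 0
    · simp [h0]
    have hn : 0 < ‖y‖ := norm_pos_iff.2 h0
    have h1 : ⟪R (‖y‖⁻¹ • y), ‖y‖⁻¹ • y⟫ ≤ sSup S := by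
      refine le_csSup hbd (hS ▸ ⟨_, ⟨P.smul_mem _ hy, ?_⟩, rfl⟩)
      exact (norm_smul_inv_norm (𝕜 := ℝ) h0).le
    rw [map_smul, real_inner_smul_left, real_inner_smul_right, ← mul_assoc, ← sq, inv_pow,
      inv_mul_le_iff₀ (by positivity)] at h1
    linarith
  have hne : S.Nonempty := hS ▸ ⟨_, 0, ⟨P.zero_mem, by simp⟩, rfl⟩
  have htS : t ≤ sSup S := by
    have h1 := hxt.trans (hle x hx)
    have : 0 < ‖x‖ ^ 2 := by positivity
    exact le_of_mul_le_mul_right h1 this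
  obtain ⟨a, -, ha, haS⟩ := exists_seq_tendsto_sSup hne hbd
  have haS' : ∀ n, ∃ y, y ∈ P ∧ ‖y‖ ≤ 1 ∧ ⟪R y, y⟫ = a n := fun n => by
    obtain ⟨y, ⟨h1, h2⟩, h3⟩ := hS ▸ haS n
    exact ⟨y, h1, h2, h3⟩
  choose y hyP hy1 hya using haS'
  obtain ⟨w, hw⟩ := exists_weakLim hy1
  have hwP : w ∈ P := hw.mem hyP
  have hw1 : ‖w‖ ≤ 1 := hw.norm_le hy1
  have hwS : ⟪R w, w⟫ = sSup S := by
    have h1 := hw.tendsto_inner (hR y w hw)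
    rw [real_inner_comm]
    refine tendsto_nhds_unique h1 ((ha.mono_left Nat.hyperfilter_le_atTop).congr fun n => ?_)
    rw [← hya n, real_inner_comm]
  -- Positivity of t is what keeps the maximiser away from 0.
  have hw0 : w ≠ 0 := by
    rintro rfl
    simp at hwS
    linarith
  refine ⟨sSup S, htS, w, hwP, hw0, ?_⟩
  have hA : IsSelfAdjoint (sSup S • (1 : X →L[ℝ] X) - R) := isSelfAdjoint_of_inner fun u v => by
    simp [inner_sub_left, inner_sub_right, real_inner_smul_left, real_inner_smul_right,
      hs.inner_map_comm]
  -- The form of sSup S - R is nonnegative on P and vanishes at w, so (sSup S) w - R w is orthogonal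
  -- to P. It lies in P by invariance, hence is 0.
  have h2 := inner_eq_zero_of_nonneg hA (P := P) (fun z hz => by
    have := hle z hz
    simp [inner_sub_left, real_inner_smul_left]
    linarith) hwP (by
      simp only [sub_apply, smul_apply, one_apply_eq_self, inner_sub_left, real_inner_smul_left,
        hwS, real_inner_self_eq_norm_sq]
      have h5 : ‖w‖ ^ 2 ≤ 1 := pow_le_one₀ (norm_nonneg w) hw1
      nlinarith)
  have h3 : sSup S • w - R w = 0 := by
    rw [← inner_self_eq_zero (𝕜 := ℝ)]
    exact h2 _ (P.sub_mem (P.smul_mem _ hwP) (hP w hwP))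
  exact (sub_eq_zero.1 h3).symm

end WeakLimits

end DtN

end

noncomputable section

namespace DtN

/-! ### Counting eigenvalues of completely continuous self-adjoint operators -/

section Counting

variable {X : Type*} [NormedAddCommGroup X] [InnerProductSpace ℝ X]

/-- The span of the eigenspaces for the eigenvalues `μ ≥ t`. -/
def specGE (R : X →L[ℝ] X) (t : ℝ) : Submodule ℝ X :=
  ⨆ μ ∈ Set.Ici t, Module.End.eigenspace (R : X →ₗ[ℝ] X) μ

lemma mem_specGE {R : X →L[ℝ] X} {t μ : ℝ} (h : t ≤ μ) {x : X} (hx : R x = μ • x) :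
    x ∈ specGE R t :=
  Submodule.mem_iSup_of_mem μ (Submodule.mem_iSup_of_mem h (Module.End.mem_eigenspace_iff.2 hx))

lemma map_mem_specGE {R : X →L[ℝ] X} {t : ℝ} {x : X} (hx : x ∈ specGE R t) :
    R x ∈ specGE R t := by
  have : specGE R t ≤ (specGE R t).comap (R : X →ₗ[ℝ] X) := by
    refine iSup₂_le fun μ hμ y hy => ?_
    have hy' : R y = μ • y := Module.End.mem_eigenspace_iff.1 hy
    show R y ∈ specGE R t
    rw [hy']
    exact Submodule.smul_mem _ _ (mem_specGE hμ hy')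
  exact this hx

/-- Eigenvectors for distinct eigenvalues are orthogonal, so the Rayleigh quotient is a weighted
mean of eigenvalues that are all at least t. -/
lemma inner_ge_of_mem_specGE [CompleteSpace X] {R : X →L[ℝ] X} (hs : IsSelfAdjoint R) {t : ℝ}
    {x : X} (hx : x ∈ specGE R t) : t * ‖x‖ ^ 2 ≤ ⟪R x, x⟫ := by
  obtain ⟨f, hf, rfl⟩ := (Submodule.mem_iSup_iff_exists_finsupp _ x).1 hx
  have h1 : ∀ μ, R (f μ) = μ • f μ ∧ (t ≤ μ ∨ f μ = 0) := fun μ => by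
    by_cases h : μ ∈ Set.Ici t
    · have := hf μ
      simp only [h, iSup_pos] at this
      exact ⟨Module.End.mem_eigenspace_iff.1 this, Or.inl h⟩
    · have := hf μ
      simp only [h, iSup_false, Submodule.mem_bot] at this
      simp [this]
  have h2 : ∀ μ ν, μ ≠ ν → ⟪f μ, f ν⟫ = 0 := fun μ ν hne => by
    have h3 := hs.inner_map_comm (f μ) (f ν)
    rw [(h1 μ).1, (h1 ν).1, real_inner_smul_left, real_inner_smul_right] at h3
    have : (μ - ν) * ⟪f μ, f ν⟫ = 0 := by linarith
    exact (mul_eq_zero.1 this).resolve_left (sub_ne_zero.2 hne)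
  have h3 : ∀ c : ℝ → ℝ, ⟪∑ μ ∈ f.support, c μ • f μ, ∑ ν ∈ f.support, f ν⟫
      = ∑ μ ∈ f.support, c μ * ‖f μ‖ ^ 2 := fun c => by
    rw [sum_inner]
    refine Finset.sum_congr rfl fun μ hμ => ?_
    rw [inner_sum, Finset.sum_eq_single μ]
    · rw [real_inner_smul_left, real_inner_self_eq_norm_sq]
    · intro ν _ hne
      rw [real_inner_smul_left, h2 μ ν hne.symm, mul_zero]
    · exact fun h => absurd hμ h
  simp only [Finsupp.sum, map_sum]
  rw [Finset.sum_congr rfl fun μ _ => (h1 μ).1, h3, ← real_inner_self_eq_norm_sq]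
  have h4 := h3 fun _ => 1
  simp only [one_smul, one_mul] at h4
  rw [h4, Finset.mul_sum]
  refine Finset.sum_le_sum fun μ _ => ?_
  rcases (h1 μ).2 with h | h
  · gcongr
  · simp [h]

/-- Stability of the count under perturbations in norm. If `specGE R' t'` had dimension below n,
some nonzero vector of `specGE R t` would be orthogonal to it. The Rayleigh quotient of R' there is
at least t - ‖R - R'‖ ≥ t' > 0, so R' would have an eigenvalue at least t' in the orthogonal
complement, although all such eigenvectors already lie in `specGE R' t'`. -/
lemma le_rank_specGE [CompleteSpace X] {R R' : X →L[ℝ] X} (hs : IsSelfAdjoint R)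
    (hs' : IsSelfAdjoint R') (hR' : CC R') {t t' : ℝ} (ht' : 0 < t') (htt : t' ≤ t - ‖R - R'‖)
    {n : ℕ} (hn : (n : Cardinal) ≤ Module.rank ℝ (specGE R t)) :
    (n : Cardinal) ≤ Module.rank ℝ (specGE R' t') := by
  by_contra! hlt
  have hfin : Module.Finite ℝ (specGE R' t') :=
    Module.rank_lt_aleph0_iff.1 (hlt.trans Cardinal.natCast_lt_aleph0)
  obtain ⟨v, hv⟩ := Module.le_rank_iff.1 hn
  let A : (Fin n → ℝ) →ₗ[ℝ] X := (specGE R t).subtype ∘ₗ Fintype.linearCombination ℝ v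
  have hA : Function.Injective A := by
    refine (Submodule.subtype_injective _).comp ?_
    exact hv.fintypeLinearCombination_injective
  let Pr : X →ₗ[ℝ] specGE R' t' := ((specGE R' t').orthogonalProjectionOnto : X →ₗ[ℝ] specGE R' t')
  have hlt' : Module.finrank ℝ (specGE R' t') < Module.finrank ℝ (Fin n → ℝ) := by
    rw [Module.finrank_fin_fun]
    rw [← Module.finrank_eq_rank] at hlt
    exact_mod_cast hlt
  obtain ⟨c, hc, hc0⟩ := Submodule.exists_mem_ne_zero_of_ne_bot
    (LinearMap.ker_ne_bot_of_finrank_lt (f := Pr ∘ₗ A) hlt')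
  have hx0 : A c ≠ 0 := fun h => hc0 (hA (h.trans (map_zero A).symm))
  have hxF : A c ∈ (specGE R' t')ᗮ := by
    rw [← Submodule.orthogonalProjectionOnto_eq_zero_iff]
    exact hc
  have hxR : A c ∈ specGE R t := Submodule.coe_mem _
  have h1 := inner_ge_of_mem_specGE hs hxR
  have h2 : t' * ‖A c‖ ^ 2 ≤ ⟪R' (A c), A c⟫ := by
    have h3 : ⟪(R - R') (A c), A c⟫ ≤ ‖R - R'‖ * ‖A c‖ ^ 2 := by
      refine (real_inner_le_norm _ _).trans ?_
      rw [sq, ← mul_assoc]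
      exact mul_le_mul_of_nonneg_right ((R - R').le_opNorm _) (norm_nonneg _)
    rw [sub_apply, inner_sub_left] at h3
    have : t' * ‖A c‖ ^ 2 ≤ (t - ‖R - R'‖) * ‖A c‖ ^ 2 := by gcongr
    linarith
  obtain ⟨μ, hμ, w, hw, hw0, hRw⟩ := exists_eigenvector_ge hR' hs' (P := (specGE R' t')ᗮ)
    (fun y hy => by
      rw [Submodule.mem_orthogonal'] at hy ⊢
      intro z hz
      rw [hs'.inner_map_comm]
      exact hy _ (map_mem_specGE hz)) ht' hxF hx0 h2
  exact hw0 (inner_self_eq_zero (𝕜 := ℝ) |>.1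
    ((Submodule.mem_orthogonal _ _).1 hw _ (mem_specGE hμ hRw)))

end Counting

/-! ### The two-parameter pencil `1 - (1 + Λ) J†J - (1 + σ) γ†γ` -/

section Pencil

set_option linter.unusedSectionVars false

variable {G H B : Type*} [NormedAddCommGroup G] [InnerProductSpace ℝ G] [CompleteSpace G]
  [NormedAddCommGroup H] [InnerProductSpace ℝ H] [CompleteSpace H]
  [NormedAddCommGroup B] [InnerProductSpace ℝ B] [CompleteSpace B]
  {J : G →L[ℝ] H} {γ : G →L[ℝ] B} {Λ Λ₀ σ τ s : ℝ}

/-- The operator of the form `⟪U, V⟫ - (1 + Λ) ⟪J U, J V⟫ - (1 + σ) ⟪γ U, γ V⟫`. -/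
def pencil (J : G →L[ℝ] H) (γ : G →L[ℝ] B) (Λ σ : ℝ) : G →L[ℝ] G :=
  1 - ((1 + Λ) • (J.adjoint ∘L J) + (1 + σ) • (γ.adjoint ∘L γ))

lemma inner_pencil (U V : G) : ⟪pencil J γ Λ σ U, V⟫
    = ⟪U, V⟫ - (1 + Λ) * ⟪J U, J V⟫ - (1 + σ) * ⟪γ U, γ V⟫ := by
  simp only [pencil, sub_apply, add_apply, smul_apply, one_apply_eq_self, inner_sub_left,
    inner_add_left, real_inner_smul_left, ContinuousLinearMap.coe_comp, Function.comp_apply,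
    ContinuousLinearMap.adjoint_inner_left]
  ring

lemma isSelfAdjoint_pencil : IsSelfAdjoint (pencil J γ Λ σ) :=
  isSelfAdjoint_of_inner fun U V => by
    rw [real_inner_comm (pencil J γ Λ σ V) U, inner_pencil, inner_pencil, real_inner_comm U V,
      real_inner_comm (J U) (J V), real_inner_comm (γ U) (γ V)]

lemma isUnit_pencil (hJ : CC J) (hγ : CC γ) (h : ∀ U, pencil J γ Λ σ U = 0 → U = 0) :
    IsUnit (pencil J γ Λ σ) := by
  refine isUnit_one_sub_of_injective (((hJ.comp_left _).smul _).add ((hγ.comp_left _).smul _)) ?_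
    fun U hU => h U ?_
  · have h1 : IsSelfAdjoint (pencil J γ Λ σ) := isSelfAdjoint_pencil
    refine isSelfAdjoint_of_inner fun U V => ?_
    have h2 := h1.inner_map_comm U V
    simp only [pencil, sub_apply, one_apply_eq_self, inner_sub_left, inner_sub_right] at h2
    linarith
  · rw [pencil, sub_apply, hU, one_apply_eq_self, sub_self]

/-- `U` satisfies the equation with parameter `Λ` in the interior. -/
def IsHarm (J : G →L[ℝ] H) (γ : G →L[ℝ] B) (Λ : ℝ) (U : G) : Prop :=
  ∀ V, γ V = 0 → ⟪U, V⟫ = (1 + Λ) * ⟪J U, J V⟫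

/-- The interior problem with parameter `Λ` and zero boundary values has no nonzero solution. -/
def Regular (J : G →L[ℝ] H) (γ : G →L[ℝ] B) (Λ : ℝ) : Prop :=
  ∀ U, γ U = 0 → IsHarm J γ Λ U → U = 0

lemma isHarm_of_pencil_eq_zero {U : G} (h : pencil J γ Λ σ U = 0) : IsHarm J γ Λ U := by
  intro V hV
  have := inner_pencil (J := J) (γ := γ) (Λ := Λ) (σ := σ) U V
  rw [h, hV, inner_zero_left, inner_zero_right] at this
  linarith

lemma IsHarm.sub {U V : G} (hU : IsHarm J γ Λ U) (hV : IsHarm J γ Λ V) :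
    IsHarm J γ Λ (U - V) := by
  intro W hW
  rw [map_sub, inner_sub_left, inner_sub_left, hU W hW, hV W hW]
  ring

lemma IsHarm.smul {U : G} (hU : IsHarm J γ Λ U) (c : ℝ) : IsHarm J γ Λ (c • U) := by
  intro W hW
  rw [map_smul, real_inner_smul_left, real_inner_smul_left, hU W hW]
  ring

/-- Proved by compactness, so that the constant is uniform in Λ near Λ₀. Normalised counterexamples
with constants n + 1 and parameters tending to Λ₀ converge weakly to a Λ₀-harmonic element with zero
trace. It vanishes by regularity, yet its image under J has squared norm at least ε. -/
lemma norm_sq_le_of_isHarm (hJ : CC J) (hγ : CC γ) (hreg : Regular J γ Λ₀) {ε : ℝ} (hε : 0 < ε) :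
    ∃ C, 0 ≤ C ∧ ∀ᶠ Λ in 𝓝 Λ₀, ∀ U, IsHarm J γ Λ U →
      ‖J U‖ ^ 2 ≤ ε * ‖U‖ ^ 2 + C * ‖γ U‖ ^ 2 := by
  by_contra! hcon
  have h1 : ∀ n : ℕ, ∃ Λ, dist Λ Λ₀ < 1 / ((n : ℝ) + 1) ∧ ∃ U, IsHarm J γ Λ U ∧ ‖U‖ = 1 ∧
      ε + ((n : ℝ) + 1) * ‖γ U‖ ^ 2 < ‖J U‖ ^ 2 := fun n => by
    obtain ⟨Λ, ⟨U, hU, h2⟩, h3⟩ := ((hcon ((n : ℝ) + 1) (by positivity)).and_eventually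
      (Metric.ball_mem_nhds Λ₀ (show 0 < 1 / ((n : ℝ) + 1) by positivity))).exists
    have hU0 : U ≠ 0 := by
      rintro rfl
      simp at h2
    have hn : 0 < ‖U‖ := norm_pos_iff.2 hU0
    refine ⟨Λ, h3, ‖U‖⁻¹ • U, hU.smul _, norm_smul_inv_norm (𝕜 := ℝ) hU0, ?_⟩
    rw [map_smul, map_smul, norm_smul, norm_smul, norm_inv, norm_norm, mul_pow, mul_pow, inv_pow]
    have h4 : (‖U‖ ^ 2)⁻¹ * (ε * ‖U‖ ^ 2 + ((n : ℝ) + 1) * ‖γ U‖ ^ 2) < (‖U‖ ^ 2)⁻¹ * ‖J U‖ ^ 2 := by gcongr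
    have h5 : (‖U‖ ^ 2)⁻¹ * (ε * ‖U‖ ^ 2 + ((n : ℝ) + 1) * ‖γ U‖ ^ 2)
        = ε + ((n : ℝ) + 1) * ((‖U‖ ^ 2)⁻¹ * ‖γ U‖ ^ 2) := by
      field_simp
    linarith
  choose L hL U hU hU1 hUn using h1
  obtain ⟨U₀, hw⟩ := exists_weakLim (x := U) (C := 1) fun n => (hU1 n).le
  have hJlim := hJ U U₀ hw
  have hγlim := hγ U U₀ hw
  have h0 : Tendsto (fun n : ℕ => 1 / ((n : ℝ) + 1)) (hyperfilter ℕ : Filter ℕ) (𝓝 0) :=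
    tendsto_one_div_add_atTop_nhds_zero_nat.mono_left Nat.hyperfilter_le_atTop
  have hLlim : Tendsto L (hyperfilter ℕ : Filter ℕ) (𝓝 Λ₀) := by
    rw [tendsto_iff_dist_tendsto_zero]
    exact squeeze_zero (fun _ => dist_nonneg) (fun n => (hL n).le) h0
  have hγ0 : γ U₀ = 0 := by
    -- The assumed strict inequality gives (n + 1)‖γ(U n)‖² ≤ ‖J(U n)‖² ≤ ‖J‖².
    have h3 : Tendsto (fun n => ‖γ (U n)‖ ^ 2) (hyperfilter ℕ : Filter ℕ) (𝓝 0) := by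
      refine squeeze_zero (g := fun n : ℕ => ‖J‖ ^ 2 * (1 / ((n : ℝ) + 1)))
        (fun n => by positivity) (fun n => ?_) (by simpa using h0.const_mul (‖J‖ ^ 2))
      have h2 : ‖J (U n)‖ ^ 2 ≤ ‖J‖ ^ 2 := by
        gcongr
        simpa [hU1 n] using J.le_opNorm (U n)
      rw [mul_one_div, le_div_iff₀ (by positivity)]
      nlinarith [hUn n]
    have h4 := tendsto_nhds_unique (hγlim.norm.pow 2) h3
    simpa using h4
  have hharm : IsHarm J γ Λ₀ U₀ := fun V hV => by
    refine tendsto_nhds_unique (hw.2 V) ?_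
    simp_rw [fun n => hU n V hV]
    exact (hLlim.const_add 1).mul (hJlim.inner tendsto_const_nhds)
  have hz : U₀ = 0 := hreg _ hγ0 hharm
  have h5 : ε ≤ ‖J U₀‖ ^ 2 := ge_of_tendsto (hJlim.norm.pow 2) (Eventually.of_forall fun n => by
    have := hUn n
    have : 0 ≤ ((n : ℝ) + 1) * ‖γ (U n)‖ ^ 2 := by positivity
    linarith)
  rw [hz, map_zero, norm_zero] at h5
  norm_num at h5
  linarith

/-- The Robin form with parameter `s` is coercive on `Λ`-harmonic elements. -/
def RobinCoercive (J : G →L[ℝ] H) (γ : G →L[ℝ] B) (s Λ : ℝ) : Prop :=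
  ∀ U, IsHarm J γ Λ U → 1 / 2 * ‖U‖ ^ 2 ≤ ⟪pencil J γ Λ (-s) U, U⟫

lemma RobinCoercive.mono {s' : ℝ} (h : RobinCoercive J γ s Λ) (hs : s ≤ s') :
    RobinCoercive J γ s' Λ := by
  intro U hU
  refine (h U hU).trans ?_
  rw [inner_pencil, inner_pencil]
  nlinarith [real_inner_self_nonneg (x := γ U)]

/-- A single s has to serve all Λ near Λ₀, since the operators (D_Λ + s)⁻¹ are compared with one
another. -/
lemma eventually_robinCoercive (hJ : CC J) (hγ : CC γ) (hreg : Regular J γ Λ₀) :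
    ∃ s, ∀ᶠ Λ in 𝓝 Λ₀, RobinCoercive J γ s Λ := by
  have ha : 0 < 2 + |Λ₀| := by positivity
  -- For |Λ - Λ₀| < 1 one has 1 + Λ ≤ 2 + |Λ₀|. With this ε the interior term uses up half of ‖U‖²,
  -- and s compensates the remaining boundary term.
  obtain ⟨C, hC, h⟩ := norm_sq_le_of_isHarm hJ hγ hreg (ε := 1 / (2 * (2 + |Λ₀|))) (by positivity)
  refine ⟨1 + (2 + |Λ₀|) * C, ?_⟩
  filter_upwards [h, Metric.ball_mem_nhds Λ₀ one_pos] with Λ hΛ h1 U hU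
  have h2 := hΛ U hU
  have h3 : 1 + Λ ≤ 2 + |Λ₀| := by
    have := (abs_lt.1 (show |Λ - Λ₀| < 1 from h1)).2
    linarith [le_abs_self Λ₀]
  rw [inner_pencil, real_inner_self_eq_norm_sq, real_inner_self_eq_norm_sq,
    real_inner_self_eq_norm_sq]
  have h4 : (1 + Λ) * ‖J U‖ ^ 2 ≤ (2 + |Λ₀|) * ‖J U‖ ^ 2 := by gcongr
  have h5 : (2 + |Λ₀|) * ‖J U‖ ^ 2
      ≤ (2 + |Λ₀|) * (1 / (2 * (2 + |Λ₀|)) * ‖U‖ ^ 2 + C * ‖γ U‖ ^ 2) := by gcongr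
  have h6 : (2 + |Λ₀|) * (1 / (2 * (2 + |Λ₀|)) * ‖U‖ ^ 2 + C * ‖γ U‖ ^ 2)
      = 1 / 2 * ‖U‖ ^ 2 + (2 + |Λ₀|) * C * ‖γ U‖ ^ 2 := by
    field_simp
  linarith

/-- The boundary values of the solutions of the eigenvalue problem with parameters `Λ, τ`. -/
def eigSpace (J : G →L[ℝ] H) (γ : G →L[ℝ] B) (Λ τ : ℝ) : Submodule ℝ B :=
  (pencil J γ Λ τ).ker.map (γ : G →ₗ[ℝ] B)

/-- The span of the eigenspaces for the eigenvalues `τ ≤ σ`. -/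
def eigSpan (J : G →L[ℝ] H) (γ : G →L[ℝ] B) (Λ σ : ℝ) : Submodule ℝ B :=
  ⨆ τ ∈ Set.Iic σ, eigSpace J γ Λ τ

/-- The `k`-th eigenvalue. -/
def eigVal (J : G →L[ℝ] H) (γ : G →L[ℝ] B) (Λ : ℝ) (k : ℕ+) : ℝ :=
  sInf {σ | ((k : ℕ) : Cardinal) ≤ Module.rank ℝ (eigSpan J γ Λ σ)}

lemma mem_eigSpace {u : B} : u ∈ eigSpace J γ Λ τ ↔ ∃ U, pencil J γ Λ τ U = 0 ∧ γ U = u := by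
  simp [eigSpace, Submodule.mem_map]

lemma eigSpan_mono {σ' : ℝ} (h : σ ≤ σ') : eigSpan J γ Λ σ ≤ eigSpan J γ Λ σ' :=
  iSup₂_le fun τ hτ => le_iSup₂_of_le τ (le_trans hτ h) le_rfl

lemma pencil_sub_apply (U : G) : pencil J γ Λ (σ + τ) U
    = pencil J γ Λ σ U - τ • γ.adjoint (γ U) := by
  simp only [pencil, sub_apply, add_apply, smul_apply, one_apply_eq_self,
    ContinuousLinearMap.coe_comp, Function.comp_apply, add_smul, ← add_assoc]
  abel

namespace RobinCoercive

/-- An element of the kernel at τ satisfies ⟪P(Λ, -s)U, U⟫ = (τ + s)‖γU‖² ≤ 0, against coercivity.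
So -s lies strictly below all the eigenvalues. -/
lemma eq_zero (h : RobinCoercive J γ s Λ) {U : G} (hτ : τ ≤ -s) (hU : pencil J γ Λ τ U = 0) :
    U = 0 := by
  have h1 := h U (isHarm_of_pencil_eq_zero hU)
  have h2 := inner_pencil (J := J) (γ := γ) (Λ := Λ) (σ := τ) U U
  rw [hU, inner_zero_left] at h2
  rw [inner_pencil] at h1
  have h3 : 0 ≤ ⟪γ U, γ U⟫ := real_inner_self_nonneg
  have h4 : ‖U‖ ^ 2 ≤ 0 := by nlinarith
  exact norm_eq_zero.1 (pow_eq_zero_iff two_ne_zero |>.1 (le_antisymm h4 (sq_nonneg _)))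

lemma eigSpace_eq_bot (h : RobinCoercive J γ s Λ) (hτ : τ ≤ -s) : eigSpace J γ Λ τ = ⊥ := by
  rw [Submodule.eq_bot_iff]
  intro u hu
  obtain ⟨U, hU, rfl⟩ := mem_eigSpace.1 hu
  rw [h.eq_zero hτ hU, map_zero]

lemma isUnit (h : RobinCoercive J γ s Λ) (hJ : CC J) (hγ : CC γ) :
    IsUnit (pencil J γ Λ (-s)) :=
  isUnit_pencil hJ hγ fun _ hU => h.eq_zero le_rfl hU

lemma regular (h : RobinCoercive J γ s Λ) : Regular J γ Λ := by
  intro U hU hharm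
  have h1 := h U hharm
  rw [inner_pencil, hU, hharm U hU] at h1
  simp only [inner_zero_left] at h1
  have h4 : ‖U‖ ^ 2 ≤ 0 := by linarith
  exact norm_eq_zero.1 (pow_eq_zero_iff two_ne_zero |>.1 (le_antisymm h4 (sq_nonneg _)))

end RobinCoercive

/-- The inverse of the Robin problem on the boundary: `(D_Λ + s)⁻¹`. -/
def robinInv (J : G →L[ℝ] H) (γ : G →L[ℝ] B) (s Λ : ℝ) : B →L[ℝ] B :=
  γ ∘L Ring.inverse (pencil J γ Λ (-s)) ∘L γ.adjoint

/-! ### Spectrum of the inverse Robin operator and the counting of eigenvalues -/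

lemma pencil_ringInverse (h : IsUnit (pencil J γ Λ σ)) (V : G) :
    pencil J γ Λ σ (Ring.inverse (pencil J γ Λ σ) V) = V := by
  rw [← mul_apply_eq_comp, Ring.mul_inverse_cancel _ h, one_apply_eq_self]

lemma ringInverse_pencil (h : IsUnit (pencil J γ Λ σ)) (V : G) :
    Ring.inverse (pencil J γ Λ σ) (pencil J γ Λ σ V) = V := by
  rw [← mul_apply_eq_comp, Ring.inverse_mul_cancel _ h, one_apply_eq_self]

lemma cc_robinInv (hγ : CC γ) : CC (robinInv J γ s Λ) := hγ.comp_right _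

lemma inner_robinInv (h : IsUnit (pencil J γ Λ (-s))) (f g : B) :
    ⟪robinInv J γ s Λ f, g⟫ = ⟪pencil J γ Λ (-s) (Ring.inverse (pencil J γ Λ (-s)) (γ.adjoint f)),
      Ring.inverse (pencil J γ Λ (-s)) (γ.adjoint g)⟫ := by
  have hs : IsSelfAdjoint (pencil J γ Λ (-s)) := isSelfAdjoint_pencil
  rw [hs.inner_map_comm, pencil_ringInverse h, ContinuousLinearMap.adjoint_inner_right]
  rfl

lemma isSelfAdjoint_robinInv (h : IsUnit (pencil J γ Λ (-s))) :
    IsSelfAdjoint (robinInv J γ s Λ) :=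
  isSelfAdjoint_of_inner fun f g => by
    have hs : IsSelfAdjoint (pencil J γ Λ (-s)) := isSelfAdjoint_pencil
    rw [inner_robinInv h, hs.inner_map_comm, real_inner_comm, ← inner_robinInv h,
      real_inner_comm]

/-- P(Λ, τ)U = 0 means P(Λ, -s)U = (τ + s)γ†γU. Applying γP(Λ, -s)⁻¹ shows that γU is an eigenvector
for μ = (τ + s)⁻¹; conversely, μ⁻¹P(Λ, -s)⁻¹γ†f lifts an eigenvector f back to the kernel. -/
lemma eigenspace_robinInv (h : IsUnit (pencil J γ Λ (-s))) {μ : ℝ} (hμ : μ ≠ 0) :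
    Module.End.eigenspace (robinInv J γ s Λ : B →ₗ[ℝ] B) μ = eigSpace J γ Λ (μ⁻¹ - s) := by
  ext f
  rw [Module.End.mem_eigenspace_iff, mem_eigSpace]
  have e : μ⁻¹ - s = -s + μ⁻¹ := by ring
  rw [e]
  constructor
  · intro hf
    have hf' : γ (Ring.inverse (pencil J γ Λ (-s)) (γ.adjoint f)) = μ • f := hf
    refine ⟨μ⁻¹ • Ring.inverse (pencil J γ Λ (-s)) (γ.adjoint f), ?_, ?_⟩
    · rw [map_smul, pencil_sub_apply, pencil_ringInverse h, hf', map_smul, smul_smul,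
        inv_mul_cancel₀ hμ, one_smul, sub_self, smul_zero]
    · rw [map_smul, hf', smul_smul, inv_mul_cancel₀ hμ, one_smul]
  · rintro ⟨U, hU, rfl⟩
    rw [pencil_sub_apply, sub_eq_zero] at hU
    have h1 := ringInverse_pencil h U
    rw [hU, map_smul] at h1
    have h2 := congrArg (fun V => μ • γ V) h1
    simp only [map_smul, smul_smul, mul_inv_cancel₀ hμ, one_smul] at h2
    exact h2

/-- The map τ ↦ (τ + s)⁻¹ reverses order on (-s, ∞), and there are no eigenvalues in (-∞, -s].
Counting eigenvalues below σ becomes counting eigenvalues of a compact operator above a positive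
threshold. -/
lemma RobinCoercive.eigSpan_eq (h : RobinCoercive J γ s Λ) (hJ : CC J) (hγ : CC γ) (hσ : -s < σ) :
    eigSpan J γ Λ σ = specGE (robinInv J γ s Λ) (σ + s)⁻¹ := by
  have hu := h.isUnit hJ hγ
  apply le_antisymm
  · refine iSup₂_le fun τ hτ => ?_
    rcases le_or_gt τ (-s) with h1 | h1
    · rw [h.eigSpace_eq_bot h1]
      exact bot_le
    · have h2 : 0 < τ + s := by linarith
      have h3 := eigenspace_robinInv hu (μ := (τ + s)⁻¹) (by positivity)
      rw [inv_inv, add_sub_cancel_right] at h3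
      rw [← h3]
      refine le_iSup₂_of_le (τ + s)⁻¹ ?_ le_rfl
      have : τ ≤ σ := hτ
      exact inv_anti₀ h2 (by linarith)
  · refine iSup₂_le fun μ hμ => ?_
    have h1 : 0 < σ + s := by linarith
    have h2 : 0 < μ := lt_of_lt_of_le (by positivity) hμ
    rw [eigenspace_robinInv hu h2.ne']
    refine le_iSup₂_of_le (μ⁻¹ - s) ?_ le_rfl
    have h3 : μ⁻¹ ≤ σ + s := inv_le_of_inv_le₀ h1 hμ
    show μ⁻¹ - s ≤ σ
    linarith

lemma continuousAt_robinInv (h : IsUnit (pencil J γ Λ₀ (-s))) :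
    ContinuousAt (robinInv J γ s) Λ₀ := by
  have h1 : ContinuousAt (fun Λ => Ring.inverse (pencil J γ Λ (-s))) Λ₀ := by
    obtain ⟨u, hu⟩ := h
    have h2 := NormedRing.inverse_continuousAt u
    rw [hu] at h2
    refine ContinuousAt.comp (f := fun Λ => pencil J γ Λ (-s)) h2 ?_
    unfold pencil
    fun_prop
  exact (continuousAt_const.clm_comp (h1.clm_comp continuousAt_const))

lemma le_rank_eigSpan {n : ℕ} (hJ : CC J) (hγ : CC γ) {Λ' σ' : ℝ} (h : RobinCoercive J γ s Λ)
    (h' : RobinCoercive J γ s Λ') (hσ : -s < σ) (hσ' : -s < σ')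
    (hn : ‖robinInv J γ s Λ - robinInv J γ s Λ'‖ ≤ (σ + s)⁻¹ - (σ' + s)⁻¹)
    (hr : (n : Cardinal) ≤ Module.rank ℝ (eigSpan J γ Λ σ)) :
    (n : Cardinal) ≤ Module.rank ℝ (eigSpan J γ Λ' σ') := by
  rw [h.eigSpan_eq hJ hγ hσ] at hr
  rw [h'.eigSpan_eq hJ hγ hσ']
  have : 0 < σ' + s := by linarith
  exact le_rank_specGE (isSelfAdjoint_robinInv (h.isUnit hJ hγ))
    (isSelfAdjoint_robinInv (h'.isUnit hJ hγ)) (cc_robinInv hγ) (by positivity) (by linarith) hr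

lemma RobinCoercive.lt_of_le_rank (h : RobinCoercive J γ s Λ) {k : ℕ+}
    (hr : ((k : ℕ) : Cardinal) ≤ Module.rank ℝ (eigSpan J γ Λ σ)) : -s < σ := by
  by_contra! hle
  have h1 : eigSpan J γ Λ σ = ⊥ := by
    rw [eq_bot_iff]
    exact iSup₂_le fun τ hτ => (h.eigSpace_eq_bot (le_trans hτ hle)).le
  rw [h1, rank_bot] at hr
  have : ((k : ℕ) : Cardinal) ≠ 0 := by exact_mod_cast k.ne_zero
  exact this (le_antisymm hr zero_le)

lemma RobinCoercive.bddBelow (h : RobinCoercive J γ s Λ) (k : ℕ+) :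
    BddBelow {σ | ((k : ℕ) : Cardinal) ≤ Module.rank ℝ (eigSpan J γ Λ σ)} :=
  ⟨-s, fun _ hσ => (h.lt_of_le_rank hσ).le⟩

/-- Without eigenvalues in the ε-window the span would be the same at the left of the infimum, which
could then be lowered. This approximate form is enough later, so attainment of the infimum is not
needed. -/
lemma RobinCoercive.exists_eigenvalue_near (h : RobinCoercive J γ s Λ) {k : ℕ+}
    (hne : {σ | ((k : ℕ) : Cardinal) ≤ Module.rank ℝ (eigSpan J γ Λ σ)}.Nonempty)
    {ε : ℝ} (hε : 0 < ε) : ∃ τ, dist τ (eigVal J γ Λ k) < ε ∧ eigSpace J γ Λ τ ≠ ⊥ := by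
  by_contra! hcon
  obtain ⟨σ, hσ, hlt⟩ := exists_lt_of_csInf_lt hne
    (show eigVal J γ Λ k < eigVal J γ Λ k + ε by linarith)
  have h1 : eigSpan J γ Λ σ ≤ eigSpan J γ Λ (eigVal J γ Λ k - ε / 2) := by
    refine iSup₂_le fun τ hτ => ?_
    by_cases hτ' : τ ≤ eigVal J γ Λ k - ε / 2
    · exact le_iSup₂_of_le τ hτ' le_rfl
    · rw [hcon τ ?_]
      · exact bot_le
      · rw [Real.dist_eq, abs_lt]
        have : τ ≤ σ := hτ
        push Not at hτ'
        constructor <;> linarith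
  have h3 : ((k : ℕ) : Cardinal) ≤ Module.rank ℝ (eigSpan J γ Λ (eigVal J γ Λ k - ε / 2)) :=
    le_trans hσ (Submodule.rank_mono h1)
  have h2 : eigVal J γ Λ k ≤ eigVal J γ Λ k - ε / 2 := csInf_le (h.bddBelow k) h3
  linarith

/-- Continuity of the eigenvalues. -/
lemma tendsto_eigVal (hJ : CC J) (hγ : CC γ) (hreg : Regular J γ Λ₀) {k : ℕ+}
    (hne : {σ | ((k : ℕ) : Cardinal) ≤ Module.rank ℝ (eigSpan J γ Λ₀ σ)}.Nonempty) :
    Tendsto (fun Λ => eigVal J γ Λ k) (𝓝 Λ₀) (𝓝 (eigVal J γ Λ₀ k)) ∧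
    ∀ᶠ Λ in 𝓝 Λ₀, ∀ ε > 0, ∃ τ, dist τ (eigVal J γ Λ k) < ε ∧ eigSpace J γ Λ τ ≠ ⊥ := by
  obtain ⟨s₀, hs₀⟩ := eventually_robinCoercive hJ hγ hreg
  -- The extra 1 leaves room: all eigenvalues are at least -s₀, so thresholds lowered by less than 1
  -- still exceed -s.
  obtain ⟨s, rfl⟩ : ∃ s, s = s₀ + 1 := ⟨_, rfl⟩
  have hco : ∀ᶠ Λ in 𝓝 Λ₀, RobinCoercive J γ (s₀ + 1) Λ :=
    hs₀.mono fun Λ h => h.mono (by linarith)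
  have hco0 := hco.self_of_nhds
  have hlow : -s₀ ≤ eigVal J γ Λ₀ k :=
    le_csInf hne fun σ hσ => (hs₀.self_of_nhds.lt_of_le_rank hσ).le
  have hcont := continuousAt_robinInv (hco0.isUnit hJ hγ)
  -- Upper semicontinuity: k eigenvalues at Λ₀ below the larger threshold persist for nearby Λ.
  have hup : ∀ ε > 0, ∀ᶠ Λ in 𝓝 Λ₀, ((k : ℕ) : Cardinal) ≤
      Module.rank ℝ (eigSpan J γ Λ (eigVal J γ Λ₀ k + ε)) := by
    intro ε hε
    obtain ⟨σ, hσ, hlt⟩ := exists_lt_of_csInf_lt hne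
      (show eigVal J γ Λ₀ k < eigVal J γ Λ₀ k + ε by linarith)
    have hσ1 := hco0.lt_of_le_rank hσ
    have hpos : 0 < (σ + (s₀ + 1))⁻¹ - (eigVal J γ Λ₀ k + ε + (s₀ + 1))⁻¹ := by
      rw [sub_pos]
      exact inv_strictAnti₀ (by linarith) (by linarith)
    filter_upwards [hco, Metric.tendsto_nhds.1 hcont _ hpos] with Λ h1 h2
    rw [dist_comm, dist_eq_norm] at h2
    exact le_rank_eigSpan hJ hγ hco0 h1 hσ1 (by linarith) h2.le hσ
  refine ⟨?_, ?_⟩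
  · rw [Metric.tendsto_nhds]
    intro ε hε
    obtain ⟨δ, hδ, hδ1, hδε⟩ : ∃ δ > 0, δ < 1 ∧ δ < ε :=
      ⟨min 1 ε / 2, by positivity, by have := min_le_left 1 ε; linarith,
        by have := min_le_right 1 ε; linarith⟩
    have hpos : 0 < (eigVal J γ Λ₀ k - δ + (s₀ + 1))⁻¹
        - (eigVal J γ Λ₀ k - δ / 2 + (s₀ + 1))⁻¹ := by
      rw [sub_pos]
      exact inv_strictAnti₀ (by linarith) (by linarith)
    filter_upwards [hco, Metric.tendsto_nhds.1 hcont _ hpos, hup δ hδ] with Λ h1 h2 h3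
    -- Lower semicontinuity: otherwise k eigenvalues at Λ below σ_k(Λ₀) - δ would be carried back to
    -- Λ₀, below σ_k(Λ₀) - δ/2.
    have hge : eigVal J γ Λ₀ k - δ ≤ eigVal J γ Λ k := by
      refine le_csInf ⟨_, h3⟩ fun σ hσ => ?_
      by_contra! hlt
      have hσ' : ((k : ℕ) : Cardinal) ≤ Module.rank ℝ (eigSpan J γ Λ (eigVal J γ Λ₀ k - δ)) :=
        le_trans hσ (Submodule.rank_mono (eigSpan_mono hlt.le))
      rw [dist_eq_norm] at h2
      have h4 := le_rank_eigSpan hJ hγ h1 hco0 (by linarith) (by linarith) h2.le hσ'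
      have h5 : eigVal J γ Λ₀ k ≤ eigVal J γ Λ₀ k - δ / 2 := csInf_le (hco0.bddBelow k) h4
      linarith
    have hle : eigVal J γ Λ k ≤ eigVal J γ Λ₀ k + δ := csInf_le (h1.bddBelow k) h3
    rw [Real.dist_eq, abs_lt]
    constructor <;> linarith
  · filter_upwards [hco, hup 1 one_pos] with Λ h1 h2 ε hε
    exact h1.exists_eigenvalue_near ⟨_, h2⟩ hε

end Pencil

end DtN

end

noncomputable section

namespace DtN

/-! ### Perturbation theory for simple eigenvalues of the pencil -/

section Bordered

set_option linter.unusedSectionVars false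

variable {G H B : Type*} [NormedAddCommGroup G] [InnerProductSpace ℝ G] [CompleteSpace G]
  [NormedAddCommGroup H] [InnerProductSpace ℝ H] [CompleteSpace H]
  [NormedAddCommGroup B] [InnerProductSpace ℝ B] [CompleteSpace B]
  {J : G →L[ℝ] H} {γ : G →L[ℝ] B}

/-- The pencil plus the rank one operator `⟪w, ·⟫ w`. -/
def bordered (J : G →L[ℝ] H) (γ : G →L[ℝ] B) (w : G) (p : ℝ × ℝ) : G →L[ℝ] G :=
  pencil J γ p.1 p.2 + (innerSL ℝ w).smulRight w

lemma bordered_apply (w : G) (p : ℝ × ℝ) (U : G) :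
    bordered J γ w p U = pencil J γ p.1 p.2 U + ⟪w, U⟫ • w := by
  simp [bordered]

lemma isUnit_bordered (hJ : CC J) (hγ : CC γ) {w : G} {p : ℝ × ℝ}
    (h : ∀ U, bordered J γ w p U = 0 → U = 0) : IsUnit (bordered J γ w p) := by
  have e : bordered J γ w p = 1 - (((1 + p.1) • (J.adjoint ∘L J) +
      (1 + p.2) • (γ.adjoint ∘L γ)) + (-1 : ℝ) • (innerSL ℝ w).smulRight w) := by
    rw [bordered, pencil]
    module
  rw [e]
  refine isUnit_one_sub_of_injective ((((hJ.comp_left _).smul _).add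
    ((hγ.comp_left _).smul _)).add ((CC.rankOne w w).smul _)) ?_ fun U hU => h U ?_
  · have h1 : IsSelfAdjoint (pencil J γ p.1 p.2) := isSelfAdjoint_pencil
    refine isSelfAdjoint_of_inner fun U V => ?_
    have h2 := h1.inner_map_comm U V
    simp only [pencil, sub_apply, one_apply_eq_self, inner_sub_left, inner_sub_right] at h2
    rw [add_apply, add_apply _ _ V, inner_add_left, inner_add_right]
    have h3 : ⟪((-1 : ℝ) • (innerSL ℝ w).smulRight w) U, V⟫
        = ⟪U, ((-1 : ℝ) • (innerSL ℝ w).smulRight w) V⟫ := by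
      simp [real_inner_smul_right, real_inner_comm]
      ring
    linarith
  · rw [e, sub_apply, hU, one_apply_eq_self, sub_self]

lemma hasFDerivAt_bordered (w : G) (p : ℝ × ℝ) :
    HasFDerivAt (bordered J γ w)
      (-((ContinuousLinearMap.fst ℝ ℝ ℝ).smulRight (J.adjoint ∘L J) +
        (ContinuousLinearMap.snd ℝ ℝ ℝ).smulRight (γ.adjoint ∘L γ))) p := by
  have h1 : HasFDerivAt (fun q : ℝ × ℝ => 1 + q.1) (ContinuousLinearMap.fst ℝ ℝ ℝ) p :=
    hasFDerivAt_fst.const_add 1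
  have h2 : HasFDerivAt (fun q : ℝ × ℝ => 1 + q.2) (ContinuousLinearMap.snd ℝ ℝ ℝ) p :=
    hasFDerivAt_snd.const_add 1
  have h3 := h1.smul_const (J.adjoint ∘L J)
  have h4 := h2.smul_const (γ.adjoint ∘L γ)
  exact ((h3.add h4).const_sub 1).add_const _

lemma contDiff_bordered (w : G) {n : WithTop ℕ∞} : ContDiff ℝ n (bordered J γ w) := by
  unfold bordered pencil
  fun_prop

/-- The solution of the bordered problem. -/
def borderedSol (J : G →L[ℝ] H) (γ : G →L[ℝ] B) (w : G) (p : ℝ × ℝ) : G :=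
  Ring.inverse (bordered J γ w p) w

lemma bordered_ringInverse {w : G} {p : ℝ × ℝ} (h : IsUnit (bordered J γ w p)) (V : G) :
    bordered J γ w p (Ring.inverse (bordered J γ w p) V) = V := by
  rw [← mul_apply_eq_comp, Ring.mul_inverse_cancel _ h, one_apply_eq_self]

lemma ringInverse_bordered {w : G} {p : ℝ × ℝ} (h : IsUnit (bordered J γ w p)) (V : G) :
    Ring.inverse (bordered J γ w p) (bordered J γ w p V) = V := by
  rw [← mul_apply_eq_comp, Ring.inverse_mul_cancel _ h, one_apply_eq_self]

/-- This is d(B⁻¹)w = -B⁻¹(dB)B⁻¹w with dB = -(dΛ J†J + dσ γ†γ). -/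
lemma hasFDerivAt_borderedSol {w : G} {p : ℝ × ℝ} (h : IsUnit (bordered J γ w p)) :
    HasFDerivAt (borderedSol J γ w)
      ((Ring.inverse (bordered J γ w p)) ∘L
        ((ContinuousLinearMap.fst ℝ ℝ ℝ).smulRight (J.adjoint (J (borderedSol J γ w p))) +
        (ContinuousLinearMap.snd ℝ ℝ ℝ).smulRight (γ.adjoint (γ (borderedSol J γ w p))))) p := by
  obtain ⟨u, hu⟩ := h
  have h1 := hasFDerivAt_ringInverse (𝕜 := ℝ) u
  rw [hu] at h1
  have h2 := h1.comp p (hasFDerivAt_bordered w p)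
  have h3 := h2.clm_apply (hasFDerivAt_const w p)
  have e : (↑u⁻¹ : G →L[ℝ] G) = Ring.inverse (bordered J γ w p) := by
    rw [← hu, Ring.inverse_unit]
  rw [e] at h3
  refine h3.congr_fderiv ?_
  ext <;> simp [borderedSol]

lemma contDiffAt_borderedSol {w : G} {p : ℝ × ℝ} (h : IsUnit (bordered J γ w p))
    {n : WithTop ℕ∞} : ContDiffAt ℝ n (borderedSol J γ w) p := by
  obtain ⟨u, hu⟩ := h
  have h1 := contDiffAt_ringInverse ℝ (n := n) u
  rw [hu] at h1
  exact (h1.comp p (contDiff_bordered w).contDiffAt).clm_apply contDiffAt_const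

lemma inner_borderedSol {w : G} {p : ℝ × ℝ} (h : IsUnit (bordered J γ w p)) (V : G) :
    ⟪Ring.inverse (bordered J γ w p) V, w⟫ = ⟪V, borderedSol J γ w p⟫ := by
  have h1 : IsSelfAdjoint (pencil J γ p.1 p.2) := isSelfAdjoint_pencil
  have h2 : ∀ U U', ⟪bordered J γ w p U, U'⟫ = ⟪U, bordered J γ w p U'⟫ := fun U U' => by
    rw [bordered_apply, bordered_apply, inner_add_left, inner_add_right, h1.inner_map_comm,
      real_inner_smul_left, real_inner_smul_right, real_inner_comm U w]
    ring
  have h3 := h2 (Ring.inverse (bordered J γ w p) V) (borderedSol J γ w p)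
  rw [bordered_ringInverse h] at h3
  rw [h3, borderedSol, bordered_ringInverse h]

/-- The eigenvalues are the solutions `p` of `borderedFun J γ w p = 1`. -/
def borderedFun (J : G →L[ℝ] H) (γ : G →L[ℝ] B) (w : G) (p : ℝ × ℝ) : ℝ :=
  ⟪borderedSol J γ w p, w⟫

/-- If V is in the kernel of the pencil then BV = ⟪w, V⟫w, so V = ⟪w, V⟫B⁻¹w. Pairing with w and
cancelling ⟪w, V⟫, nonzero because V ≠ 0, gives the equation. Only this implication is needed. -/
lemma borderedFun_eq_one {w : G} {p : ℝ × ℝ} (h : IsUnit (bordered J γ w p))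
    (he : eigSpace J γ p.1 p.2 ≠ ⊥) : borderedFun J γ w p = 1 := by
  obtain ⟨u, hu, hu0⟩ := Submodule.exists_mem_ne_zero_of_ne_bot he
  obtain ⟨V, hV, rfl⟩ := mem_eigSpace.1 hu
  have h1 := ringInverse_bordered h V
  rw [bordered_apply, hV, zero_add, map_smul] at h1
  have hc : ⟪w, V⟫ ≠ 0 := fun hc => hu0 (by rw [← h1, hc, zero_smul, map_zero])
  have h2 : ⟪⟪w, V⟫ • Ring.inverse (bordered J γ w p) w, w⟫ = ⟪w, V⟫ := by
    rw [h1, real_inner_comm]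
  rw [real_inner_smul_left] at h2
  exact mul_left_cancel₀ hc (by rw [mul_one]; exact h2)

/-- Since B is self-adjoint, the outer B⁻¹ moves onto w and produces the solution a second time, so
both partial derivatives become squared norms. -/
lemma hasFDerivAt_borderedFun {w : G} {p : ℝ × ℝ} (h : IsUnit (bordered J γ w p)) :
    HasFDerivAt (borderedFun J γ w)
      (‖J (borderedSol J γ w p)‖ ^ 2 • ContinuousLinearMap.fst ℝ ℝ ℝ +
        ‖γ (borderedSol J γ w p)‖ ^ 2 • ContinuousLinearMap.snd ℝ ℝ ℝ) p := by
  have h1 := (hasFDerivAt_borderedSol h).inner ℝ (hasFDerivAt_const w p)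
  refine h1.congr_fderiv ?_
  have h2 := inner_borderedSol h (J.adjoint (J (borderedSol J γ w p)))
  have h3 := inner_borderedSol h (γ.adjoint (γ (borderedSol J γ w p)))
  rw [ContinuousLinearMap.adjoint_inner_left, real_inner_self_eq_norm_sq] at h2 h3
  ext
  · simp [h2]
  · simp [h3]

lemma contDiffAt_borderedFun {w : G} {p : ℝ × ℝ} (h : IsUnit (bordered J γ w p))
    {n : WithTop ℕ∞} : ContDiffAt ℝ n (borderedFun J γ w) p :=
  (contDiffAt_borderedSol h).inner ℝ contDiffAt_const

/-- The implicit function theorem for F = 1, with continuity of the eigenvalue to identify the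
resulting curve. Here Z is the derivative of the normalised solution along the curve. -/
theorem eigVal_derivatives (hJ : CC J) (hγ : CC γ) {Λ₀ : ℝ} (hreg : Regular J γ Λ₀) {k : ℕ+}
    (hne : {σ | ((k : ℕ) : Cardinal) ≤ Module.rank ℝ (eigSpan J γ Λ₀ σ)}.Nonempty) {U₀ : G}
    (hU₀ : pencil J γ Λ₀ (eigVal J γ Λ₀ k) U₀ = 0) (hn : ‖γ U₀‖ = 1)
    (hs : ∀ V, pencil J γ Λ₀ (eigVal J γ Λ₀ k) V = 0 → ∃ c : ℝ, V = c • U₀) :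
    HasDerivAt (fun Λ => eigVal J γ Λ k) (-‖J U₀‖ ^ 2) Λ₀ ∧
    (∀ᶠ Λ in 𝓝 Λ₀, DifferentiableAt ℝ (fun Λ => eigVal J γ Λ k) Λ) ∧
    ∃ Z, pencil J γ Λ₀ (eigVal J γ Λ₀ k) Z
        = J.adjoint (J U₀) - ‖J U₀‖ ^ 2 • γ.adjoint (γ U₀) ∧ ⟪γ U₀, γ Z⟫ = 0 ∧
      HasDerivAt (deriv (fun Λ => eigVal J γ Λ k)) (-2 * ⟪J Z, J U₀⟫) Λ₀ := by
  obtain ⟨σ₀, hσ₀⟩ : ∃ σ₀, σ₀ = eigVal J γ Λ₀ k := ⟨_, rfl⟩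
  rw [← hσ₀] at hU₀ hs ⊢
  -- With this border, ⟪w, V⟫ = ⟪γU₀, γV⟫. In particular ⟪w, U₀⟫ = 1, so the bordered solution at
  -- the base point is U₀ itself.
  obtain ⟨w, hw⟩ : ∃ w, w = γ.adjoint (γ U₀) := ⟨_, rfl⟩
  have hwi : ∀ V, ⟪w, V⟫ = ⟪γ U₀, γ V⟫ := fun V => by
    rw [hw, ContinuousLinearMap.adjoint_inner_left]
  have hw1 : ⟪w, U₀⟫ = 1 := by rw [hwi, real_inner_self_eq_norm_sq, hn, one_pow]
  have hsa : IsSelfAdjoint (pencil J γ Λ₀ σ₀) := isSelfAdjoint_pencil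
  have hpU : ∀ V, ⟪pencil J γ Λ₀ σ₀ V, U₀⟫ = 0 := fun V => by
    rw [hsa.inner_map_comm, hU₀, inner_zero_right]
  have hpair : ∀ V, ⟪bordered J γ w (Λ₀, σ₀) V, U₀⟫ = ⟪w, V⟫ := fun V => by
    rw [bordered_apply, inner_add_left, hpU, real_inner_smul_left, hw1, zero_add, mul_one]
  -- Pairing BV = 0 with U₀ removes the pencil and leaves ⟪w, V⟫ = 0. So V lies in the kernel of the
  -- pencil, is a multiple of U₀ by simplicity, and the multiple is 0.
  have hunit : IsUnit (bordered J γ w (Λ₀, σ₀)) := by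
    refine isUnit_bordered hJ hγ fun V hV => ?_
    have h1 := hpair V
    rw [hV, inner_zero_left] at h1
    rw [bordered_apply, ← h1, zero_smul, add_zero] at hV
    obtain ⟨c, rfl⟩ := hs V hV
    rw [real_inner_smul_right, hw1, mul_one] at h1
    rw [← h1, zero_smul]
  have hsol : borderedSol J γ w (Λ₀, σ₀) = U₀ := by
    have h1 := ringInverse_bordered hunit U₀
    rwa [bordered_apply, hU₀, hw1, one_smul, zero_add] at h1
  have hone : borderedFun J γ w (Λ₀, σ₀) = 1 := by
    rw [borderedFun, hsol, real_inner_comm, hw1]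
  have hcd : ContDiffAt ℝ 2 (borderedFun J γ w) (Λ₀, σ₀) := contDiffAt_borderedFun hunit
  have hfd := (hasFDerivAt_borderedFun hunit).fderiv
  rw [hsol, hn] at hfd
  have hinv : (fderiv ℝ (borderedFun J γ w) (Λ₀, σ₀) ∘L .inr ℝ ℝ ℝ).IsInvertible := by
    have : fderiv ℝ (borderedFun J γ w) (Λ₀, σ₀) ∘L .inr ℝ ℝ ℝ
        = (ContinuousLinearEquiv.refl ℝ ℝ : ℝ →L[ℝ] ℝ) := by
      rw [hfd]
      ext
      simp
    exact ⟨_, this.symm⟩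
  obtain ⟨ψ, hψdef⟩ : ∃ ψ, ψ = hcd.implicitFunction two_ne_zero hinv := ⟨_, rfl⟩
  have hψ0 : ψ Λ₀ = σ₀ := by
    rw [hψdef]
    exact hcd.implicitFunction_apply_self two_ne_zero hinv
  have hψc : ContDiffAt ℝ 2 ψ Λ₀ := by
    rw [hψdef]
    exact hcd.contDiffAt_implicitFunction two_ne_zero hinv
  have hψ1 : ∀ᶠ Λ in 𝓝 Λ₀, borderedFun J γ w (Λ, ψ Λ) = 1 := by
    rw [hψdef, ← hone]
    exact hcd.eventually_apply_implicitFunction two_ne_zero hinv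
  have hψiff : ∀ᶠ v in 𝓝 (Λ₀, σ₀), borderedFun J γ w v = 1 ↔ ψ v.1 = v.2 := by
    rw [hψdef, ← hone]
    exact hcd.eventually_apply_eq_iff_implicitFunction two_ne_zero hinv
  have hunits : ∀ᶠ v in 𝓝 (Λ₀, σ₀), IsUnit (bordered J γ w v) :=
    (contDiff_bordered w (n := 0)).continuous.continuousAt.eventually
      (Units.isOpen.mem_nhds hunit)
  obtain ⟨hcont, hnear⟩ := tendsto_eigVal hJ hγ hreg hne
  rw [← hσ₀] at hcont
  -- Arbitrarily close to σ_k(Λ) there is a genuine eigenvalue τ. It is near σ₀, hence on the curve,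
  -- so τ = ψ Λ and the distance from ψ Λ to σ_k(Λ) is 0.
  have heq : (fun Λ => eigVal J γ Λ k) =ᶠ[𝓝 Λ₀] ψ := by
    obtain ⟨r, hr, hball⟩ := Metric.eventually_nhds_iff.1 (hψiff.and hunits)
    filter_upwards [hnear, Metric.ball_mem_nhds Λ₀ hr,
      Metric.tendsto_nhds.1 hcont (r / 2) (by positivity)] with Λ h1 h2 h3
    have h4 : ∀ ε > 0, dist (ψ Λ) (eigVal J γ Λ k) ≤ ε := fun ε hε => by
      obtain ⟨τ, hτ, hτe⟩ := h1 (min ε (r / 2)) (by positivity)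
      have h5 : dist (Λ, τ) (Λ₀, σ₀) < r := by
        rw [Prod.dist_eq, max_lt_iff]
        refine ⟨h2, ?_⟩
        have := dist_triangle τ (eigVal J γ Λ k) σ₀
        have := min_le_right ε (r / 2)
        dsimp only at *
        linarith
      obtain ⟨h6, h7⟩ := hball h5
      rw [h6.1 (borderedFun_eq_one h7 hτe)]
      exact (hτ.trans_le (min_le_left _ _)).le
    exact (eq_of_dist_eq_zero (le_antisymm (le_of_forall_pos_le_add fun ε hε => by
      simpa using h4 ε hε) dist_nonneg)).symm
  have hψd : ∀ᶠ Λ in 𝓝 Λ₀, DifferentiableAt ℝ ψ Λ :=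
    (hψc.eventually (by simp)).mono fun Λ h => h.differentiableAt two_ne_zero
  have htend : Tendsto (fun Λ => (Λ, ψ Λ)) (𝓝 Λ₀) (𝓝 (Λ₀, σ₀)) := by
    have h1 := hψc.continuousAt
    rw [ContinuousAt, hψ0] at h1
    exact tendsto_id.prodMk_nhds h1
  -- The identity F(Λ, ψ Λ) = 1 is differentiated at every nearby Λ, since the resulting formula is
  -- itself differentiated at Λ₀ below.
  have hder : ∀ᶠ Λ in 𝓝 Λ₀, HasDerivAt ψ (-(‖J (borderedSol J γ w (Λ, ψ Λ))‖ ^ 2 /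
      ‖γ (borderedSol J γ w (Λ, ψ Λ))‖ ^ 2)) Λ := by
    filter_upwards [hψd, hψ1.eventually_nhds, htend.eventually hunits] with Λ h1 h2 h3
    have h4 : HasDerivAt (fun Λ => (Λ, ψ Λ)) (1, deriv ψ Λ) Λ :=
      (hasDerivAt_id Λ).prodMk h1.hasDerivAt
    have h5 := HasFDerivAt.comp_hasDerivAt Λ (f := fun Λ => (Λ, ψ Λ))
      (hasFDerivAt_borderedFun h3) h4
    have h6 : HasDerivAt (borderedFun J γ w ∘ fun Λ => (Λ, ψ Λ)) 0 Λ :=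
      (hasDerivAt_const Λ (1 : ℝ)).congr_of_eventuallyEq h2
    have h7 := h5.unique h6
    simp at h7
    have h8 : γ (borderedSol J γ w (Λ, ψ Λ)) ≠ 0 := fun h => by
      have h9 := h2.self_of_nhds
      rw [borderedFun, real_inner_comm, hwi, h, inner_zero_right] at h9
      exact zero_ne_one h9
    have h9 : ‖γ (borderedSol J γ w (Λ, ψ Λ))‖ ^ 2 ≠ 0 :=
      pow_ne_zero 2 (norm_ne_zero_iff.2 h8)
    have h10 : deriv ψ Λ = -(‖J (borderedSol J γ w (Λ, ψ Λ))‖ ^ 2 /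
      ‖γ (borderedSol J γ w (Λ, ψ Λ))‖ ^ 2) := by
      rw [← neg_div, eq_div_iff h9]
      linarith
    rw [← h10]
    exact h1.hasDerivAt
  have hψ' : HasDerivAt ψ (-‖J U₀‖ ^ 2) Λ₀ := by
    have := hder.self_of_nhds
    rwa [hψ0, hsol, hn, one_pow, div_one] at this
  refine ⟨hψ'.congr_of_eventuallyEq heq, ?_, ?_⟩
  · filter_upwards [hψd, heq.eventually_nhds] with Λ h1 h2
    exact h1.congr_of_eventuallyEq h2
  obtain ⟨Z, hZ⟩ : ∃ Z, Z = Ring.inverse (bordered J γ w (Λ₀, σ₀))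
      (J.adjoint (J U₀) - ‖J U₀‖ ^ 2 • γ.adjoint (γ U₀)) := ⟨_, rfl⟩
  have hBZ : bordered J γ w (Λ₀, σ₀) Z
      = J.adjoint (J U₀) - ‖J U₀‖ ^ 2 • γ.adjoint (γ U₀) := by
    rw [hZ, bordered_ringInverse hunit]
  -- The right-hand side is orthogonal to U₀ because ⟪w, U₀⟫ = 1. So the border term drops out and Z
  -- solves the unbordered equation.
  have hwZ : ⟪w, Z⟫ = 0 := by
    have h1 := hpair Z
    rw [hBZ, inner_sub_left, real_inner_smul_left, ContinuousLinearMap.adjoint_inner_left,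
      ← hw, hw1, real_inner_self_eq_norm_sq] at h1
    linarith
  have hγZ : ⟪γ U₀, γ Z⟫ = 0 := by rw [← hwi, hwZ]
  refine ⟨Z, ?_, hγZ, ?_⟩
  · rw [bordered_apply, hwZ, zero_smul, add_zero] at hBZ
    exact hBZ
  have hpd : HasDerivAt (fun Λ => (Λ, ψ Λ)) (1, -‖J U₀‖ ^ 2) Λ₀ :=
    (hasDerivAt_id Λ₀).prodMk hψ'
  have hsold : HasDerivAt (fun Λ => borderedSol J γ w (Λ, ψ Λ)) Z Λ₀ := by
    have h0 := hasFDerivAt_borderedSol hunit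
    rw [hsol] at h0
    have e : (Λ₀, σ₀) = (Λ₀, ψ Λ₀) := by rw [hψ0]
    rw [e] at h0
    have h1 := HasFDerivAt.comp_hasDerivAt Λ₀ (f := fun Λ => (Λ, ψ Λ)) h0 hpd
    refine h1.congr_deriv ?_
    rw [hZ, ← e]
    simp [sub_eq_add_neg]
  have hJd := (J.hasFDerivAt.comp_hasDerivAt Λ₀ hsold).norm_sq
  have hγd := (γ.hasFDerivAt.comp_hasDerivAt Λ₀ hsold).norm_sq
  have hq := (hJd.div hγd (by simp [hψ0, hsol, hn])).neg
  have hd : deriv (fun Λ => eigVal J γ Λ k) =ᶠ[𝓝 Λ₀]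
      fun Λ => -(‖J (borderedSol J γ w (Λ, ψ Λ))‖ ^ 2 /
        ‖γ (borderedSol J γ w (Λ, ψ Λ))‖ ^ 2) := by
    filter_upwards [hder, heq.eventually_nhds] with Λ h1 h2
    rw [EventuallyEq.deriv_eq h2, h1.deriv]
  refine HasDerivAt.congr_of_eventuallyEq (hq.congr_deriv ?_) hd
  -- In the quotient rule the derivative of the denominator is 2⟪γU₀, γZ⟫ = 0.
  simp only [Function.comp_apply, hψ0, hsol, hn, hγZ]
  rw [real_inner_comm]
  ring

end Bordered

end DtN

end

noncomputable section

namespace DtN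

/-! ### Eigenfunction expansions -/

section Expansion

set_option linter.unusedSectionVars false

variable {G H B : Type*} [NormedAddCommGroup G] [InnerProductSpace ℝ G] [CompleteSpace G]
  [NormedAddCommGroup H] [InnerProductSpace ℝ H] [CompleteSpace H]
  [NormedAddCommGroup B] [InnerProductSpace ℝ B] [CompleteSpace B]
  {J : G →L[ℝ] H} {γ : G →L[ℝ] B} {Λ s : ℝ}

/-- By Bessel's inequality an orthonormal sequence converges weakly to 0. -/
lemma tendsto_of_orthonormal {R : B →L[ℝ] B} (hR : CC R) {x : ℕ → B} (hx : Orthonormal ℝ x) :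
    Tendsto (fun n => R (x n)) (hyperfilter ℕ : Filter ℕ) (𝓝 0) := by
  have h : WeakLim x 0 := by
    refine ⟨⟨1, fun n => (hx.1 n).le⟩, fun v => ?_⟩
    have h1 := (hx.inner_products_summable v).tendsto_cofinite_zero.mono_left
      (hyperfilter_le_cofinite (α := ℕ))
    have h2 := h1.sqrt
    simp only [Real.sqrt_sq (norm_nonneg _), Real.sqrt_zero] at h2
    rw [inner_zero_left]
    exact tendsto_zero_iff_norm_tendsto_zero.2 h2
  simpa using hR x 0 h

lemma le_rank_of_linearIndependent {E : Submodule ℝ B} {n : ℕ} {v : Fin n → B}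
    (hv : LinearIndependent ℝ v) (hE : ∀ i, v i ∈ E) : (n : Cardinal) ≤ Module.rank ℝ E := by
  refine Module.le_rank_iff.2 ⟨fun i => ⟨v i, hE i⟩, ?_⟩
  exact LinearIndependent.of_comp E.subtype hv

lemma eigSpace_le_eigSpan {τ σ : ℝ} (h : τ ≤ σ) : eigSpace J γ Λ τ ≤ eigSpan J γ Λ σ :=
  le_iSup₂_of_le (f := fun τ (_ : τ ∈ Set.Iic σ) => eigSpace J γ Λ τ) τ h le_rfl

/-- The infimum defining `eigVal` must not be over the empty set. Any bound for the first k of the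
given eigenvalues is a member, as their eigenfunctions are independent. -/
lemma exists_le_rank_eigSpan {U : ℕ+ → G} {σ : ℕ+ → ℝ} (ho : Orthonormal ℝ fun j => γ (U j))
    (hU : ∀ j, pencil J γ Λ (σ j) (U j) = 0) (k : ℕ+) :
    {t | ((k : ℕ) : Cardinal) ≤ Module.rank ℝ (eigSpan J γ Λ t)}.Nonempty := by
  let f : Fin k → ℕ+ := fun i => Nat.succPNat i
  have hf : Function.Injective f := fun i j h => Fin.ext (Nat.succPNat_injective h)
  obtain ⟨M, hM⟩ := (Set.finite_range fun i : Fin k => σ (f i)).bddAbove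
  refine ⟨M, le_rank_of_linearIndependent ((ho.comp f hf).linearIndependent) fun i => ?_⟩
  exact eigSpace_le_eigSpan (hM ⟨i, rfl⟩) (mem_eigSpace.2 ⟨_, hU _, rfl⟩)

lemma robinInv_apply_of_pencil (h : IsUnit (pencil J γ Λ (-s))) {U : G} {τ : ℝ} (hτ : τ + s ≠ 0)
    (hU : pencil J γ Λ τ U = 0) : robinInv J γ s Λ (γ U) = (τ + s)⁻¹ • γ U := by
  have h1 := eigenspace_robinInv h (inv_ne_zero hτ)
  rw [inv_inv, add_sub_cancel_right] at h1
  have h2 : γ U ∈ eigSpace J γ Λ τ := mem_eigSpace.2 ⟨U, hU, rfl⟩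
  rw [← h1, Module.End.mem_eigenspace_iff] at h2
  exact h2

lemma RobinCoercive.lt_of_pencil (h : RobinCoercive J γ s Λ) {U : G} {τ : ℝ} (hU0 : γ U ≠ 0)
    (hU : pencil J γ Λ τ U = 0) : -s < τ := by
  by_contra! hle
  exact hU0 (by rw [h.eq_zero hle hU, map_zero])

/-- No eigenvector is missing from the list. A further one with eigenvalue τ, together with the
eigenfunctions of index below n, would give n independent vectors, so by strong induction every
listed eigenvalue is at most τ. Then the images of the orthonormal traces under (D_Λ + s)⁻¹ have
norm at least (τ + s)⁻¹, against complete continuity. -/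
lemma eigenvector_eq_zero_of_orthogonal (h : RobinCoercive J γ s Λ) (hJ : CC J) (hγ : CC γ)
    {U : ℕ+ → G} (ho : Orthonormal ℝ fun j => γ (U j))
    (hU : ∀ j, pencil J γ Λ (eigVal J γ Λ j) (U j) = 0) {w : B} {τ : ℝ}
    (hw : w ∈ eigSpace J γ Λ τ) (hwo : ∀ j, ⟪γ (U j), w⟫ = 0) : w = 0 := by
  by_contra hw0
  obtain ⟨W, hW, rfl⟩ := mem_eigSpace.1 hw
  have hτs := h.lt_of_pencil hw0 hW
  have hle : ∀ n : ℕ+, eigVal J γ Λ n ≤ τ := by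
    intro n
    induction n using PNat.strongInductionOn with
    | _ n ih =>
      refine csInf_le (h.bddBelow n) ?_
      -- Slot 0 holds the extra vector and slots 1, …, n - 1 the eigenfunctions with those indices.
      let v : Fin n → B := fun i => if h : 0 < (i : ℕ) then γ (U ⟨i, h⟩) else γ W
      have hv : LinearIndependent ℝ v := by
        refine linearIndependent_of_ne_zero_of_inner_eq_zero (𝕜 := ℝ) (fun i => ?_) ?_
        · dsimp only [v]
          split_ifs
          · exact ho.ne_zero _
          · exact hw0
        · intro i j hij
          dsimp only [v]
          split_ifs with h1 h2 h2
          · refine ho.2 fun h3 => hij (Fin.ext ?_)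
            simpa using congrArg PNat.val h3
          · exact hwo _
          · rw [real_inner_comm]
            exact hwo _
          · exact absurd (Fin.ext (by lia)) hij
      refine le_rank_of_linearIndependent hv fun i => ?_
      dsimp only [v]
      split_ifs with h1
      · exact eigSpace_le_eigSpan (ih ⟨i, h1⟩ (PNat.coe_lt_coe _ _ |>.1 i.2)) (mem_eigSpace.2 ⟨_, hU _, rfl⟩)
      · exact eigSpace_le_eigSpan le_rfl hw
  have hinj : Function.Injective Nat.succPNat := Nat.succPNat_injective
  have hlim := tendsto_of_orthonormal (cc_robinInv (J := J) (Λ := Λ) (s := s) hγ)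
    (ho.comp _ hinj)
  have hge : ∀ n : ℕ, (τ + s)⁻¹ ≤ ‖robinInv J γ s Λ (γ (U n.succPNat))‖ := fun n => by
    have h1 := h.lt_of_pencil (ho.ne_zero n.succPNat) (hU _)
    have h2 : 0 < eigVal J γ Λ n.succPNat + s := by linarith
    rw [robinInv_apply_of_pencil (h.isUnit hJ hγ) h2.ne' (hU _), norm_smul, norm_inv,
      ho.1, mul_one, Real.norm_of_nonneg h2.le]
    exact inv_anti₀ h2 (by linarith [hle n.succPNat])
  have h3 : (τ + s)⁻¹ ≤ ‖(0 : B)‖ := ge_of_tendsto hlim.norm (Eventually.of_forall hge)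
  rw [norm_zero] at h3
  have h4 : 0 < τ + s := by linarith
  have h5 : 0 < (τ + s)⁻¹ := by positivity
  linarith

lemma RobinCoercive.isHarm_ringInverse (h : RobinCoercive J γ s Λ) (hJ : CC J) (hγ : CC γ)
    (f : B) : IsHarm J γ Λ (Ring.inverse (pencil J γ Λ (-s)) (γ.adjoint f)) := by
  intro V hV
  have h1 := inner_pencil (J := J) (γ := γ) (Λ := Λ) (σ := -s)
    (Ring.inverse (pencil J γ Λ (-s)) (γ.adjoint f)) V
  rw [pencil_ringInverse (h.isUnit hJ hγ), ContinuousLinearMap.adjoint_inner_left, hV,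
    inner_zero_right, inner_zero_right] at h1
  linarith

/-- Completeness of the eigenfunctions. -/
lemma adjoint_eq_zero_of_orthogonal (h : RobinCoercive J γ s Λ) (hJ : CC J) (hγ : CC γ)
    {U : ℕ+ → G} (ho : Orthonormal ℝ fun j => γ (U j))
    (hU : ∀ j, pencil J γ Λ (eigVal J γ Λ j) (U j) = 0) {y : B}
    (hy : ∀ j, ⟪γ (U j), y⟫ = 0) : γ.adjoint y = 0 := by
  have hu := h.isUnit hJ hγ
  obtain ⟨V, hV⟩ : ∃ V, V = Ring.inverse (pencil J γ Λ (-s)) (γ.adjoint y) := ⟨_, rfl⟩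
  have hpV : pencil J γ Λ (-s) V = γ.adjoint y := by rw [hV, pencil_ringInverse hu]
  -- If V ≠ 0, this makes the Rayleigh quotient of (D_Λ + s)⁻¹ positive at y. The operator then has
  -- an eigenvector in the orthogonal complement of all the eigenfunctions, which is impossible.
  have hge : 1 / 2 * ‖V‖ ^ 2 ≤ ⟪robinInv J γ s Λ y, y⟫ := by
    rw [inner_robinInv hu, ← hV]
    exact h V (hV ▸ h.isHarm_ringInverse hJ hγ y)
  by_cases hV0 : V = 0
  · rw [← hpV, hV0, map_zero]
  exfalso
  have hVpos : 0 < ‖V‖ ^ 2 := by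
    have := norm_pos_iff.2 hV0
    positivity
  have hy0 : y ≠ 0 := by
    rintro rfl
    exact hV0 (by rw [hV, map_zero, map_zero])
  have hypos : 0 < ‖y‖ ^ 2 := by
    have := norm_pos_iff.2 hy0
    positivity
  let P : Submodule ℝ B := (Submodule.span ℝ (Set.range fun j => γ (U j)))ᗮ
  have hmemP : ∀ z, z ∈ P ↔ ∀ j, ⟪γ (U j), z⟫ = 0 := fun z => by
    rw [Submodule.mem_orthogonal]
    refine ⟨fun h j => h _ (Submodule.subset_span ⟨j, rfl⟩), fun h v hv => ?_⟩
    induction hv using Submodule.span_induction with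
    | mem v hv =>
      obtain ⟨j, rfl⟩ := hv
      exact h j
    | zero => exact inner_zero_left _
    | add v w _ _ h1 h2 => rw [inner_add_left, h1, h2, add_zero]
    | smul c v _ h1 => rw [real_inner_smul_left, h1, mul_zero]
  have hsa := isSelfAdjoint_robinInv hu
  obtain ⟨μ, hμ, w, hwP, hw0, hw⟩ := exists_eigenvector_ge (cc_robinInv hγ) hsa (P := P)
    (fun z hz => by
      rw [hmemP] at hz ⊢
      intro j
      have h1 := h.lt_of_pencil (ho.ne_zero j) (hU j)
      rw [← hsa.inner_map_comm, robinInv_apply_of_pencil hu (by linarith) (hU j),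
        real_inner_smul_left, hz, mul_zero])
    (t := ⟪robinInv J γ s Λ y, y⟫ / ‖y‖ ^ 2)
    (div_pos (by linarith) hypos) ((hmemP y).2 hy) hy0
    (by rw [div_mul_cancel₀ _ hypos.ne'])
  have hμ0 : 0 < μ := lt_of_lt_of_le (div_pos (by linarith) hypos) hμ
  have hwe : w ∈ eigSpace J γ Λ (μ⁻¹ - s) := by
    rw [← eigenspace_robinInv hu hμ0.ne', Module.End.mem_eigenspace_iff]
    exact hw
  exact hw0 (eigenvector_eq_zero_of_orthogonal h hJ hγ ho hU hwe ((hmemP w).1 hwP))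

lemma inner_pencil_neg_of_pencil {U V : G} {τ : ℝ} (hU : pencil J γ Λ τ U = 0) :
    ⟪pencil J γ Λ (-s) U, V⟫ = (τ + s) * ⟪γ U, γ V⟫ := by
  have h1 := inner_pencil (J := J) (γ := γ) (Λ := Λ) (σ := τ) U V
  rw [hU, inner_zero_left] at h1
  rw [inner_pencil]
  linarith

lemma IsHarm.sum {ι : Type*} {F : Finset ι} {U : ι → G} (h : ∀ i, IsHarm J γ Λ (U i)) :
    IsHarm J γ Λ (∑ i ∈ F, U i) := by
  intro V hV
  rw [map_sum, sum_inner, sum_inner, Finset.mul_sum]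
  exact Finset.sum_congr rfl fun i _ => h i V hV

lemma isHarm_of_hasSum {ι : Type*} {U : ι → G} {X : G} (h : ∀ i, IsHarm J γ Λ (U i))
    (hX : HasSum U X) : IsHarm J γ Λ X := by
  intro V hV
  have h1 : Tendsto (fun F : Finset ι => ⟪∑ i ∈ F, U i, V⟫) atTop (𝓝 ⟪X, V⟫) :=
    Tendsto.inner hX tendsto_const_nhds
  have h2 : Tendsto (fun F : Finset ι => (1 + Λ) * ⟪J (∑ i ∈ F, U i), J V⟫) atTop
      (𝓝 ((1 + Λ) * ⟪J X, J V⟫)) :=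
    (((J.continuous.tendsto X).comp hX).inner tendsto_const_nhds).const_mul _
  exact tendsto_nhds_unique (h1.congr fun F => IsHarm.sum h V hV) h2

/-- Expansion of a `Λ`-harmonic element in the eigenfunctions. -/
theorem hasSum_eigenfunctions (h : RobinCoercive J γ s Λ) (hJ : CC J) (hγ : CC γ)
    {U : ℕ+ → G} (ho : Orthonormal ℝ fun j => γ (U j))
    (hU : ∀ j, pencil J γ Λ (eigVal J γ Λ j) (U j) = 0) {Y : G} (hY : IsHarm J γ Λ Y) :
    HasSum (fun j => ⟪γ (U j), γ Y⟫ • U j) Y := by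
  classical
  have hpos : ∀ j, 0 < eigVal J γ Λ j + s := fun j => by
    linarith [h.lt_of_pencil (ho.ne_zero j) (hU j)]
  have hharm : ∀ j, IsHarm J γ Λ (⟪γ (U j), γ Y⟫ • U j) := fun j =>
    (isHarm_of_pencil_eq_zero (hU j)).smul _
  have hsa : IsSelfAdjoint (pencil J γ Λ (-s)) := isSelfAdjoint_pencil
  have hUU : ∀ i j, ⟪pencil J γ Λ (-s) (U i), U j⟫
      = if i = j then eigVal J γ Λ j + s else 0 := fun i j => by
    rw [inner_pencil_neg_of_pencil (hU i), orthonormal_iff_ite.1 ho]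
    split_ifs with hij
    · rw [hij, mul_one]
    · rw [mul_zero]
  have hUF : ∀ (F : Finset ℕ+) i, ⟪pencil J γ Λ (-s) (U i), ∑ j ∈ F, ⟪γ (U j), γ Y⟫ • U j⟫
      = if i ∈ F then ⟪γ (U i), γ Y⟫ * (eigVal J γ Λ i + s) else 0 := fun F i => by
    rw [inner_sum]
    simp only [real_inner_smul_right, hUU, mul_ite, mul_zero, Finset.sum_ite_eq]
  have hFF : ∀ F : Finset ℕ+, ⟪pencil J γ Λ (-s) (∑ j ∈ F, ⟪γ (U j), γ Y⟫ • U j),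
      ∑ j ∈ F, ⟪γ (U j), γ Y⟫ • U j⟫
      = ∑ j ∈ F, ⟪γ (U j), γ Y⟫ ^ 2 * (eigVal J γ Λ j + s) := fun F => by
    rw [map_sum, sum_inner]
    refine Finset.sum_congr rfl fun j hj => ?_
    rw [map_smul, real_inner_smul_left, hUF, if_pos hj]
    ring
  have hFY : ∀ F : Finset ℕ+, ⟪pencil J γ Λ (-s) (∑ j ∈ F, ⟪γ (U j), γ Y⟫ • U j), Y⟫
      = ∑ j ∈ F, ⟪γ (U j), γ Y⟫ ^ 2 * (eigVal J γ Λ j + s) := fun F => by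
    rw [map_sum, sum_inner]
    refine Finset.sum_congr rfl fun j hj => ?_
    rw [map_smul, real_inner_smul_left, inner_pencil_neg_of_pencil (hU j)]
    ring
  -- Bessel's inequality for the Robin form, in which the U j are orthogonal with squares σ_j + s.
  -- It is coercivity applied to Y minus a partial sum.
  have hbessel : ∀ F : Finset ℕ+, ∑ j ∈ F, ⟪γ (U j), γ Y⟫ ^ 2 * (eigVal J γ Λ j + s)
      ≤ ⟪pencil J γ Λ (-s) Y, Y⟫ := fun F => by
    have h1 := h _ (hY.sub (IsHarm.sum (F := F) hharm))
    have h2 : 0 ≤ ‖Y - ∑ j ∈ F, ⟪γ (U j), γ Y⟫ • U j‖ ^ 2 := sq_nonneg _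
    have h3 : ⟪pencil J γ Λ (-s) Y, ∑ j ∈ F, ⟪γ (U j), γ Y⟫ • U j⟫
        = ∑ j ∈ F, ⟪γ (U j), γ Y⟫ ^ 2 * (eigVal J γ Λ j + s) := by
      rw [hsa.inner_map_comm, real_inner_comm, hFY]
    rw [map_sub, inner_sub_left, inner_sub_right, inner_sub_right, hFF, hFY, h3] at h1
    linarith
  have hsq : Summable fun j => ⟪γ (U j), γ Y⟫ ^ 2 * (eigVal J γ Λ j + s) :=
    summable_of_sum_le (fun j => mul_nonneg (sq_nonneg _) (hpos j).le) hbessel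
  -- Coercivity bounds the norm of a block of the series by the corresponding block of the
  -- convergent numerical series.
  have hsum : Summable fun j => ⟪γ (U j), γ Y⟫ • U j := by
    rw [summable_iff_vanishing_norm] at hsq ⊢
    intro ε hε
    obtain ⟨F₀, hF₀⟩ := hsq (ε ^ 2 / 2) (by positivity)
    refine ⟨F₀, fun F hF => ?_⟩
    have h1 := (le_abs_self _).trans_lt (hF₀ F hF)
    have h2 := h _ (IsHarm.sum (F := F) hharm)
    rw [hFF] at h2
    exact lt_of_pow_lt_pow_left₀ 2 hε.le (by linarith)
  obtain ⟨X, hX⟩ := hsum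
  have hXh := isHarm_of_hasSum hharm hX
  have hXU : ∀ i, ⟪γ (U i), γ X⟫ = ⟪γ (U i), γ Y⟫ := fun i => by
    have h1 := (innerSL ℝ (pencil J γ Λ (-s) (U i))).hasSum hX
    simp only [innerSL_apply_apply, real_inner_smul_right, hUU] at h1
    have h2 := h1.unique (hasSum_single i fun j hj => by rw [if_neg hj.symm, mul_zero])
    rw [if_pos rfl, inner_pencil_neg_of_pencil (hU i), mul_comm] at h2
    exact mul_right_cancel₀ (hpos i).ne' h2
  -- The trace of Y - X is orthogonal to all eigenfunctions, so completeness gives γ†γ(Y - X) = 0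
  -- and hence zero trace; regularity then removes the harmonic difference.
  have hzero : Y - X = 0 := by
    refine h.regular _ ?_ (hY.sub hXh)
    have h1 : γ.adjoint (γ (Y - X)) = 0 := adjoint_eq_zero_of_orthogonal h hJ hγ ho hU fun j => by
      rw [map_sub, inner_sub_right, hXU, sub_self]
    rw [← inner_self_eq_zero (𝕜 := ℝ), ← ContinuousLinearMap.adjoint_inner_left, h1,
      inner_zero_left]
  rw [(sub_eq_zero.1 hzero).symm] at hX
  exact hX

/-- The first two derivatives of a simple eigenvalue. -/
theorem eigVal_derivatives_series (hJ : CC J) (hγ : CC γ) {Λ₀ : ℝ} (hreg : Regular J γ Λ₀)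
    {k : ℕ+} (hfin : Module.finrank ℝ (eigSpace J γ Λ₀ (eigVal J γ Λ₀ k)) = 1) {U : ℕ+ → G}
    (ho : Orthonormal ℝ fun j => γ (U j))
    (hU : ∀ j, pencil J γ Λ₀ (eigVal J γ Λ₀ j) (U j) = 0) {D : G} (hD0 : γ D = 0)
    (hD : ∀ V, γ V = 0 → ⟪D, V⟫ - (1 + Λ₀) * ⟪J D, J V⟫ = ⟪J (U k), J V⟫) :
    HasDerivAt (fun Λ => eigVal J γ Λ k) (-‖J (U k)‖ ^ 2) Λ₀ ∧
    (∀ᶠ Λ in 𝓝 Λ₀, DifferentiableAt ℝ (fun Λ => eigVal J γ Λ k) Λ) ∧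
    Summable (fun j : {j : ℕ+ // j ≠ k} =>
      ⟪J (U j), J (U k)⟫ ^ 2 / (eigVal J γ Λ₀ j - eigVal J γ Λ₀ k)) ∧
    HasDerivAt (deriv (fun Λ => eigVal J γ Λ k))
      (-2 * (⟪J D, J (U k)⟫ + ∑' j : {j : ℕ+ // j ≠ k},
        ⟪J (U j), J (U k)⟫ ^ 2 / (eigVal J γ Λ₀ j - eigVal J γ Λ₀ k))) Λ₀ := by
  obtain ⟨s, hs⟩ := eventually_robinCoercive hJ hγ hreg
  have hs := hs.self_of_nhds
  have hne := exists_le_rank_eigSpan (J := J) (Λ := Λ₀) ho hU k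
  -- Simplicity is assumed for boundary values. It lifts to the kernel in G, because a harmonic
  -- element is determined by its trace.
  have hsimple : ∀ V, pencil J γ Λ₀ (eigVal J γ Λ₀ k) V = 0 → ∃ c : ℝ, V = c • U k := by
    intro V hV
    have hk0 : (⟨γ (U k), mem_eigSpace.2 ⟨_, hU k, rfl⟩⟩ :
        eigSpace J γ Λ₀ (eigVal J γ Λ₀ k)) ≠ 0 := fun h =>
      ho.ne_zero k (congrArg Subtype.val h)
    obtain ⟨c, hc⟩ := (finrank_eq_one_iff_of_nonzero' _ hk0).1 hfin
      ⟨γ V, mem_eigSpace.2 ⟨_, hV, rfl⟩⟩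
    have hc' : c • γ (U k) = γ V := congrArg Subtype.val hc
    refine ⟨c, sub_eq_zero.1 (hreg _ ?_ ?_)⟩
    · rw [map_sub, map_smul, hc', sub_self]
    · exact (isHarm_of_pencil_eq_zero hV).sub ((isHarm_of_pencil_eq_zero (hU k)).smul c)
  obtain ⟨h1, h2, Z, hZ, hγZ, h3⟩ := eigVal_derivatives hJ hγ hreg hne (hU k) (ho.1 k) hsimple
  refine ⟨h1, h2, ?_⟩
  -- Against elements with zero trace, Z and D satisfy the same inhomogeneous equation with source
  -- J(U k).
  have hY : IsHarm J γ Λ₀ (Z - D) := by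
    intro V hV
    have h4 := inner_pencil (J := J) (γ := γ) (Λ := Λ₀) (σ := eigVal J γ Λ₀ k) Z V
    rw [hZ, inner_sub_left, real_inner_smul_left, ContinuousLinearMap.adjoint_inner_left,
      ContinuousLinearMap.adjoint_inner_left, hV, inner_zero_right, inner_zero_right] at h4
    have h5 := hD V hV
    rw [map_sub, inner_sub_left, inner_sub_left]
    linarith
  have hγY : γ (Z - D) = γ Z := by rw [map_sub, hD0, sub_zero]
  have hsa : IsSelfAdjoint (pencil J γ Λ₀ (eigVal J γ Λ₀ k)) := isSelfAdjoint_pencil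
  -- The equation for Z is paired with U j; at the parameter σ_k the pencil sends U j to (σ_j -
  -- σ_k)γ†γ(U j).
  have hcoef : ∀ j, j ≠ k → ⟪γ (U j), γ Z⟫
      = ⟪J (U j), J (U k)⟫ / (eigVal J γ Λ₀ j - eigVal J γ Λ₀ k) := by
    intro j hj
    have hjk : ⟪γ (U k), γ (U j)⟫ = 0 := ho.2 hj.symm
    have hne' : eigVal J γ Λ₀ j - eigVal J γ Λ₀ k ≠ 0 := by
      intro h4
      have h5 := hU j
      rw [sub_eq_zero.1 h4] at h5
      obtain ⟨c, hc⟩ := hsimple _ h5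
      have h6 : ⟪γ (U j), γ (U j)⟫ = 0 := by
        nth_rewrite 1 [hc]
        rw [map_smul, real_inner_smul_left, hjk, mul_zero]
      exact ho.ne_zero j (inner_self_eq_zero.1 h6)
    have h4 := hsa.inner_map_comm Z (U j)
    have h5 : pencil J γ Λ₀ (eigVal J γ Λ₀ k) (U j)
        = (eigVal J γ Λ₀ j - eigVal J γ Λ₀ k) • γ.adjoint (γ (U j)) := by
      have h6 := pencil_sub_apply (J := J) (γ := γ) (Λ := Λ₀) (σ := eigVal J γ Λ₀ j)
        (τ := eigVal J γ Λ₀ k - eigVal J γ Λ₀ j) (U j)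
      rw [hU j, add_sub_cancel, zero_sub, ← neg_smul, neg_sub] at h6
      exact h6
    rw [hZ, h5, inner_sub_left, real_inner_smul_left, real_inner_smul_right,
      ContinuousLinearMap.adjoint_inner_left, ContinuousLinearMap.adjoint_inner_left,
      ContinuousLinearMap.adjoint_inner_right, hjk] at h4
    rw [eq_div_iff hne', real_inner_comm, real_inner_comm (J (U k))]
    linarith
  have hsum := hasSum_eigenfunctions hs hJ hγ ho hU hY
  have hsum2 := (innerSL ℝ (J (U k))).hasSum (J.hasSum hsum)
  simp only [innerSL_apply_apply, map_smul, hγY] at hsum2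
  have hsub : HasSum (fun j : {j : ℕ+ // j ≠ k} =>
      ⟪J (U j), J (U k)⟫ ^ 2 / (eigVal J γ Λ₀ j - eigVal J γ Λ₀ k)) ⟪J (U k), J (Z - D)⟫ := by
    -- The term j = k is absent because ⟪γ(U k), γZ⟫ = 0.
    have h4 : Function.support (fun j => ⟪γ (U j), γ Z⟫ * ⟪J (U k), J (U j)⟫) ⊆ {j | j ≠ k} := by
      intro j hj hjk
      apply hj
      simp only [hjk, hγZ, zero_mul]
    have h5 := (hasSum_subtype_iff_of_support_subset h4).2 hsum2
    refine h5.congr_fun fun j => ?_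
    simp only [Function.comp_apply]
    rw [hcoef j j.2, real_inner_comm (J (U j)) (J (U k))]
    ring
  refine ⟨hsub.summable, ?_⟩
  rw [hsub.tsum_eq, map_sub, inner_sub_right, real_inner_comm (J D), real_inner_comm (J Z)]
  convert h3 using 2
  ring

end Expansion

/-! ### Concavity of the lowest eigenvalue -/

section Concavity

set_option linter.unusedSectionVars false

variable {G H B : Type*} [NormedAddCommGroup G] [InnerProductSpace ℝ G] [CompleteSpace G]
  [NormedAddCommGroup H] [InnerProductSpace ℝ H] [CompleteSpace H]
  [NormedAddCommGroup B] [InnerProductSpace ℝ B] [CompleteSpace B]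
  {J : G →L[ℝ] H} {γ : G →L[ℝ] B} {l Λ : ℝ}

/-- If this failed, the compact operator J†J restricted to ker γ would have an eigenvalue μ ≥
‖JU‖²/‖U‖². Its eigenvector solves the interior problem with parameter μ⁻¹ - 1 < Λ, which is still
regular. -/
lemma norm_sq_ge_of_ker (hJ : CC J) (hreg : ∀ Λ < l, Regular J γ Λ) (hΛ : Λ < l) {U : G}
    (hU : γ U = 0) : (1 + Λ) * ‖J U‖ ^ 2 ≤ ‖U‖ ^ 2 := by
  by_contra! hlt
  have hΛ1 : 0 < 1 + Λ := by
    by_contra! hle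
    nlinarith [sq_nonneg ‖U‖, sq_nonneg ‖J U‖]
  have hU0 : U ≠ 0 := by
    rintro rfl
    simp at hlt
  have hUpos : 0 < ‖U‖ ^ 2 := by
    have := norm_pos_iff.2 hU0
    positivity
  let J₀ : γ.ker →L[ℝ] H := J ∘L γ.ker.subtypeL
  have hJ₀ : CC J₀ := hJ.comp_right _
  have hsa : IsSelfAdjoint (J₀.adjoint ∘L J₀) := isSelfAdjoint_of_inner fun x y => by
    simp [ContinuousLinearMap.adjoint_inner_left, ContinuousLinearMap.adjoint_inner_right]
  have hJpos : 0 < ‖J U‖ ^ 2 := by nlinarith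
  obtain ⟨μ, hμ, W, -, hW0, hW⟩ := exists_eigenvector_ge (hJ₀.comp_left _) hsa (P := ⊤)
    (fun _ _ => trivial) (t := ‖J U‖ ^ 2 / ‖U‖ ^ 2) (div_pos hJpos hUpos)
    (x := ⟨U, hU⟩) trivial (fun h => hU0 (congrArg Subtype.val h)) (by
      rw [ContinuousLinearMap.coe_comp, Function.comp_apply,
        ContinuousLinearMap.adjoint_inner_left, real_inner_self_eq_norm_sq]
      exact (div_mul_cancel₀ _ hUpos.ne').le)
  have hμ0 : 0 < μ := lt_of_lt_of_le (div_pos hJpos hUpos) hμ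
  have hμΛ : μ⁻¹ - 1 < l := by
    have h1 : μ⁻¹ ≤ ‖U‖ ^ 2 / ‖J U‖ ^ 2 := by
      rw [← inv_div]
      exact inv_anti₀ (div_pos hJpos hUpos) hμ
    have h2 : ‖U‖ ^ 2 / ‖J U‖ ^ 2 < 1 + Λ := by
      rw [div_lt_iff₀ hJpos]
      exact hlt
    linarith
  refine hW0 (Subtype.ext (hreg _ hμΛ W W.2 fun V hV => ?_))
  have h1 : ⟪(J₀.adjoint ∘L J₀) W, (⟨V, hV⟩ : γ.ker)⟫ = ⟪μ • W, (⟨V, hV⟩ : γ.ker)⟫ := by rw [hW]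
  rw [real_inner_smul_left, ContinuousLinearMap.coe_comp, Function.comp_apply,
    ContinuousLinearMap.adjoint_inner_left] at h1
  have h2 : ⟪J W, J V⟫ = μ * ⟪(W : G), V⟫ := h1
  rw [h2, add_sub_cancel, ← mul_assoc, inv_mul_cancel₀ hμ0.ne', one_mul]

/-- A large boundary penalty makes the form coercive on all of G. Normalised counterexamples have a
weak limit with zero trace, which contradicts the inequality on ker γ. -/
lemma exists_coercive (hJ : CC J) (hγ : CC γ) (hreg : ∀ Λ < l, Regular J γ Λ) (hΛ : Λ < l) :
    ∃ c > 0, ∃ C, ∀ U, c * ‖U‖ ^ 2 ≤ ‖U‖ ^ 2 - (1 + Λ) * ‖J U‖ ^ 2 + C * ‖γ U‖ ^ 2 := by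
  by_contra! hcon
  have h1 : ∀ n : ℕ, ∃ U : G, ‖U‖ = 1 ∧
      1 - (1 + Λ) * ‖J U‖ ^ 2 + ((n : ℝ) + 1) * ‖γ U‖ ^ 2 < 1 / ((n : ℝ) + 1) := fun n => by
    obtain ⟨U, hU⟩ := hcon (1 / ((n : ℝ) + 1)) (by positivity) ((n : ℝ) + 1)
    have hU0 : U ≠ 0 := by
      rintro rfl
      simp at hU
    have hn : 0 < ‖U‖ := norm_pos_iff.2 hU0
    refine ⟨‖U‖⁻¹ • U, norm_smul_inv_norm (𝕜 := ℝ) hU0, ?_⟩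
    rw [map_smul, map_smul, norm_smul, norm_smul, norm_inv, norm_norm, mul_pow, mul_pow, inv_pow]
    have h4 := mul_lt_mul_of_pos_left hU (show 0 < (‖U‖ ^ 2)⁻¹ by positivity)
    have h5 : (‖U‖ ^ 2)⁻¹ * (1 / ((n : ℝ) + 1) * ‖U‖ ^ 2) = 1 / ((n : ℝ) + 1) := by
      field_simp
    have h6 : (‖U‖ ^ 2)⁻¹ * ‖U‖ ^ 2 = 1 := inv_mul_cancel₀ (by positivity)
    have h7 : (‖U‖ ^ 2)⁻¹ * (‖U‖ ^ 2 - (1 + Λ) * ‖J U‖ ^ 2 + ((n : ℝ) + 1) * ‖γ U‖ ^ 2)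
        = (‖U‖ ^ 2)⁻¹ * ‖U‖ ^ 2 - (1 + Λ) * ((‖U‖ ^ 2)⁻¹ * ‖J U‖ ^ 2)
          + ((n : ℝ) + 1) * ((‖U‖ ^ 2)⁻¹ * ‖γ U‖ ^ 2) := by ring
    rw [h5, h7, h6] at h4
    exact h4
  choose U hU1 hU using h1
  obtain ⟨U₀, hw⟩ := exists_weakLim (x := U) (C := 1) fun n => (hU1 n).le
  have hJlim := (hJ U U₀ hw).norm.pow 2
  have hγlim := (hγ U U₀ hw).norm.pow 2
  have h0 : Tendsto (fun n : ℕ => 1 / ((n : ℝ) + 1)) (hyperfilter ℕ : Filter ℕ) (𝓝 0) :=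
    tendsto_one_div_add_atTop_nhds_zero_nat.mono_left Nat.hyperfilter_le_atTop
  have h1n : ∀ n : ℕ, 1 / ((n : ℝ) + 1) ≤ 1 := fun n => by
    rw [div_le_one (by positivity)]
    linarith [Nat.cast_nonneg (α := ℝ) n]
  have hγ0 : γ U₀ = 0 := by
    have h3 : Tendsto (fun n => ‖γ (U n)‖ ^ 2) (hyperfilter ℕ : Filter ℕ) (𝓝 0) := by
      refine squeeze_zero (g := fun n : ℕ => ((1 + |Λ|) * ‖J‖ ^ 2) * (1 / ((n : ℝ) + 1)))
        (fun n => by positivity) (fun n => ?_)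
        (by simpa using h0.const_mul ((1 + |Λ|) * ‖J‖ ^ 2))
      have h2 : ‖J (U n)‖ ^ 2 ≤ ‖J‖ ^ 2 := by
        gcongr
        simpa [hU1 n] using J.le_opNorm (U n)
      have h4 : (1 + Λ) * ‖J (U n)‖ ^ 2 ≤ (1 + |Λ|) * ‖J‖ ^ 2 := by
        have := le_abs_self Λ
        calc _ ≤ (1 + |Λ|) * ‖J (U n)‖ ^ 2 := by gcongr
          _ ≤ _ := by gcongr
      rw [mul_one_div, le_div_iff₀ (by positivity)]
      linarith [hU n, h1n n]
    simpa using tendsto_nhds_unique hγlim h3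
  have h2 : 1 ≤ (1 + Λ) * ‖J U₀‖ ^ 2 := by
    have h3 : Tendsto (fun n : ℕ => (1 + Λ) * ‖J (U n)‖ ^ 2 + 1 / ((n : ℝ) + 1))
        (hyperfilter ℕ : Filter ℕ) (𝓝 ((1 + Λ) * ‖J U₀‖ ^ 2 + 0)) :=
      (hJlim.const_mul _).add h0
    rw [add_zero] at h3
    refine ge_of_tendsto h3 (Eventually.of_forall fun n => ?_)
    have := hU n
    have : 0 ≤ ((n : ℝ) + 1) * ‖γ (U n)‖ ^ 2 := by positivity
    linarith
  -- A parameter strictly between Λ and l gives strictness: 1 ≥ ‖U₀‖² > (1 + Λ)‖JU₀‖² ≥ 1.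
  have h3 := norm_sq_ge_of_ker hJ hreg (show (Λ + l) / 2 < l by linarith) hγ0
  have h4 : ‖U₀‖ ^ 2 ≤ 1 := pow_le_one₀ (norm_nonneg _) (hw.norm_le fun n => (hU1 n).le)
  have h5 : 0 < ‖J U₀‖ ^ 2 := by
    by_contra! hle
    have : ‖J U₀‖ ^ 2 = 0 := le_antisymm hle (sq_nonneg _)
    rw [this, mul_zero] at h2
    linarith
  nlinarith

/-- The variational characterization of the lowest eigenvalue. -/
lemma exists_minimizer (hJ : CC J) (hγ : CC γ) (hreg : ∀ Λ < l, Regular J γ Λ) (hΛ : Λ < l)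
    (hγ0 : γ ≠ 0) :
    (∀ V, eigVal J γ Λ 1 * ‖γ V‖ ^ 2 ≤ ‖V‖ ^ 2 - (1 + Λ) * ‖J V‖ ^ 2 - ‖γ V‖ ^ 2) ∧
    ∃ U, ‖γ U‖ = 1 ∧ eigVal J γ Λ 1 = ‖U‖ ^ 2 - (1 + Λ) * ‖J U‖ ^ 2 - ‖γ U‖ ^ 2 := by
  obtain ⟨c, hc, C, hC⟩ := exists_coercive hJ hγ hreg hΛ
  let a : G → ℝ := fun U => ‖U‖ ^ 2 - (1 + Λ) * ‖J U‖ ^ 2 - ‖γ U‖ ^ 2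
  obtain ⟨S, hS⟩ : ∃ S : Set ℝ, S = a '' {U | ‖γ U‖ = 1} := ⟨_, rfl⟩
  have hbd : BddBelow S := by
    refine ⟨-1 - C, ?_⟩
    rw [hS]
    rintro _ ⟨U, hU, rfl⟩
    have h1 : ‖γ U‖ = 1 := hU
    have h2 := hC U
    have h3 : 0 ≤ c * ‖U‖ ^ 2 := by positivity
    simp only [a, h1] at h2 ⊢
    linarith
  have hne : S.Nonempty := by
    obtain ⟨V, hV⟩ : ∃ V, γ V ≠ 0 := by
      by_contra! h
      exact hγ0 (ContinuousLinearMap.ext h)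
    rw [hS]
    refine ⟨_, ‖γ V‖⁻¹ • V, ?_, rfl⟩
    show ‖γ (‖γ V‖⁻¹ • V)‖ = 1
    rw [map_smul]
    exact norm_smul_inv_norm (𝕜 := ℝ) hV
  have hle : ∀ V, sInf S * ‖γ V‖ ^ 2 ≤ a V := by
    intro V
    by_cases hV : γ V = 0
    · have := norm_sq_ge_of_ker hJ hreg hΛ hV
      simp only [a, hV, norm_zero]
      linarith
    · have hn : 0 < ‖γ V‖ := norm_pos_iff.2 hV
      have h1 : sInf S ≤ a (‖γ V‖⁻¹ • V) := by
        refine csInf_le hbd (hS ▸ ⟨_, ?_, rfl⟩)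
        show ‖γ (‖γ V‖⁻¹ • V)‖ = 1
        rw [map_smul]
        exact norm_smul_inv_norm (𝕜 := ℝ) hV
      have h2 : a (‖γ V‖⁻¹ • V) = (‖γ V‖ ^ 2)⁻¹ * a V := by
        simp only [a, map_smul, norm_smul, norm_inv, norm_norm]
        ring
      rw [h2, le_inv_mul_iff₀ (by positivity)] at h1
      linarith
  obtain ⟨b, -, hb, hbS⟩ := exists_seq_tendsto_sInf hne hbd
  have hbS' : ∀ n, ∃ U, ‖γ U‖ = 1 ∧ a U = b n := fun n => by
    obtain ⟨U, hU, hUb⟩ := hS ▸ hbS n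
    exact ⟨U, hU, hUb⟩
  choose U hU1 hUb using hbS'
  obtain ⟨M, hM⟩ := hb.bddAbove_range
  have hbound : ∀ n, ‖U n‖ ≤ √((M + 1 + C) / c) := fun n => by
    apply Real.le_sqrt_of_sq_le
    rw [le_div_iff₀ hc]
    have h1 := hC (U n)
    have h2 : b n ≤ M := hM ⟨n, rfl⟩
    have h3 := hUb n
    simp only [a, hU1 n] at h1 h3
    linarith
  obtain ⟨U₀, hw⟩ := exists_weakLim hbound
  have hγU : ‖γ U₀‖ = 1 := by
    have h1 := (hγ U U₀ hw).norm
    simp only [hU1] at h1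
    exact (tendsto_nhds_unique tendsto_const_nhds h1).symm
  -- Weak lower semicontinuity of the norm, through 2⟪U n, U₀⟫ - ‖U₀‖² ≤ ‖U n‖².
  have hmin : a U₀ ≤ sInf S := by
    have h1 : Tendsto (fun n => 2 * ⟪U n, U₀⟫ - ‖U₀‖ ^ 2 - (1 + Λ) * ‖J (U n)‖ ^ 2 - 1)
        (hyperfilter ℕ : Filter ℕ)
        (𝓝 (2 * ⟪U₀, U₀⟫ - ‖U₀‖ ^ 2 - (1 + Λ) * ‖J U₀‖ ^ 2 - 1)) :=
      ((((hw.2 U₀).const_mul 2).sub_const _).sub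
        (((hJ U U₀ hw).norm.pow 2).const_mul _)).sub_const _
    have h2 := le_of_tendsto_of_tendsto' h1 (hb.mono_left Nat.hyperfilter_le_atTop) fun n => by
      rw [← hUb n]
      have h3 : 0 ≤ ‖U n - U₀‖ ^ 2 := sq_nonneg _
      rw [norm_sub_sq_real] at h3
      simp only [a, hU1 n]
      linarith
    rw [real_inner_self_eq_norm_sq] at h2
    simp only [a, hγU]
    linarith
  have haU : a U₀ = sInf S := le_antisymm hmin (by simpa [hγU] using hle U₀)
  have hpen : ∀ V, ⟪pencil J γ Λ (sInf S) V, V⟫ = a V - sInf S * ‖γ V‖ ^ 2 := fun V => by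
    rw [inner_pencil, real_inner_self_eq_norm_sq, real_inner_self_eq_norm_sq,
      real_inner_self_eq_norm_sq]
    simp only [a]
    ring
  have heig : pencil J γ Λ (sInf S) U₀ = 0 := by
    have h1 := inner_eq_zero_of_nonneg (isSelfAdjoint_pencil (J := J) (γ := γ) (Λ := Λ)
      (σ := sInf S)) (P := ⊤) (fun V _ => by rw [hpen]; linarith [hle V]) (w := U₀) trivial
      (by rw [hpen, haU, hγU]; simp)
    exact inner_self_eq_zero (𝕜 := ℝ) |>.1 (h1 _ trivial)
  have hval : eigVal J γ Λ 1 = sInf S := by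
    refine IsLeast.csInf_eq ⟨?_, fun σ hσ => ?_⟩
    · have h1 : γ U₀ ∈ eigSpan J γ Λ (sInf S) :=
        eigSpace_le_eigSpan le_rfl (mem_eigSpace.2 ⟨_, heig, rfl⟩)
      refine le_rank_of_linearIndependent (n := 1) (v := fun _ => γ U₀) ?_ fun _ => h1
      refine LinearIndependent.of_subsingleton 0 ?_
      intro h
      rw [h, norm_zero] at hγU
      exact zero_ne_one hγU
    · by_contra! hlt
      have h1 : eigSpan J γ Λ σ = ⊥ := by
        rw [eq_bot_iff]
        refine iSup₂_le fun τ hτ u hu => ?_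
        obtain ⟨V, hV, rfl⟩ := mem_eigSpace.1 hu
        have h2 := inner_pencil (J := J) (γ := γ) (Λ := Λ) (σ := τ) V V
        rw [hV, inner_zero_left, real_inner_self_eq_norm_sq, real_inner_self_eq_norm_sq,
          real_inner_self_eq_norm_sq] at h2
        have h3 := hle V
        simp only [a] at h3
        have h4 : τ < sInf S := lt_of_le_of_lt hτ hlt
        have h5 : ‖γ V‖ ^ 2 ≤ 0 := by
          by_contra! hp
          nlinarith
        exact norm_eq_zero.1 (pow_eq_zero_iff two_ne_zero |>.1 (le_antisymm h5 (sq_nonneg _)))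
      have h2 : (((1 : ℕ+) : ℕ) : Cardinal) ≤ Module.rank ℝ (eigSpan J γ Λ σ) := hσ
      rw [h1, rank_bot] at h2
      simp at h2
  rw [hval]
  exact ⟨hle, U₀, hγU, haU.symm⟩

/-- The minimiser at the intermediate parameter is a trial function at the two end parameters, and
the quadratic form is affine in Λ. -/
theorem concaveOn_eigVal_one (hJ : CC J) (hγ : CC γ) (hreg : ∀ Λ < l, Regular J γ Λ) :
    ConcaveOn ℝ (Set.Iio l) fun Λ => eigVal J γ Λ 1 := by
  -- With a zero trace operator there are no eigenvectors, and the value of the infimum is the same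
  -- for all Λ.
  by_cases hγ0 : γ = 0
  · have h1 : (fun Λ => eigVal J γ Λ 1) = fun _ => eigVal J γ 0 1 := by
      have h2 : ∀ Λ σ, eigSpan J γ Λ σ = ⊥ := fun Λ σ => by
        rw [eq_bot_iff]
        refine iSup₂_le fun τ hτ u hu => ?_
        obtain ⟨V, -, rfl⟩ := mem_eigSpace.1 hu
        simp [hγ0]
      funext Λ
      have h3 : eigSpan J γ Λ = eigSpan J γ 0 := funext fun σ => (h2 Λ σ).trans (h2 0 σ).symm
      unfold eigVal
      rw [h3]
    rw [h1]
    exact concaveOn_const _ (convex_Iio l)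
  refine ⟨convex_Iio l, fun x hx y hy p q hp hq hpq => ?_⟩
  obtain ⟨-, U, hU1, hU⟩ := exists_minimizer hJ hγ hreg (convex_Iio l hx hy hp hq hpq) hγ0
  have h1 := (exists_minimizer hJ hγ hreg hx hγ0).1 U
  have h2 := (exists_minimizer hJ hγ hreg hy hγ0).1 U
  rw [hU1] at h1 h2 hU
  simp only [smul_eq_mul] at hU ⊢
  rw [hU]
  have h3 : ‖U‖ ^ 2 - (1 + (p * x + q * y)) * ‖J U‖ ^ 2 - 1 ^ 2
      = p * (‖U‖ ^ 2 - (1 + x) * ‖J U‖ ^ 2 - 1 ^ 2)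
        + q * (‖U‖ ^ 2 - (1 + y) * ‖J U‖ ^ 2 - 1 ^ 2) := by
    have : q = 1 - p := by linarith
    rw [this]
    ring
  rw [h3]
  simp only [one_pow, mul_one] at h1 h2 ⊢
  gcongr

end Concavity

end DtN

end

noncomputable section

namespace DtN

/-! ### Graph coordinates -/

section Coordinates

open scoped ENNReal NNReal

variable {d : ℕ} {e : Euc d}

lemma inner_add_smul_self (he : ‖e‖ = 1) (y : (ℝ ∙ e)ᗮ) (s : ℝ) :
    ⟪e, (y : Euc d) + s • e⟫ = s := by
  have h1 : ⟪e, (y : Euc d)⟫ = 0 := Submodule.mem_orthogonal_singleton_iff_inner_right.1 y.2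
  rw [inner_add_right, h1, real_inner_smul_right, real_inner_self_eq_norm_sq, he]
  ring

lemma sub_inner_smul_mem (he : ‖e‖ = 1) (x : Euc d) : x - ⟪e, x⟫ • e ∈ (ℝ ∙ e)ᗮ := by
  rw [Submodule.mem_orthogonal_singleton_iff_inner_right, inner_sub_right, real_inner_smul_right,
    real_inner_self_eq_norm_sq, he]
  ring

/-- The coordinates `(x', ⟪e, x⟫)` of a point, with `x'` orthogonal to the unit vector `e`. -/
def splitEquiv (he : ‖e‖ = 1) : WithLp 2 ((ℝ ∙ e)ᗮ × ℝ) ≃ₗᵢ[ℝ] Euc d where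
  toFun z := (z.fst : Euc d) + z.snd • e
  invFun x := WithLp.toLp 2 (⟨x - ⟪e, x⟫ • e, sub_inner_smul_mem he x⟩, ⟪e, x⟫)
  map_add' z w := by
    simp only [WithLp.add_fst, WithLp.add_snd, Submodule.coe_add, add_smul]
    abel
  map_smul' c z := by
    simp only [WithLp.smul_fst, WithLp.smul_snd, Submodule.coe_smul, smul_add, smul_eq_mul,
      mul_smul, RingHom.id_apply]
  left_inv z := by
    have h := inner_add_smul_self he z.fst z.snd
    simp only [h, add_sub_cancel_right]
    rfl
  right_inv x := by simp
  norm_map' z := by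
    have h1 : ⟪(z.fst : Euc d), e⟫ = 0 := Submodule.mem_orthogonal_singleton_iff_inner_left.1
      z.fst.2
    have h2 : ‖(z.fst : Euc d) + z.snd • e‖ ^ 2 = ‖z‖ ^ 2 := by
      rw [norm_add_sq_real, real_inner_smul_right, h1, norm_smul, he, WithLp.prod_norm_sq_eq_of_L2]
      simp
    exact (sq_eq_sq₀ (norm_nonneg _) (norm_nonneg _)).1 h2

lemma measurePreserving_split (he : ‖e‖ = 1) :
    MeasurePreserving (fun z : (ℝ ∙ e)ᗮ × ℝ => (z.1 : Euc d) + z.2 • e) volume volume :=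
  (splitEquiv he).measurePreserving.comp (WithLp.volume_preserving_toLp (ℝ ∙ e)ᗮ ℝ)

lemma lintegral_split (he : ‖e‖ = 1) {f : Euc d → ℝ≥0∞} (hf : Measurable f) :
    ∫⁻ x, f x = ∫⁻ y : (ℝ ∙ e)ᗮ, ∫⁻ s : ℝ, f (y + s • e) := by
  rw [← (measurePreserving_split he).lintegral_comp hf, Measure.volume_eq_prod,
    lintegral_prod (fun z : (ℝ ∙ e)ᗮ × ℝ => f ((z.1 : Euc d) + z.2 • e))
      (hf.comp (measurePreserving_split he).measurable).aemeasurable]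

/-- The point at depth `t` below the graph of `g`. -/
def graphPt (e : Euc d) (g : Euc d → ℝ) (t : ℝ) (y : (ℝ ∙ e)ᗮ) : Euc d :=
  (y : Euc d) + (g y - t) • e

lemma lintegral_graph (he : ‖e‖ = 1) (g : Euc d → ℝ) {f : Euc d → ℝ≥0∞} (hf : Measurable f) :
    ∫⁻ x, f x = ∫⁻ y : (ℝ ∙ e)ᗮ, ∫⁻ t : ℝ, f (graphPt e g t y) := by
  rw [lintegral_split he hf]
  refine lintegral_congr fun y => ?_
  exact (lintegral_sub_left_eq_self (fun s : ℝ => f (y + s • e)) (g y)).symm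

/-- The signed height over the graph of `g`. -/
def height (e : Euc d) (g : Euc d → ℝ) (x : Euc d) : ℝ := ⟪e, x⟫ - g (x - ⟪e, x⟫ • e)

lemma height_graphPt (he : ‖e‖ = 1) (g : Euc d → ℝ) (t : ℝ) (y : (ℝ ∙ e)ᗮ) :
    height e g (graphPt e g t y) = -t := by
  rw [height, graphPt, inner_add_smul_self he, add_sub_cancel_right]
  ring

lemma graphPt_height (he : ‖e‖ = 1) (g : Euc d → ℝ) (x : Euc d) :
    graphPt e g (-height e g x) ⟨x - ⟪e, x⟫ • e, sub_inner_smul_mem he x⟩ = x := by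
  simp only [graphPt, height]
  rw [show g (x - ⟪e, x⟫ • e) - -(⟪e, x⟫ - g (x - ⟪e, x⟫ • e)) = ⟪e, x⟫ by ring]
  exact sub_add_cancel _ _

lemma norm_sub_inner_smul_le (he : ‖e‖ = 1) (x : Euc d) : ‖x - ⟪e, x⟫ • e‖ ≤ ‖x‖ := by
  have h1 : ‖x - ⟪e, x⟫ • e‖ ^ 2 ≤ ‖x‖ ^ 2 := by
    rw [norm_sub_sq_real, real_inner_smul_right, norm_smul, he, real_inner_comm e x]
    simp only [Real.norm_eq_abs, mul_one, sq_abs]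
    nlinarith [sq_nonneg ⟪x, e⟫]
  exact le_of_sq_le_sq h1 (norm_nonneg _)

lemma abs_height_sub_le (he : ‖e‖ = 1) {g : Euc d → ℝ} {K : ℝ≥0} (hg : LipschitzWith K g)
    (x z : Euc d) : |height e g x - height e g z| ≤ (1 + K) * ‖x - z‖ := by
  have h1 : |⟪e, x - z⟫| ≤ ‖x - z‖ := by
    have := abs_real_inner_le_norm e (x - z)
    rwa [he, one_mul] at this
  have h2 : |g (x - ⟪e, x⟫ • e) - g (z - ⟪e, z⟫ • e)| ≤ K * ‖x - z‖ := by
    have h3 := hg.dist_le_mul (x - ⟪e, x⟫ • e) (z - ⟪e, z⟫ • e)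
    rw [Real.dist_eq, dist_eq_norm] at h3
    refine h3.trans ?_
    gcongr
    have h4 := norm_sub_inner_smul_le he (x - z)
    rw [inner_sub_right] at h4
    refine le_trans (le_of_eq ?_) h4
    congr 1
    module
  have h5 : height e g x - height e g z
      = ⟪e, x - z⟫ - (g (x - ⟪e, x⟫ • e) - g (z - ⟪e, z⟫ • e)) := by
    rw [height, height, inner_sub_right]
    ring
  rw [h5]
  refine (abs_sub _ _).trans ?_
  linarith

lemma continuous_height {g : Euc d → ℝ} {K : ℝ≥0} (hg : LipschitzWith K g) :
    Continuous (height e g) := by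
  have := hg.continuous
  unfold height
  fun_prop

lemma continuous_graphPt {g : Euc d → ℝ} {K : ℝ≥0} (hg : LipschitzWith K g) :
    Continuous fun z : ℝ × (ℝ ∙ e)ᗮ => graphPt e g z.1 z.2 := by
  have := hg.continuous
  unfold graphPt
  fun_prop

lemma dist_graphPt (he : ‖e‖ = 1) (g : Euc d → ℝ) (s t : ℝ) (y : (ℝ ∙ e)ᗮ) :
    dist (graphPt e g s y) (graphPt e g t y) = |s - t| := by
  rw [dist_eq_norm, graphPt, graphPt, add_sub_add_left_eq_sub, ← sub_smul, norm_smul, he, mul_one,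
    Real.norm_eq_abs, abs_sub_comm]
  congr 1
  ring

lemma lipschitz_graphPt (he : ‖e‖ = 1) {g : Euc d → ℝ} {K : ℝ≥0} (hg : LipschitzWith K g) (t : ℝ) :
    LipschitzWith (1 + K) (graphPt e g t) := by
  refine LipschitzWith.of_dist_le_mul fun y z => ?_
  have h1 := hg.dist_le_mul y z
  rw [Real.dist_eq] at h1
  rw [dist_eq_norm]
  have h2 : graphPt e g t y - graphPt e g t z = ((y : Euc d) - z) + (g y - g z) • e := by
    simp only [graphPt]
    module
  rw [h2]
  refine (norm_add_le _ _).trans ?_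
  rw [norm_smul, he, mul_one, Real.norm_eq_abs, ← dist_eq_norm]
  have h3 : dist (y : Euc d) z = dist y z := rfl
  rw [h3] at h1 ⊢
  push_cast
  linarith

/-- Near `p` (in the ball of radius `r`), `Ω` is the strict subgraph of `g` in the direction
`e`. -/
structure IsGraphNear (Ω : Set (Euc d)) (p : Euc d) (r : ℝ) (e : Euc d) (K : ℝ≥0)
    (g : Euc d → ℝ) : Prop where
  pos : 0 < r
  norm_eq : ‖e‖ = 1
  lipschitz : LipschitzWith K g
  mem_iff : ∀ x ∈ Metric.ball p r, x ∈ Ω ↔ height e g x < 0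

lemma IsBoundedLipschitzDomain.exists_isGraphNear {Ω : Set (Euc d)}
    (hΩ : IsBoundedLipschitzDomain Ω) {p : Euc d} (hp : p ∈ frontier Ω) :
    ∃ r e K g, IsGraphNear Ω p r e K g := by
  obtain ⟨N, hN, hpN, e, he, K, g, hg, hΩN⟩ := hΩ.lipschitz_boundary p hp
  obtain ⟨r, hr, hrN⟩ := Metric.isOpen_iff.1 hN p hpN
  refine ⟨r, e, K, g, hr, he, hg, fun x hx => ?_⟩
  have h1 : x ∈ Ω ∩ N ↔ x ∈ N ∧ ⟪e, x⟫ < g (x - ⟪e, x⟫ • e) := by rw [hΩN]; rfl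
  have h2 := hrN hx
  rw [height, sub_neg]
  constructor
  · exact fun h => (h1.1 ⟨h, h2⟩).2
  · exact fun h => (h1.2 ⟨h2, h⟩).1

variable {Ω : Set (Euc d)} {p : Euc d} {r : ℝ} {K : ℝ≥0} {g : Euc d → ℝ}

/-- Positive height is an open condition that excludes Ω, so it does not occur in the closure. A
point of height 0 is the limit of the points just below it. -/
lemma IsGraphNear.mem_frontier_iff (h : IsGraphNear Ω p r e K g) (hΩ : IsOpen Ω) {x : Euc d}
    (hx : x ∈ Metric.ball p r) : x ∈ frontier Ω ↔ height e g x = 0 := by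
  have hc := continuous_height (e := e) h.lipschitz
  rw [hΩ.frontier_eq]
  constructor
  · rintro ⟨h1, h2⟩
    refine le_antisymm ?_ (not_lt.1 fun h3 => h2 ((h.mem_iff x hx).2 h3))
    by_contra! h3
    obtain ⟨z, ⟨hz1, hz2⟩, hz3⟩ := mem_closure_iff.1 h1 (Metric.ball p r ∩ height e g ⁻¹' Set.Ioi 0)
      (Metric.isOpen_ball.inter (isOpen_Ioi.preimage hc)) ⟨hx, h3⟩
    have := (h.mem_iff z hz1).1 hz3
    exact absurd hz2 (not_lt.2 this.le)
  · intro h1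
    refine ⟨?_, fun h2 => absurd ((h.mem_iff x hx).1 h2) (by rw [h1]; exact lt_irrefl _)⟩
    let y : (ℝ ∙ e)ᗮ := ⟨x - ⟪e, x⟫ • e, sub_inner_smul_mem h.norm_eq x⟩
    have hxy : graphPt e g 0 y = x := by
      have h2 := graphPt_height h.norm_eq g x
      rwa [h1, neg_zero] at h2
    rw [Metric.mem_closure_iff]
    intro ε hε
    have h3 : dist x p < r := hx
    obtain ⟨t, ht, ht1, ht2⟩ : ∃ t > 0, t < ε ∧ t < r - dist x p :=
      ⟨min ε (r - dist x p) / 2, by have : 0 < r - dist x p := by linarith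
                                    positivity,
        by have := min_le_left ε (r - dist x p); linarith,
        by have := min_le_right ε (r - dist x p); linarith⟩
    have h4 : dist x (graphPt e g t y) = t := by
      rw [← hxy, dist_graphPt h.norm_eq, zero_sub, abs_neg, abs_of_pos ht]
    refine ⟨graphPt e g t y, (h.mem_iff _ ?_).2 ?_, by rw [h4]; exact ht1⟩
    · rw [Metric.mem_ball]
      have := dist_triangle_left (graphPt e g t y) p x
      linarith
    · rw [height_graphPt h.norm_eq]
      linarith

lemma finrank_orthogonal (he : ‖e‖ = 1) : Module.finrank ℝ (ℝ ∙ e)ᗮ = d - 1 := by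
  have h1 := (ℝ ∙ e).finrank_add_finrank_orthogonal
  rw [finrank_span_singleton (norm_ne_zero_iff.1 (by rw [he]; exact one_ne_zero)),
    finrank_euclideanSpace_fin] at h1
  omega

lemma euclideanHausdorffMeasure_orthogonal (he : ‖e‖ = 1) :
    (Measure.euclideanHausdorffMeasure (d - 1) : Measure (ℝ ∙ e)ᗮ) = volume := by
  rw [← finrank_orthogonal he]
  exact InnerProductSpace.euclideanHausdorffMeasure_eq_volume

lemma _root_.LipschitzWith.euclideanHausdorffMeasure_image_le {X Y : Type*} [MetricSpace X]
    [MeasurableSpace X] [BorelSpace X] [MetricSpace Y] [MeasurableSpace Y] [BorelSpace Y]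
    {C : ℝ≥0} {f : X → Y} (hf : LipschitzWith C f) (n : ℕ) (s : Set X) :
    Measure.euclideanHausdorffMeasure n (f '' s)
      ≤ (C : ℝ≥0∞) ^ n * Measure.euclideanHausdorffMeasure n s := by
  simp_rw [Measure.euclideanHausdorffMeasure_def, Measure.smul_apply, ENNReal.smul_def]
  have h1 := hf.hausdorffMeasure_image_le (Nat.cast_nonneg n) s
  rw [ENNReal.rpow_natCast] at h1
  calc _ ≤ _ := mul_le_mul_right h1 _
    _ = _ := by simp only [smul_eq_mul]; ring

/-- The part of the parameter domain over which the graph is in the ball `B(p, ρ)`. -/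
def graphDom (e : Euc d) (g : Euc d → ℝ) (p : Euc d) (ρ : ℝ) : Set (ℝ ∙ e)ᗮ :=
  graphPt e g 0 ⁻¹' Metric.ball p ρ

lemma measurableSet_graphDom (he : ‖e‖ = 1) (hg : LipschitzWith K g) (ρ : ℝ) :
    MeasurableSet (graphDom e g p ρ) :=
  (Metric.isOpen_ball.preimage (lipschitz_graphPt he hg 0).continuous).measurableSet

/-- The graph map is (1 + K)-Lipschitz, so it enlarges (d - 1)-dimensional Hausdorff measure by at
most (1 + K)^(d - 1). -/
lemma IsGraphNear.surfaceMeasure_le (h : IsGraphNear Ω p r e K g) (hΩ : IsOpen Ω) {ρ : ℝ}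
    (hρ : ρ ≤ r) : (surfaceMeasure Ω).restrict (Metric.ball p ρ)
      ≤ ((1 + K : ℝ≥0) : ℝ≥0∞) ^ (d - 1) •
        (volume.restrict (graphDom e g p ρ)).map (graphPt e g 0) := by
  have hm := (lipschitz_graphPt h.norm_eq h.lipschitz 0).continuous.measurable
  refine Measure.le_iff.2 fun S hS => ?_
  rw [Measure.smul_apply, Measure.map_apply hm hS, Measure.restrict_apply (hm hS),
    Measure.restrict_apply hS, surfaceMeasure,
    Measure.restrict_apply (hS.inter Metric.isOpen_ball.measurableSet)]
  have hsub : S ∩ Metric.ball p ρ ∩ frontier Ω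
      ⊆ graphPt e g 0 '' (graphPt e g 0 ⁻¹' S ∩ graphDom e g p ρ) := by
    rintro x ⟨⟨hxS, hxb⟩, hxf⟩
    have h1 := (h.mem_frontier_iff hΩ (Metric.ball_subset_ball hρ hxb)).1 hxf
    have h2 := graphPt_height h.norm_eq g x
    rw [h1, neg_zero] at h2
    refine ⟨_, ⟨?_, ?_⟩, h2⟩
    · rw [Set.mem_preimage, h2]
      exact hxS
    · rw [graphDom, Set.mem_preimage, h2]
      exact hxb
  refine (measure_mono hsub).trans ?_
  refine ((lipschitz_graphPt h.norm_eq h.lipschitz 0).euclideanHausdorffMeasure_image_le _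
    _).trans ?_
  rw [euclideanHausdorffMeasure_orthogonal h.norm_eq, smul_eq_mul]

/-- The orthogonal projection along e is 1-Lipschitz and inverts the graph map. -/
lemma IsGraphNear.le_surfaceMeasure (h : IsGraphNear Ω p r e K g) (hΩ : IsOpen Ω) {ρ : ℝ}
    (hρ : ρ ≤ r) : (volume.restrict (graphDom e g p ρ)).map (graphPt e g 0)
      ≤ (surfaceMeasure Ω).restrict (Metric.ball p ρ) := by
  have hm := (lipschitz_graphPt h.norm_eq h.lipschitz 0).continuous.measurable
  refine Measure.le_iff.2 fun S hS => ?_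
  rw [Measure.map_apply hm hS, Measure.restrict_apply (hm hS),
    Measure.restrict_apply hS, surfaceMeasure,
    Measure.restrict_apply (hS.inter Metric.isOpen_ball.measurableSet)]
  let P : Euc d → (ℝ ∙ e)ᗮ := fun x => ⟨x - ⟪e, x⟫ • e, sub_inner_smul_mem h.norm_eq x⟩
  have hP : LipschitzWith 1 P := by
    refine LipschitzWith.of_dist_le_mul fun x z => ?_
    rw [NNReal.coe_one, one_mul, dist_eq_norm x z]
    have h1 := norm_sub_inner_smul_le h.norm_eq (x - z)
    rw [inner_sub_right] at h1
    refine le_trans (le_of_eq ?_) h1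
    rw [dist_eq_norm, ← Submodule.norm_coe, Submodule.coe_sub]
    congr 1
    simp only [P]
    module
  have hsub : graphPt e g 0 ⁻¹' S ∩ graphDom e g p ρ
      ⊆ P '' (S ∩ Metric.ball p ρ ∩ frontier Ω) := by
    rintro y ⟨hyS, hyb⟩
    refine ⟨graphPt e g 0 y, ⟨⟨hyS, hyb⟩, ?_⟩, ?_⟩
    · rw [h.mem_frontier_iff hΩ (Metric.ball_subset_ball hρ hyb), height_graphPt h.norm_eq, neg_zero]
    · refine Subtype.ext ?_
      simp only [P, graphPt, inner_add_smul_self h.norm_eq, add_sub_cancel_right]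
  refine (measure_mono hsub).trans ?_
  rw [← euclideanHausdorffMeasure_orthogonal h.norm_eq]
  refine (hP.euclideanHausdorffMeasure_image_le _ _).trans ?_
  simp

end Coordinates

end DtN

end

noncomputable section

namespace DtN

/-! ### Estimates near the boundary -/

section Boundary

open scoped ENNReal NNReal

variable {d : ℕ} {e : Euc d}

/-- Integrate the derivative of -(1 - t/τ)ψ² and split the mixed term by the arithmetic-geometric
mean inequality. The weight τ on the derivative can be made small, which later makes the trace
compact. -/
lemma sq_le_integral {ψ : ℝ → ℝ} (hψ : ContDiff ℝ 1 ψ) {τ : ℝ} (hτ : 0 < τ) :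
    ψ 0 ^ 2 ≤ ∫ t in (0 : ℝ)..τ, (2 / τ * ψ t ^ 2 + τ * deriv ψ t ^ 2) := by
  have hc := hψ.continuous
  have hc' := hψ.continuous_deriv (by simp)
  have hd : ∀ t, HasDerivAt ψ (deriv ψ t) t := fun t =>
    (hψ.differentiable (by simp) t).hasDerivAt
  have h1 : ∀ t, HasDerivAt (fun t => -((1 - t / τ) * ψ t ^ 2))
      (1 / τ * ψ t ^ 2 - (1 - t / τ) * (2 * ψ t * deriv ψ t)) t := fun t => by
    have h2 := ((((hasDerivAt_id t).div_const τ).const_sub 1).mul ((hd t).pow 2)).neg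
    refine h2.congr_deriv ?_
    simp
    ring
  have h3 := intervalIntegral.integral_eq_sub_of_hasDerivAt (a := 0) (b := τ) (fun t _ => h1 t)
    (Continuous.intervalIntegrable (by fun_prop) _ _)
  have h4 : ψ 0 ^ 2 = ∫ t in (0 : ℝ)..τ,
      (1 / τ * ψ t ^ 2 - (1 - t / τ) * (2 * ψ t * deriv ψ t)) := by
    rw [h3, div_self hτ.ne']
    simp
  rw [h4]
  refine intervalIntegral.integral_mono_on hτ.le
    (Continuous.intervalIntegrable (by fun_prop) _ _)
    (Continuous.intervalIntegrable (by fun_prop) _ _) fun t ht => ?_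
  have h5 : 0 ≤ 1 - t / τ := by
    rw [sub_nonneg, div_le_one hτ]
    exact ht.2
  have h6 : 1 - t / τ ≤ 1 := by
    have : 0 ≤ t / τ := div_nonneg ht.1 hτ.le
    linarith
  have h7 : 0 ≤ (ψ t + (1 - t / τ) * τ * deriv ψ t) ^ 2 / τ := by positivity
  have h8 : (ψ t + (1 - t / τ) * τ * deriv ψ t) ^ 2 / τ
      = 1 / τ * ψ t ^ 2 + (1 - t / τ) * (2 * ψ t * deriv ψ t)
        + (1 - t / τ) ^ 2 * (τ * deriv ψ t ^ 2) := by
    field_simp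
    ring
  have h9 : (1 - t / τ) ^ 2 * (τ * deriv ψ t ^ 2) ≤ 1 * (τ * deriv ψ t ^ 2) := by
    gcongr
    exact pow_le_one₀ h5 h6
  have h10 : 2 / τ * ψ t ^ 2 = 1 / τ * ψ t ^ 2 + 1 / τ * ψ t ^ 2 := by ring
  linarith

/-- The density `(2/τ) φ² + τ |∇φ|²`. -/
def energyDensity (φ : Euc d → ℝ) (τ : ℝ) (x : Euc d) : ℝ≥0∞ :=
  ENNReal.ofReal (2 / τ * φ x ^ 2 + τ * ‖fderiv ℝ φ x‖ ^ 2)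

lemma continuous_energyDensity {φ : Euc d → ℝ} (hφ : ContDiff ℝ ∞ φ) (τ : ℝ) :
    Continuous (energyDensity φ τ) := by
  have h1 := hφ.continuous
  have h2 := hφ.continuous_fderiv (by simp)
  exact ENNReal.continuous_ofReal.comp (by fun_prop)

variable {Ω : Set (Euc d)} {p : Euc d} {r : ℝ} {K : ℝ≥0} {g : Euc d → ℝ}

lemma IsGraphNear.graphPt_mem (h : IsGraphNear Ω p r e K g) {y : (ℝ ∙ e)ᗮ}
    (hy : y ∈ graphDom e g p (r / 2)) {t : ℝ} (ht : 0 < t) (htr : t ≤ r / 2) :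
    graphPt e g t y ∈ Ω := by
  have h1 : dist (graphPt e g t y) (graphPt e g 0 y) = t := by
    rw [dist_graphPt h.norm_eq, sub_zero, abs_of_pos ht]
  refine (h.mem_iff _ ?_).2 ?_
  · rw [Metric.mem_ball]
    have h2 : dist (graphPt e g 0 y) p < r / 2 := hy
    have h3 := dist_triangle (graphPt e g t y) (graphPt e g 0 y) p
    linarith
  · rw [height_graphPt h.norm_eq]
    linarith

lemma contDiff_comp_graphPt {φ : Euc d → ℝ} (hφ : ContDiff ℝ ∞ φ) (g : Euc d → ℝ) (s : ℝ)
    (y : (ℝ ∙ e)ᗮ) : ContDiff ℝ 1 fun t => φ (graphPt e g (s + t) y) := by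
  have hline : ContDiff ℝ ∞ fun t : ℝ => graphPt e g (s + t) y := by
    unfold graphPt
    fun_prop
  exact (hφ.comp hline).of_le (by simp)

lemma deriv_comp_graphPt_le {φ : Euc d → ℝ} (hφ : ContDiff ℝ ∞ φ) (he : ‖e‖ = 1)
    (g : Euc d → ℝ) (s : ℝ) (y : (ℝ ∙ e)ᗮ) (t : ℝ) :
    deriv (fun t => φ (graphPt e g (s + t) y)) t ^ 2
      ≤ ‖fderiv ℝ φ (graphPt e g (s + t) y)‖ ^ 2 := by
  have h1 : HasDerivAt (fun t : ℝ => graphPt e g (s + t) y) (-e) t := by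
    have h2 : HasDerivAt (fun t : ℝ => g y - (s + t)) (-1) t :=
      ((hasDerivAt_id t).const_add s).const_sub (g y)
    have h3 := (h2.smul_const e).const_add (y : Euc d)
    rw [neg_one_smul] at h3
    exact h3
  have h2 := ((hφ.differentiable (by simp) _).hasFDerivAt).comp_hasDerivAt t h1
  have h3 : deriv (fun t => φ (graphPt e g (s + t) y)) t
      = fderiv ℝ φ (graphPt e g (s + t) y) (-e) := h2.deriv
  rw [h3, ← sq_abs, ← Real.norm_eq_abs]
  refine pow_le_pow_left₀ (norm_nonneg _) ?_ 2
  refine ((fderiv ℝ φ (graphPt e g (s + t) y)).le_opNorm _).trans ?_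
  rw [norm_neg, he, mul_one]

/-- The one-dimensional estimate is applied on the segments from depth s to depth s + τ, which stay
in Ω, and integrated over the base. Depth 0 gives the trace inequality, positive depths the strip
estimate. -/
lemma IsGraphNear.lintegral_slice_le (h : IsGraphNear Ω p r e K g) {φ : Euc d → ℝ}
    (hφ : ContDiff ℝ ∞ φ) (hΩ : IsOpen Ω) {s τ : ℝ} (hs : 0 ≤ s) (hτ : 0 < τ)
    (hsτ : s + τ ≤ r / 2) :
    ∫⁻ y in graphDom e g p (r / 2), ENNReal.ofReal (φ (graphPt e g s y) ^ 2)
      ≤ ∫⁻ x in Ω, energyDensity φ τ x := by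
  have hcE := continuous_energyDensity hφ τ
  have hE : Measurable (Ω.indicator (energyDensity φ τ)) :=
    hcE.measurable.indicator hΩ.measurableSet
  rw [← lintegral_indicator hΩ.measurableSet, lintegral_graph h.norm_eq g hE]
  refine (setLIntegral_mono' (measurableSet_graphDom h.norm_eq h.lipschitz _)
    fun y hy => ?_).trans (setLIntegral_le_lintegral _ _)
  have hmem : ∀ t ∈ Set.Ioc (0 : ℝ) τ, graphPt e g (s + t) y ∈ Ω := fun t ht =>
    h.graphPt_mem hy (by linarith [ht.1]) (by linarith [ht.2])
  let ψ : ℝ → ℝ := fun t => φ (graphPt e g (s + t) y)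
  have hψ : ContDiff ℝ 1 ψ := contDiff_comp_graphPt hφ g s y
  have hc := hψ.continuous
  have hc' := hψ.continuous_deriv (by simp)
  have h1 := sq_le_integral hψ hτ
  have h2 : ENNReal.ofReal (φ (graphPt e g s y) ^ 2)
      ≤ ∫⁻ t in Set.Ioc 0 τ, energyDensity φ τ (graphPt e g (s + t) y) := by
    have h3 : φ (graphPt e g s y) = ψ 0 := by simp [ψ]
    rw [h3]
    refine (ENNReal.ofReal_le_ofReal h1).trans ?_
    rw [intervalIntegral.integral_of_le hτ.le,
      ofReal_integral_eq_lintegral_ofReal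
        (Continuous.integrableOn_Ioc (by fun_prop)) (ae_of_all _ fun t => by positivity)]
    refine lintegral_mono fun t => ?_
    refine ENNReal.ofReal_le_ofReal ?_
    have h4 := deriv_comp_graphPt_le hφ h.norm_eq g s y t
    simp only [ψ]
    gcongr
  refine h2.trans ?_
  rw [← lintegral_add_left_eq_self
    (fun t => Ω.indicator (energyDensity φ τ) (graphPt e g t y)) s]
  refine le_trans ?_ (setLIntegral_le_lintegral (Set.Ioc 0 τ) _)
  refine setLIntegral_mono' measurableSet_Ioc fun t ht => ?_
  rw [Set.indicator_of_mem (hmem t ht)]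

lemma IsGraphNear.lintegral_surface_le (h : IsGraphNear Ω p r e K g) {φ : Euc d → ℝ}
    (hφ : ContDiff ℝ ∞ φ) (hΩ : IsOpen Ω) {τ : ℝ} (hτ : 0 < τ) (hτr : τ ≤ r / 2) :
    ∫⁻ x in Metric.ball p (r / 2), ENNReal.ofReal (φ x ^ 2) ∂(surfaceMeasure Ω)
      ≤ ((1 + K : ℝ≥0) : ℝ≥0∞) ^ (d - 1) * ∫⁻ x in Ω, energyDensity φ τ x := by
  have hpos := h.pos
  have hm := (lipschitz_graphPt h.norm_eq h.lipschitz 0).continuous.measurable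
  have hcφ := hφ.continuous
  refine (lintegral_mono' (h.surfaceMeasure_le hΩ (by linarith)) le_rfl).trans ?_
  rw [lintegral_smul_measure, lintegral_map (by fun_prop) hm, smul_eq_mul]
  gcongr
  exact h.lintegral_slice_le hφ hΩ le_rfl hτ (by linarith)

/-- The height is (1 + K)-Lipschitz and vanishes on the boundary, so points within η of it have
depth at most (1 + K)η. The condition on η keeps their base points in the chart: r/4 + η + (1 + K)η
≤ r/2. -/
lemma IsGraphNear.lintegral_strip_le_slices (h : IsGraphNear Ω p r e K g) {φ : Euc d → ℝ}
    (hcφ : Continuous φ) (hΩ : IsOpen Ω) {η : ℝ} (hη : 0 < η) (hηr : (2 + K) * η ≤ r / 4) :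
    ∫⁻ x in {x ∈ Ω | ∃ q ∈ frontier Ω ∩ Metric.ball p (r / 4), dist x q ≤ η},
        ENNReal.ofReal (φ x ^ 2)
      ≤ ∫⁻ t in Set.Ioc 0 ((1 + K) * η), ∫⁻ y in graphDom e g p (r / 2),
          ENNReal.ofReal (φ (graphPt e g t y) ^ 2) := by
  have hpos := h.pos
  have hcG := continuous_graphPt (e := e) h.lipschitz
  have hA := measurableSet_graphDom (p := p) h.norm_eq h.lipschitz (r / 2)
  let f : Euc d → ℝ≥0∞ := fun x => ENNReal.ofReal (φ x ^ 2)
  have hf : Measurable f := by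
    simp only [f]
    fun_prop
  let P : Euc d → (ℝ ∙ e)ᗮ := fun x => ⟨x - ⟪e, x⟫ • e, sub_inner_smul_mem h.norm_eq x⟩
  let T : Set (Euc d) := {x | -height e g x ∈ Set.Ioc 0 ((1 + K) * η) ∧
    P x ∈ graphDom e g p (r / 2)}
  have hPm : Continuous P := by
    refine Continuous.subtype_mk ?_ _
    fun_prop
  have hT : MeasurableSet T := by
    have h1 : Measurable fun x => -height e g x :=
      (continuous_height (e := e) h.lipschitz).measurable.neg
    exact (h1 measurableSet_Ioc).inter (hPm.measurable hA)
  have hsub : {x ∈ Ω | ∃ q ∈ frontier Ω ∩ Metric.ball p (r / 4), dist x q ≤ η} ⊆ T := by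
    rintro x ⟨hx, q, ⟨hq, hqb⟩, hxq⟩
    rw [Metric.mem_ball] at hqb
    have hK : 0 ≤ (K : ℝ) := K.coe_nonneg
    have hη2 : η ≤ r / 4 := by nlinarith
    have hq0 := (h.mem_frontier_iff hΩ (x := q) (by rw [Metric.mem_ball]; linarith)).1 hq
    have hxb : dist x p < r := by
      have := dist_triangle x q p
      linarith
    have hx0 := (h.mem_iff x hxb).1 hx
    have h1 := abs_height_sub_le h.norm_eq h.lipschitz x q
    rw [hq0, sub_zero, ← dist_eq_norm, abs_of_neg hx0] at h1
    have h2 : -height e g x ≤ (1 + K) * η := h1.trans (by gcongr)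
    refine ⟨⟨by linarith, h2⟩, ?_⟩
    have h3 : dist (graphPt e g 0 (P x)) x ≤ (1 + K) * η := by
      have h4 := graphPt_height h.norm_eq g x
      have h5 := dist_graphPt h.norm_eq g 0 (-height e g x) (P x)
      rw [h4, zero_sub, neg_neg, abs_of_neg hx0] at h5
      linarith
    show dist (graphPt e g 0 (P x)) p < r / 2
    have h6 := dist_triangle (graphPt e g 0 (P x)) x p
    have h7 := dist_triangle x q p
    linarith
  have hPG : ∀ t y, P (graphPt e g t y) = y := fun t y => by
    refine Subtype.ext ?_
    simp only [P, graphPt, inner_add_smul_self h.norm_eq, add_sub_cancel_right]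
  calc _ ≤ ∫⁻ x in T, f x := lintegral_mono_set hsub
    _ = ∫⁻ y : (ℝ ∙ e)ᗮ, ∫⁻ t : ℝ, T.indicator f (graphPt e g t y) := by
        rw [← lintegral_indicator hT, lintegral_graph h.norm_eq g (hf.indicator hT)]
    _ = ∫⁻ y in graphDom e g p (r / 2), ∫⁻ t in Set.Ioc 0 ((1 + K) * η), f (graphPt e g t y) := by
        rw [← lintegral_indicator hA]
        refine lintegral_congr fun y => ?_
        by_cases hy : y ∈ graphDom e g p (r / 2)
        · rw [Set.indicator_of_mem hy, ← lintegral_indicator measurableSet_Ioc]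
          refine lintegral_congr fun t => ?_
          simp only [Set.indicator, T, Set.mem_ofPred_eq, hPG, height_graphPt h.norm_eq, neg_neg,
            hy, and_true]
        · rw [Set.indicator_of_notMem hy]
          refine (lintegral_congr fun t => ?_).trans lintegral_zero
          simp only [Set.indicator, T, Set.mem_ofPred_eq, hPG, hy, and_false, if_false]
    _ = ∫⁻ t in Set.Ioc 0 ((1 + K) * η), ∫⁻ y in graphDom e g p (r / 2), f (graphPt e g t y) := by
        refine lintegral_lintegral_swap ?_
        refine Measurable.aemeasurable ?_
        exact hf.comp (hcG.measurable.comp measurable_swap)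

lemma IsGraphNear.lintegral_strip_le (h : IsGraphNear Ω p r e K g) {φ : Euc d → ℝ}
    (hφ : ContDiff ℝ ∞ φ) (hΩ : IsOpen Ω) {η : ℝ} (hη : 0 < η) (hηr : (2 + K) * η ≤ r / 4) :
    ∫⁻ x in {x ∈ Ω | ∃ q ∈ frontier Ω ∩ Metric.ball p (r / 4), dist x q ≤ η},
        ENNReal.ofReal (φ x ^ 2)
      ≤ ENNReal.ofReal ((1 + K) * η) * ∫⁻ x in Ω, energyDensity φ (r / 4) x := by
  have hpos := h.pos
  refine (h.lintegral_strip_le_slices hφ.continuous hΩ hη hηr).trans ?_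
  calc _ ≤ ∫⁻ _ in Set.Ioc 0 ((1 + K) * η), ∫⁻ x in Ω, energyDensity φ (r / 4) x := by
        refine setLIntegral_mono' measurableSet_Ioc fun t ht => ?_
        refine h.lintegral_slice_le hφ hΩ ht.1.le (by linarith) ?_
        have := ht.2
        have : (1 + K) * η ≤ (2 + K) * η := by gcongr; norm_num
        linarith
    _ = _ := by
        rw [setLIntegral_const, Real.volume_Ioc, sub_zero, mul_comm]

lemma IsBoundedLipschitzDomain.exists_cover (hΩ : IsBoundedLipschitzDomain Ω) :
    ∃ (s : Finset (Euc d)) (r : Euc d → ℝ) (e : Euc d → Euc d) (K : Euc d → ℝ≥0)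
      (g : Euc d → Euc d → ℝ), (∀ p ∈ s, IsGraphNear Ω p (r p) (e p) (K p) (g p)) ∧
      frontier Ω ⊆ ⋃ p ∈ s, Metric.ball p (r p / 4) := by
  have h0 : ∀ p : Euc d, ∃ (r : ℝ) (e : Euc d) (K : ℝ≥0) (g : Euc d → ℝ),
      p ∈ frontier Ω → IsGraphNear Ω p r e K g := fun p => by
    by_cases hp : p ∈ frontier Ω
    · obtain ⟨r, e, K, g, h⟩ := hΩ.exists_isGraphNear hp
      exact ⟨r, e, K, g, fun _ => h⟩
    · exact ⟨0, 0, 0, 0, fun h => absurd h hp⟩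
  choose r e K g h using h0
  have hc : IsCompact (frontier Ω) := Metric.isCompact_of_isClosed_isBounded isClosed_frontier
    (hΩ.isBounded.closure.subset frontier_subset_closure)
  obtain ⟨s, hs, hcov⟩ := hc.elim_nhds_subcover (fun p => Metric.ball p (r p / 4)) fun p hp =>
    Metric.ball_mem_nhds p (by linarith [(h p hp).pos])
  exact ⟨s, r, e, K, g, fun p hp => h p (hs p hp), hcov⟩

lemma exists_pos_le {ι : Type*} (s : Finset ι) {f : ι → ℝ} (hf : ∀ i ∈ s, 0 < f i) :
    ∃ δ > 0, ∀ i ∈ s, δ ≤ f i := by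
  classical
  induction s using Finset.induction_on with
  | empty => exact ⟨1, one_pos, by simp⟩
  | insert i s hi ih =>
    obtain ⟨δ, hδ, h⟩ := ih fun j hj => hf j (Finset.mem_insert_of_mem hj)
    refine ⟨min δ (f i), lt_min hδ (hf i (s.mem_insert_self i)), fun j hj => ?_⟩
    rcases Finset.mem_insert.1 hj with rfl | hj
    · exact min_le_right _ _
    · exact (min_le_left _ _).trans (h j hj)

lemma lintegral_biUnion_finset_le {ι X : Type*} [MeasurableSpace X] (μ : Measure X) (s : Finset ι)
    (t : ι → Set X) (f : X → ℝ≥0∞) :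
    ∫⁻ x in ⋃ i ∈ s, t i, f x ∂μ ≤ ∑ i ∈ s, ∫⁻ x in t i, f x ∂μ := by
  classical
  induction s using Finset.induction_on with
  | empty => simp
  | insert i s hi ih =>
    rw [Finset.set_biUnion_insert, Finset.sum_insert hi]
    exact (lintegral_union_le f _ _).trans (by gcongr)

/-- The trace inequality for smooth functions. -/
lemma IsBoundedLipschitzDomain.lintegral_surface_le (hΩ : IsBoundedLipschitzDomain Ω) :
    ∃ C : ℝ≥0, ∃ τ₀ > 0, ∀ τ, 0 < τ → τ ≤ τ₀ → ∀ φ : Euc d → ℝ, ContDiff ℝ ∞ φ →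
      ∫⁻ x, ENNReal.ofReal (φ x ^ 2) ∂(surfaceMeasure Ω)
        ≤ C * ∫⁻ x in Ω, energyDensity φ τ x := by
  obtain ⟨s, r, e, K, g, h, hcov⟩ := hΩ.exists_cover
  obtain ⟨τ₀, hτ₀, hτ⟩ := exists_pos_le s (f := fun p => r p / 2) fun p hp => by
    linarith [(h p hp).pos]
  refine ⟨∑ p ∈ s, (1 + K p) ^ (d - 1), τ₀, hτ₀, fun τ hτ0 hττ φ hφ => ?_⟩
  have h1 : surfaceMeasure Ω = (surfaceMeasure Ω).restrict (⋃ p ∈ s, Metric.ball p (r p / 2)) := by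
    refine (Measure.restrict_eq_self_of_ae_mem ?_).symm
    have h2 : ∀ᵐ x ∂(surfaceMeasure Ω), x ∈ frontier Ω :=
      ae_restrict_mem isClosed_frontier.measurableSet
    filter_upwards [h2] with x hx
    refine Set.iUnion₂_mono (fun p hp => ?_) (hcov hx)
    exact Metric.ball_subset_ball (by linarith [(h p hp).pos])
  rw [h1]
  refine (lintegral_biUnion_finset_le _ _ _ _).trans ?_
  push_cast
  rw [Finset.sum_mul]
  refine Finset.sum_le_sum fun p hp => ?_
  have h3 := (h p hp).lintegral_surface_le hφ hΩ.isOpen hτ0 (hττ.trans (hτ p hp))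
  push_cast at h3
  exact h3

/-- Smooth functions are small in the `L²` sense near the boundary. -/
lemma IsBoundedLipschitzDomain.lintegral_strip_le (hΩ : IsBoundedLipschitzDomain Ω) :
    ∃ C : ℝ, 0 ≤ C ∧ ∃ η₀ > 0, ∀ η, 0 < η → η ≤ η₀ → ∀ φ : Euc d → ℝ, ContDiff ℝ ∞ φ →
      ∫⁻ x in {x ∈ Ω | ∃ q ∈ frontier Ω, dist x q ≤ η}, ENNReal.ofReal (φ x ^ 2)
        ≤ ENNReal.ofReal (C * η) * ∫⁻ x in Ω, energyDensity φ 1 x := by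
  obtain ⟨s, r, e, K, g, h, hcov⟩ := hΩ.exists_cover
  obtain ⟨η₀, hη₀, hη⟩ := exists_pos_le s (f := fun p => r p / 4 / (2 + K p)) fun p hp => by
    have := (h p hp).pos
    positivity
  have hr : ∀ p ∈ s, 0 ≤ 4 / r p + r p / 4 := fun p hp => by
    have := (h p hp).pos
    positivity
  -- The factor 4/r + r/4 bounds the density with τ = r/4 by the one with τ = 1.
  refine ⟨∑ p ∈ s, (1 + K p) * (4 / r p + r p / 4),
    Finset.sum_nonneg fun p hp => mul_nonneg (by positivity) (hr p hp), η₀, hη₀,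
    fun η hη0 hηη φ hφ => ?_⟩
  have hsub : {x ∈ Ω | ∃ q ∈ frontier Ω, dist x q ≤ η}
      ⊆ ⋃ p ∈ s, {x ∈ Ω | ∃ q ∈ frontier Ω ∩ Metric.ball p (r p / 4), dist x q ≤ η} := by
    rintro x ⟨hx, q, hq, hxq⟩
    obtain ⟨p, hp, hqp⟩ := Set.mem_iUnion₂.1 (hcov hq)
    exact Set.mem_iUnion₂.2 ⟨p, hp, hx, q, ⟨hq, hqp⟩, hxq⟩
  refine (lintegral_mono_set hsub).trans ((lintegral_biUnion_finset_le _ _ _ _).trans ?_)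
  rw [Finset.sum_mul, ENNReal.ofReal_sum_of_nonneg fun p hp =>
    mul_nonneg (mul_nonneg (by positivity) (hr p hp)) hη0.le, Finset.sum_mul]
  refine Finset.sum_le_sum fun p hp => ?_
  have hpos := (h p hp).pos
  have h1 := (h p hp).lintegral_strip_le hφ hΩ.isOpen hη0 (by
    have h2 := hηη.trans (hη p hp)
    rw [le_div_iff₀ (by positivity)] at h2
    linarith)
  refine h1.trans ?_
  have h2 : ∫⁻ x in Ω, energyDensity φ (r p / 4) x
      ≤ ENNReal.ofReal (4 / r p + r p / 4) * ∫⁻ x in Ω, energyDensity φ 1 x := by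
    rw [← lintegral_const_mul' _ _ ENNReal.ofReal_ne_top]
    refine lintegral_mono fun x => ?_
    rw [energyDensity, energyDensity, ← ENNReal.ofReal_mul (hr p hp)]
    refine ENNReal.ofReal_le_ofReal ?_
    have e1 : 2 / (r p / 4) = 4 / r p * 2 := by
      field_simp
    have h3 : 0 ≤ r p / 4 * (2 * φ x ^ 2) := by positivity
    have h4 : 0 ≤ 4 / r p * ‖fderiv ℝ φ x‖ ^ 2 := by positivity
    rw [e1]
    linarith
  calc _ ≤ ENNReal.ofReal ((1 + K p) * η) *
        (ENNReal.ofReal (4 / r p + r p / 4) * ∫⁻ x in Ω, energyDensity φ 1 x) := by gcongr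
    _ = _ := by
      rw [← mul_assoc, ← ENNReal.ofReal_mul (by positivity)]
      congr 2
      ring

/-- Cauchy–Schwarz bounds (ψ s - ψ 0)², in the form that the variance of ψ' is nonnegative; then (a
+ b)² ≤ 2a² + 2b². Unlike `sq_le_integral`, this starts from the boundary value. -/
lemma sq_le_sq_add_integral {ψ : ℝ → ℝ} (hψ : ContDiff ℝ 1 ψ) {s : ℝ} (hs : 0 < s) :
    ψ s ^ 2 ≤ 2 * ψ 0 ^ 2 + 2 * s * ∫ t in (0 : ℝ)..s, deriv ψ t ^ 2 := by
  have hc' := hψ.continuous_deriv (by simp)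
  have h0 : ∫ t in (0 : ℝ)..s, deriv ψ t = ψ s - ψ 0 :=
    intervalIntegral.integral_deriv_eq_sub (fun t _ => hψ.differentiable (by simp) t)
      (Continuous.intervalIntegrable (by fun_prop) _ _)
  have h3 : 0 ≤ ∫ t in (0 : ℝ)..s, (deriv ψ t - (ψ s - ψ 0) / s) ^ 2 :=
    intervalIntegral.integral_nonneg hs.le fun t _ => sq_nonneg _
  have h4 : ∫ t in (0 : ℝ)..s, (deriv ψ t - (ψ s - ψ 0) / s) ^ 2
      = (∫ t in (0 : ℝ)..s, deriv ψ t ^ 2) - (ψ s - ψ 0) ^ 2 / s := by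
    have h5 : ∀ t, (deriv ψ t - (ψ s - ψ 0) / s) ^ 2 = deriv ψ t ^ 2
        - 2 * ((ψ s - ψ 0) / s) * deriv ψ t + ((ψ s - ψ 0) / s) ^ 2 := fun t => by ring
    simp only [h5]
    rw [intervalIntegral.integral_add (Continuous.intervalIntegrable (by fun_prop) _ _)
      (Continuous.intervalIntegrable (by fun_prop) _ _),
      intervalIntegral.integral_sub (Continuous.intervalIntegrable (by fun_prop) _ _)
      (Continuous.intervalIntegrable (by fun_prop) _ _), intervalIntegral.integral_const_mul, h0,
      intervalIntegral.integral_const, sub_zero, smul_eq_mul]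
    field_simp
    ring
  rw [h4, sub_nonneg, div_le_iff₀ hs] at h3
  nlinarith [sq_nonneg (ψ s - 2 * ψ 0)]

lemma IsGraphNear.lintegral_slice_le_add (h : IsGraphNear Ω p r e K g) {φ : Euc d → ℝ}
    (hφ : ContDiff ℝ ∞ φ) (hΩ : IsOpen Ω) {s : ℝ} (hs : 0 < s) (hsr : s ≤ r / 2) :
    ∫⁻ y in graphDom e g p (r / 2), ENNReal.ofReal (φ (graphPt e g s y) ^ 2)
      ≤ 2 * (∫⁻ x, ENNReal.ofReal (φ x ^ 2) ∂(surfaceMeasure Ω))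
        + ENNReal.ofReal (2 * s) * ∫⁻ x in Ω, ENNReal.ofReal (‖fderiv ℝ φ x‖ ^ 2) := by
  have hpos := h.pos
  have hcφ := hφ.continuous
  have hcf := hφ.continuous_fderiv (by simp)
  have hm := (lipschitz_graphPt h.norm_eq h.lipschitz 0).continuous.measurable
  let k : Euc d → ℝ≥0∞ := fun x => ENNReal.ofReal (‖fderiv ℝ φ x‖ ^ 2)
  have hk : Measurable (Ω.indicator k) := by
    refine Measurable.indicator ?_ hΩ.measurableSet
    simp only [k]
    fun_prop
  have hA := measurableSet_graphDom (p := p) h.norm_eq h.lipschitz (r / 2)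
  have h1 : ∀ y ∈ graphDom e g p (r / 2), ENNReal.ofReal (φ (graphPt e g s y) ^ 2)
      ≤ 2 * ENNReal.ofReal (φ (graphPt e g 0 y) ^ 2)
        + ENNReal.ofReal (2 * s) * ∫⁻ t : ℝ, Ω.indicator k (graphPt e g t y) := fun y hy => by
    let ψ : ℝ → ℝ := fun t => φ (graphPt e g (0 + t) y)
    have hψ : ContDiff ℝ 1 ψ := contDiff_comp_graphPt hφ g 0 y
    have hc' := hψ.continuous_deriv (by simp)
    have e1 := sq_le_sq_add_integral hψ hs
    have e2 : ENNReal.ofReal (∫ t in (0 : ℝ)..s, deriv ψ t ^ 2)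
        ≤ ∫⁻ t : ℝ, Ω.indicator k (graphPt e g t y) := by
      rw [intervalIntegral.integral_of_le hs.le, ofReal_integral_eq_lintegral_ofReal
        (Continuous.integrableOn_Ioc (by fun_prop)) (ae_of_all _ fun t => by positivity)]
      refine le_trans ?_ (setLIntegral_le_lintegral (Set.Ioc 0 s) _)
      refine setLIntegral_mono' measurableSet_Ioc fun t ht => ?_
      rw [Set.indicator_of_mem (h.graphPt_mem hy ht.1 (ht.2.trans hsr))]
      refine ENNReal.ofReal_le_ofReal ?_
      have := deriv_comp_graphPt_le hφ h.norm_eq g 0 y t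
      simpa only [ψ, zero_add] using this
    have e3 : 0 ≤ ∫ t in (0 : ℝ)..s, deriv ψ t ^ 2 :=
      intervalIntegral.integral_nonneg hs.le fun t _ => sq_nonneg _
    simp only [ψ, zero_add] at e1 e2 e3
    refine (ENNReal.ofReal_le_ofReal e1).trans ?_
    rw [ENNReal.ofReal_add (by positivity) (by positivity), ENNReal.ofReal_mul zero_le_two,
      ENNReal.ofReal_mul (by positivity : (0 : ℝ) ≤ 2 * s), ENNReal.ofReal_ofNat]
    gcongr
  refine (setLIntegral_mono' hA h1).trans ?_
  rw [lintegral_add_left (by fun_prop), lintegral_const_mul' _ _ (by simp),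
    lintegral_const_mul' _ _ ENNReal.ofReal_ne_top]
  gcongr
  · have h2 := lintegral_mono' (h.le_surfaceMeasure hΩ (ρ := r / 2) (by linarith))
      (le_refl fun x => ENNReal.ofReal (φ x ^ 2))
    rw [lintegral_map (by fun_prop) hm] at h2
    exact h2.trans (setLIntegral_le_lintegral _ _)
  · rw [← lintegral_indicator hΩ.measurableSet, lintegral_graph h.norm_eq g hk]
    exact setLIntegral_le_lintegral _ _

/-- Smooth functions which are small on the boundary are small near the boundary. -/
lemma IsBoundedLipschitzDomain.lintegral_strip_le_add (hΩ : IsBoundedLipschitzDomain Ω) :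
    ∃ C : ℝ, 0 ≤ C ∧ ∃ η₀ > 0, ∀ η, 0 < η → η ≤ η₀ → ∀ φ : Euc d → ℝ, ContDiff ℝ ∞ φ →
      ∫⁻ x in {x ∈ Ω | ∃ q ∈ frontier Ω, dist x q ≤ η}, ENNReal.ofReal (φ x ^ 2)
        ≤ ENNReal.ofReal (C * η) * (∫⁻ x, ENNReal.ofReal (φ x ^ 2) ∂(surfaceMeasure Ω))
          + ENNReal.ofReal (C * η ^ 2) * ∫⁻ x in Ω, ENNReal.ofReal (‖fderiv ℝ φ x‖ ^ 2) := by
  obtain ⟨s, r, e, K, g, h, hcov⟩ := hΩ.exists_cover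
  obtain ⟨η₀, hη₀, hη⟩ := exists_pos_le s (f := fun p => r p / 4 / (2 + K p)) fun p hp => by
    have := (h p hp).pos
    positivity
  -- On each slice the gradient carries the factor 2(1 + K)η, and integration over the depth
  -- contributes another (1 + K)η. This yields the power η² that the cutoff argument requires.
  refine ⟨∑ p ∈ s, 2 * (1 + (K p : ℝ)) ^ 2, by positivity, η₀, hη₀, fun η hη0 hηη φ hφ => ?_⟩
  have hsub : {x ∈ Ω | ∃ q ∈ frontier Ω, dist x q ≤ η}
      ⊆ ⋃ p ∈ s, {x ∈ Ω | ∃ q ∈ frontier Ω ∩ Metric.ball p (r p / 4), dist x q ≤ η} := by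
    rintro x ⟨hx, q, hq, hxq⟩
    obtain ⟨p, hp, hqp⟩ := Set.mem_iUnion₂.1 (hcov hq)
    exact Set.mem_iUnion₂.2 ⟨p, hp, hx, q, ⟨hq, hqp⟩, hxq⟩
  refine (lintegral_mono_set hsub).trans ((lintegral_biUnion_finset_le _ _ _ _).trans ?_)
  rw [Finset.sum_mul, Finset.sum_mul, ENNReal.ofReal_sum_of_nonneg fun p hp => by positivity,
    ENNReal.ofReal_sum_of_nonneg fun p hp => by positivity, Finset.sum_mul, Finset.sum_mul,
    ← Finset.sum_add_distrib]
  refine Finset.sum_le_sum fun p hp => ?_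
  have hK : 0 ≤ (K p : ℝ) := (K p).coe_nonneg
  have h2 := hηη.trans (hη p hp)
  rw [le_div_iff₀ (by positivity)] at h2
  refine ((h p hp).lintegral_strip_le_slices hφ.continuous hΩ.isOpen hη0 (by linarith)).trans ?_
  calc _ ≤ ∫⁻ _ in Set.Ioc 0 ((1 + (K p : ℝ)) * η),
        (2 * (∫⁻ x, ENNReal.ofReal (φ x ^ 2) ∂(surfaceMeasure Ω))
        + ENNReal.ofReal (2 * ((1 + K p) * η)) *
          ∫⁻ x in Ω, ENNReal.ofReal (‖fderiv ℝ φ x‖ ^ 2)) := by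
        refine setLIntegral_mono' measurableSet_Ioc fun t ht => ?_
        have h3 := ht.2
        have h4 := (h p hp).pos
        refine ((h p hp).lintegral_slice_le_add hφ hΩ.isOpen ht.1 (by linarith)).trans ?_
        gcongr
    _ ≤ _ := by
        rw [setLIntegral_const, Real.volume_Ioc, sub_zero, add_mul]
        refine add_le_add ?_ ?_
        · have h5 : 2 * ENNReal.ofReal ((1 + (K p : ℝ)) * η)
              = ENNReal.ofReal (2 * ((1 + (K p : ℝ)) * η)) := by
            rw [ENNReal.ofReal_mul zero_le_two, ENNReal.ofReal_ofNat]
          rw [mul_right_comm, h5]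
          refine mul_le_mul_left (ENNReal.ofReal_le_ofReal ?_) _
          have h6 : 0 ≤ K p * ((1 + (K p : ℝ)) * η) := by positivity
          linarith
        · rw [mul_right_comm, ← ENNReal.ofReal_mul (by positivity)]
          refine le_of_eq ?_
          congr 2
          ring

end Boundary

end DtN

end

noncomputable section

namespace DtN

/-! ### The Poincaré inequality on convex sets and interior cubes -/

section Poincare

open scoped ENNReal NNReal

variable {d : ℕ}

/-- A contraction towards a point of Q preserves the convex set Q, and its inverse has Jacobian
a^(-d) ≤ 2^d. -/
lemma lintegral_homothety_le {Q : Set (Euc d)} (hQ : Convex ℝ Q) (hm : MeasurableSet Q)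
    {h : Euc d → ℝ≥0∞} (hh : Measurable h) {z : Euc d} (hz : z ∈ Q) {a : ℝ} (ha : 1 / 2 ≤ a)
    (ha1 : a ≤ 1) :
    ∫⁻ y in Q, h ((1 - a) • z + a • y) ≤ 2 ^ d * ∫⁻ x in Q, h x := by
  have ha0 : 0 < a := by linarith
  have hk : Measurable (Q.indicator h) := hh.indicator hm
  calc ∫⁻ y in Q, h ((1 - a) • z + a • y)
      ≤ ∫⁻ y in Q, Q.indicator h ((1 - a) • z + a • y) := by
        refine setLIntegral_mono' hm fun y hy => ?_
        rw [Set.indicator_of_mem (hQ hz hy (by linarith) ha0.le (by ring))]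
    _ ≤ ∫⁻ y, Q.indicator h ((1 - a) • z + a • y) := setLIntegral_le_lintegral _ _
    _ = ∫⁻ y, Q.indicator h ((1 - a) • z + y) ∂(Measure.map (a • ·) (volume : Measure (Euc d))) := by
        rw [lintegral_map (by fun_prop) (by fun_prop)]
    _ = ENNReal.ofReal |(a ^ d)⁻¹| * ∫⁻ x in Q, h x := by
        rw [Measure.map_addHaar_smul _ ha0.ne', lintegral_smul_measure,
          lintegral_add_left_eq_self, lintegral_indicator hm, finrank_euclideanSpace_fin,
          smul_eq_mul]
    _ ≤ 2 ^ d * ∫⁻ x in Q, h x := by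
        gcongr
        have h1 : |(a ^ d)⁻¹| ≤ 2 ^ d := by
          rw [abs_of_pos (by positivity), ← inv_pow]
          refine pow_le_pow_left₀ (by positivity) ?_ d
          rw [inv_le_comm₀ ha0 two_pos]
          linarith
        refine (ENNReal.ofReal_le_ofReal h1).trans ?_
        rw [ENNReal.ofReal_pow zero_le_two, ENNReal.ofReal_ofNat]

lemma sq_sub_le_lintegral {φ : Euc d → ℝ} (hφ : ContDiff ℝ ∞ φ) (x y : Euc d) {δ : ℝ}
    (hδ : ‖x - y‖ ≤ δ) :
    ENNReal.ofReal ((φ x - φ y) ^ 2) ≤ ENNReal.ofReal (δ ^ 2) *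
      ∫⁻ t in Set.Ioc (0 : ℝ) 1, ENNReal.ofReal (‖fderiv ℝ φ ((1 - t) • x + t • y)‖ ^ 2) := by
  have hcf := hφ.continuous_fderiv (by simp)
  have hline : ∀ t : ℝ, HasDerivAt (fun t : ℝ => φ ((1 - t) • x + t • y))
      (fderiv ℝ φ ((1 - t) • x + t • y) (y - x)) t := fun t => by
    have h1 : HasDerivAt (fun t : ℝ => (1 - t) • x + t • y) (y - x) t := by
      have h2 := (((hasDerivAt_id t).const_sub 1).smul_const x).add
        ((hasDerivAt_id t).smul_const y)
      refine h2.congr_deriv ?_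
      rw [neg_one_smul, one_smul]
      abel
    exact ((hφ.differentiable (by simp) _).hasFDerivAt).comp_hasDerivAt t h1
  let D : ℝ → ℝ := fun t => ‖fderiv ℝ φ ((1 - t) • x + t • y)‖
  have hD : Continuous D := by
    simp only [D]
    fun_prop
  have h0 : ∫ t in (0 : ℝ)..1, fderiv ℝ φ ((1 - t) • x + t • y) (y - x) = φ y - φ x := by
    rw [intervalIntegral.integral_eq_sub_of_hasDerivAt (fun t _ => hline t)
      (Continuous.intervalIntegrable (by fun_prop) _ _)]
    simp
  have h1 : |φ x - φ y| ≤ δ * ∫ t in (0 : ℝ)..1, D t := by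
    rw [abs_sub_comm, ← h0, ← intervalIntegral.integral_const_mul, ← Real.norm_eq_abs]
    refine (intervalIntegral.norm_integral_le_integral_norm zero_le_one).trans ?_
    refine intervalIntegral.integral_mono_on zero_le_one
      (Continuous.intervalIntegrable (by fun_prop) _ _)
      (Continuous.intervalIntegrable (by fun_prop) _ _) fun t _ => ?_
    refine ((fderiv ℝ φ ((1 - t) • x + t • y)).le_opNorm _).trans ?_
    rw [mul_comm, norm_sub_rev]
    simp only [D]
    gcongr
  have h2 : (∫ t in (0 : ℝ)..1, D t) ^ 2 ≤ ∫ t in (0 : ℝ)..1, D t ^ 2 := by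
    have h3 : 0 ≤ ∫ t in (0 : ℝ)..1, (D t - ∫ t in (0 : ℝ)..1, D t) ^ 2 :=
      intervalIntegral.integral_nonneg zero_le_one fun t _ => sq_nonneg _
    generalize hm : ∫ t in (0 : ℝ)..1, D t = m at h3 ⊢
    have h4 : ∫ t in (0 : ℝ)..1, (D t - m) ^ 2
        = (∫ t in (0 : ℝ)..1, D t ^ 2) - 2 * m * (∫ t in (0 : ℝ)..1, D t) + m ^ 2 := by
      have h5 : ∀ t, (D t - m) ^ 2 = D t ^ 2 - 2 * m * D t + m ^ 2 := fun t => by ring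
      simp only [h5]
      rw [intervalIntegral.integral_add (Continuous.intervalIntegrable (by fun_prop) _ _)
        (Continuous.intervalIntegrable (by fun_prop) _ _),
        intervalIntegral.integral_sub (Continuous.intervalIntegrable (by fun_prop) _ _)
        (Continuous.intervalIntegrable (by fun_prop) _ _), intervalIntegral.integral_const_mul]
      simp
    rw [h4, hm] at h3
    linarith
  have hδ0 : 0 ≤ δ := (norm_nonneg _).trans hδ
  have h3 : (φ x - φ y) ^ 2 ≤ δ ^ 2 * ∫ t in (0 : ℝ)..1, D t ^ 2 := by
    rw [← sq_abs]
    refine (pow_le_pow_left₀ (abs_nonneg _) h1 2).trans ?_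
    rw [mul_pow]
    gcongr
  refine (ENNReal.ofReal_le_ofReal h3).trans ?_
  rw [ENNReal.ofReal_mul (by positivity), intervalIntegral.integral_of_le zero_le_one,
    ofReal_integral_eq_lintegral_ofReal (Continuous.integrableOn_Ioc (by fun_prop))
      (ae_of_all _ fun t => by positivity)]

/-- The difference is integrated along the segment from x to y. For t ≥ 1/2 the intermediate point
is a contraction in y, for t ≤ 1/2 one in x, so the ratio is never below 1/2 and the Jacobian stays
bounded. -/
lemma lintegral_lintegral_sq_sub_le {φ : Euc d → ℝ} (hφ : ContDiff ℝ ∞ φ) {Q : Set (Euc d)}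
    (hQ : Convex ℝ Q) (hm : MeasurableSet Q) {δ : ℝ} (hδ : ∀ x ∈ Q, ∀ y ∈ Q, ‖x - y‖ ≤ δ) :
    ∫⁻ x in Q, ∫⁻ y in Q, ENNReal.ofReal ((φ x - φ y) ^ 2)
      ≤ ENNReal.ofReal (δ ^ 2) * (2 ^ d * (∫⁻ x in Q, ENNReal.ofReal (‖fderiv ℝ φ x‖ ^ 2))
        * volume Q) := by
  have hcf := hφ.continuous_fderiv (by simp)
  let h : Euc d → ℝ≥0∞ := fun x => ENNReal.ofReal (‖fderiv ℝ φ x‖ ^ 2)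
  have hh : Measurable h := by
    simp only [h]
    fun_prop
  have hsw : ∀ t ∈ Set.Ioc (0 : ℝ) 1,
      ∫⁻ x in Q, ∫⁻ y in Q, h ((1 - t) • x + t • y) ≤ 2 ^ d * (∫⁻ x in Q, h x) * volume Q := by
    intro t ht
    rw [← setLIntegral_const]
    rcases le_total (1 / 2) t with h1 | h1
    · refine setLIntegral_mono' hm fun x hx => ?_
      exact lintegral_homothety_le hQ hm hh hx h1 ht.2
    · rw [lintegral_lintegral_swap (Measurable.aemeasurable (by fun_prop))]
      refine setLIntegral_mono' hm fun y hy => ?_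
      have h2 := lintegral_homothety_le hQ hm hh hy (a := 1 - t) (by linarith) (by linarith [ht.1])
      simpa only [sub_sub_cancel, add_comm] using h2
  calc ∫⁻ x in Q, ∫⁻ y in Q, ENNReal.ofReal ((φ x - φ y) ^ 2)
      ≤ ∫⁻ x in Q, ∫⁻ y in Q, ENNReal.ofReal (δ ^ 2) *
          ∫⁻ t in Set.Ioc (0 : ℝ) 1, h ((1 - t) • x + t • y) := by
        refine setLIntegral_mono' hm fun x hx => setLIntegral_mono' hm fun y hy => ?_
        exact sq_sub_le_lintegral hφ x y (hδ x hx y hy)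
    _ = ENNReal.ofReal (δ ^ 2) * ∫⁻ t in Set.Ioc (0 : ℝ) 1, ∫⁻ x in Q, ∫⁻ y in Q,
          h ((1 - t) • x + t • y) := by
        have h1 : ∀ x, ∫⁻ y in Q, ENNReal.ofReal (δ ^ 2) *
            ∫⁻ t in Set.Ioc (0 : ℝ) 1, h ((1 - t) • x + t • y)
            = ENNReal.ofReal (δ ^ 2) * ∫⁻ t in Set.Ioc (0 : ℝ) 1, ∫⁻ y in Q,
              h ((1 - t) • x + t • y) := fun x => by
          rw [lintegral_const_mul' _ _ ENNReal.ofReal_ne_top,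
            lintegral_lintegral_swap (Measurable.aemeasurable (by fun_prop))]
        simp only [h1]
        rw [lintegral_const_mul' _ _ ENNReal.ofReal_ne_top, lintegral_lintegral_swap]
        refine Measurable.aemeasurable (Measurable.lintegral_prod_right ?_)
        fun_prop
    _ ≤ ENNReal.ofReal (δ ^ 2) * ∫⁻ _ in Set.Ioc (0 : ℝ) 1,
          2 ^ d * (∫⁻ x in Q, h x) * volume Q := by
        exact mul_le_mul_right (setLIntegral_mono' measurableSet_Ioc hsw) _
    _ = _ := by
        rw [setLIntegral_const]
        simp [h]

/-- Expanding the square, the double integral of (φ x - φ y)² is 2(|Q|∫φ² - (∫φ)²). -/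
lemma setIntegral_sq_le {φ : Euc d → ℝ} (hφ : ContDiff ℝ ∞ φ) (hc : HasCompactSupport φ)
    {Q : Set (Euc d)} (hQ : Convex ℝ Q) (hm : MeasurableSet Q) (hv : volume Q ≠ ⊤) {δ : ℝ}
    (hδ : ∀ x ∈ Q, ∀ y ∈ Q, ‖x - y‖ ≤ δ) :
    ∫ x in Q, φ x ^ 2 ≤ (volume.real Q)⁻¹ * (∫ x in Q, φ x) ^ 2
      + 2 ^ d * δ ^ 2 * ∫ x in Q, ‖fderiv ℝ φ x‖ ^ 2 := by
  have hcφ := hφ.continuous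
  have hcf := hφ.continuous_fderiv (by simp)
  have : IsFiniteMeasure ((volume : Measure (Euc d)).restrict Q) := ⟨by
    rw [Measure.restrict_apply_univ]
    exact hv.lt_top⟩
  have i1 : Integrable φ (volume.restrict Q) :=
    (hcφ.integrable_of_hasCompactSupport hc).restrict
  have i2 : Integrable (fun x => φ x ^ 2) (volume.restrict Q) := by
    refine (Continuous.integrable_of_hasCompactSupport (by fun_prop) ?_).restrict
    exact hc.comp_left (g := fun t => t ^ 2) (by simp)
  have i3 : Integrable (fun x => ‖fderiv ℝ φ x‖ ^ 2) (volume.restrict Q) := by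
    refine (Continuous.integrable_of_hasCompactSupport (by fun_prop) ?_).restrict
    exact (hc.fderiv ℝ).comp_left (g := fun t => ‖t‖ ^ 2) (by simp)
  obtain ⟨v, hv'⟩ : ∃ v, v = volume.real Q := ⟨_, rfl⟩
  obtain ⟨m, hm'⟩ : ∃ m, m = ∫ x in Q, φ x := ⟨_, rfl⟩
  obtain ⟨S, hS⟩ : ∃ S, S = ∫ x in Q, φ x ^ 2 := ⟨_, rfl⟩
  obtain ⟨D, hD⟩ : ∃ D, D = ∫ x in Q, ‖fderiv ℝ φ x‖ ^ 2 := ⟨_, rfl⟩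
  have e1 : ∀ x, ∫ y in Q, (φ x - φ y) ^ 2 = v * φ x ^ 2 - 2 * m * φ x + S := fun x => by
    have h1 : ∀ y, (φ x - φ y) ^ 2 = φ x ^ 2 - 2 * φ x * φ y + φ y ^ 2 := fun y => by ring
    have j : Integrable (fun y => φ x ^ 2 - 2 * φ x * φ y) (volume.restrict Q) :=
      (integrable_const _).sub (i1.const_mul _)
    simp only [h1]
    rw [integral_add j i2, integral_sub (integrable_const _) (i1.const_mul _),
      integral_const_mul, ← hm', ← hS]
    simp [← hv']
    ring
  have i4 : ∀ x, Integrable (fun y => (φ x - φ y) ^ 2) (volume.restrict Q) := fun x => by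
    have h1 : ∀ y, (φ x - φ y) ^ 2 = φ x ^ 2 - 2 * φ x * φ y + φ y ^ 2 := fun y => by ring
    simp only [h1]
    exact ((integrable_const _).sub (i1.const_mul _)).add i2
  have j : Integrable (fun x => v * φ x ^ 2 - 2 * m * φ x) (volume.restrict Q) :=
    (i2.const_mul _).sub (i1.const_mul _)
  have j' : Integrable (fun x => v * φ x ^ 2 - 2 * m * φ x + S) (volume.restrict Q) :=
    j.add (integrable_const _)
  have e2 : ∫ x in Q, (v * φ x ^ 2 - 2 * m * φ x + S) = 2 * (v * S - m ^ 2) := by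
    rw [integral_add j (integrable_const _),
      integral_sub (i2.const_mul _) (i1.const_mul _), integral_const_mul, integral_const_mul,
      ← hm', ← hS]
    simp [← hv']
    ring
  have e3 : ∫⁻ x in Q, ∫⁻ y in Q, ENNReal.ofReal ((φ x - φ y) ^ 2)
      = ENNReal.ofReal (2 * (v * S - m ^ 2)) := by
    rw [← e2, ofReal_integral_eq_lintegral_ofReal j']
    · refine lintegral_congr fun x => ?_
      rw [← e1, ofReal_integral_eq_lintegral_ofReal (i4 x) (ae_of_all _ fun y => sq_nonneg _)]
    · refine ae_of_all _ fun x => ?_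
      simp only [Pi.zero_apply]
      rw [← e1]
      exact integral_nonneg fun y => sq_nonneg _
  have hS0 : 0 ≤ S := hS ▸ integral_nonneg fun y => sq_nonneg _
  have hD0 : 0 ≤ D := hD ▸ integral_nonneg fun y => sq_nonneg _
  have hv0 : 0 ≤ v := hv' ▸ measureReal_nonneg
  have h1 := lintegral_lintegral_sq_sub_le hφ hQ hm hδ
  rw [e3, ← ofReal_integral_eq_lintegral_ofReal i3 (ae_of_all _ fun y => sq_nonneg _), ← hD,
    ← ofReal_measureReal hv, ← hv', ← ENNReal.ofReal_ofNat, ← ENNReal.ofReal_pow (by norm_num),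
    ← ENNReal.ofReal_mul (by positivity), ← ENNReal.ofReal_mul (by positivity),
    ← ENNReal.ofReal_mul (by positivity), ENNReal.ofReal_le_ofReal_iff (by positivity)] at h1
  rw [← hS, ← hm', ← hv', ← hD]
  -- On a null set the inverse volume is 0 by convention, but then the left-hand side vanishes too.
  rcases hv0.eq_or_lt with h0 | h0
  · have hz : volume Q = 0 := by
      rw [hv', measureReal_def] at h0
      exact ((ENNReal.toReal_eq_zero_iff _).1 h0.symm).resolve_right hv
    have : S = 0 := by
      rw [hS, Measure.restrict_eq_zero.2 hz, integral_zero_measure]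
    rw [this]
    positivity
  · rw [← sub_le_iff_le_add', ← mul_le_mul_iff_right₀ h0]
    have h2 : v * (S - v⁻¹ * m ^ 2) = v * S - m ^ 2 := by
      field_simp
    have h3 : 0 ≤ 2 ^ d * δ ^ 2 * D * v := by positivity
    rw [h2]
    linarith

/-! ### Decomposition of the domain into small cubes and a boundary strip -/

lemma exists_mem_segment_frontier {Ω : Set (Euc d)} (hΩ : IsOpen Ω) {x y : Euc d} (hx : x ∈ Ω)
    (hy : y ∉ Ω) : ∃ q ∈ segment ℝ x y, q ∈ frontier Ω := by
  by_contra! hne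
  have hor : ∀ z ∈ segment ℝ x y, z ∈ Ω ∨ z ∈ (closure Ω)ᶜ := fun z hz => by
    by_contra! hcon
    refine hne z hz ?_
    rw [hΩ.frontier_eq]
    exact ⟨not_not.1 hcon.2, hcon.1⟩
  obtain ⟨z, -, hz, hz'⟩ := (convex_segment x y).isPreconnected Ω (closure Ω)ᶜ hΩ
    isClosed_closure.isOpen_compl hor ⟨x, left_mem_segment ℝ x y, hx⟩
    ⟨y, right_mem_segment ℝ x y, (hor y (right_mem_segment ℝ x y)).resolve_left hy⟩
  exact hz' (subset_closure hz)

/-- The cell of side `ε` with index `ν`. -/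
def cell (ε : ℝ) (ν : Fin d → ℤ) : Set (Euc d) := {x | ∀ i, ⌊x i / ε⌋ = ν i}

lemma measurableSet_cell (ε : ℝ) (ν : Fin d → ℤ) : MeasurableSet (cell ε ν) := by
  have h1 : cell ε ν = ⋂ i, {x : Euc d | ⌊x i / ε⌋ = ν i} := by
    ext x
    simp [cell]
  rw [h1]
  refine MeasurableSet.iInter fun i => ?_
  have h2 : Measurable fun x : Euc d => ⌊x i / ε⌋ := Int.measurable_floor.comp (by fun_prop)
  exact h2 (measurableSet_singleton _)

lemma convex_cell (ε : ℝ) (ν : Fin d → ℤ) : Convex ℝ (cell ε ν) := by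
  intro x hx y hy a b ha hb hab i
  have h1 := Int.floor_eq_iff.1 (hx i)
  have h2 := Int.floor_eq_iff.1 (hy i)
  have h3 : (a • x + b • y) i / ε = a * (x i / ε) + b * (y i / ε) := by
    simp
    ring
  rw [Int.floor_eq_iff, h3]
  obtain ⟨h1, h1'⟩ := h1
  obtain ⟨h2, h2'⟩ := h2
  have e : ((ν i : ℤ) : ℝ) = a * ν i + b * ν i := by rw [← add_mul, hab, one_mul]
  constructor
  · rw [e]
    gcongr
  · rw [e]
    have h4 := mul_le_mul_of_nonneg_left h1'.le ha
    have h5 := mul_le_mul_of_nonneg_left h2'.le hb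
    rcases hb.eq_or_lt with h0 | h0
    · have h6 := mul_lt_mul_of_pos_left h1' (show 0 < a by linarith)
      linarith
    · have h6 := mul_lt_mul_of_pos_left h2' h0
      linarith

lemma norm_sub_le_of_mem_cell {ε : ℝ} (hε : 0 < ε) {ν : Fin d → ℤ} {x y : Euc d}
    (hx : x ∈ cell ε ν) (hy : y ∈ cell ε ν) : ‖x - y‖ ≤ √d * ε := by
  rw [EuclideanSpace.norm_eq, Real.sqrt_le_left (by positivity), mul_pow, Real.sq_sqrt (by positivity)]
  refine (Finset.sum_le_card_nsmul _ _ (ε ^ 2) fun i _ => ?_).trans ?_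
  · rw [Real.norm_eq_abs]
    have h1 := Int.floor_eq_iff.1 (hx i)
    have h2 := Int.floor_eq_iff.1 (hy i)
    have h3 : |x i / ε - y i / ε| ≤ 1 := abs_le.2 ⟨by linarith, by linarith⟩
    rw [← sub_div, abs_div, abs_of_pos hε, div_le_one hε] at h3
    refine pow_le_pow_left₀ (abs_nonneg _) ?_ 2
    simpa using h3
  · simp

lemma finite_cells {Ω : Set (Euc d)} (hΩ : Bornology.IsBounded Ω) {ε : ℝ} (hε : 0 < ε) :
    {ν : Fin d → ℤ | (cell ε ν ∩ Ω).Nonempty}.Finite := by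
  obtain ⟨R, hR⟩ := hΩ.exists_norm_le
  refine (Set.finite_Icc (fun _ : Fin d => ⌊-R / ε⌋) fun _ => ⌊R / ε⌋).subset ?_
  rintro ν ⟨x, hx, hxΩ⟩
  have h1 : ∀ i, |x i| ≤ R := fun i => (PiLp.norm_apply_le x i).trans (hR x hxΩ)
  refine ⟨fun i => ?_, fun i => ?_⟩
  · rw [← hx i]
    have := (abs_le.1 (h1 i)).1
    exact Int.floor_le_floor (by gcongr)
  · rw [← hx i]
    have := (abs_le.1 (h1 i)).2
    exact Int.floor_le_floor (by gcongr)

/-- On a bounded Lipschitz domain the `L²` norm is controlled, up to a small multiple of the `H¹`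
norm, by finitely many averages. -/
lemma IsBoundedLipschitzDomain.setIntegral_sq_le {Ω : Set (Euc d)}
    (hΩ : IsBoundedLipschitzDomain Ω) {ε : ℝ} (hε : 0 < ε) :
    ∃ (s : Finset (Fin d → ℤ)) (Q : (Fin d → ℤ) → Set (Euc d)) (C : ℝ),
      (∀ ν, MeasurableSet (Q ν)) ∧ (∀ ν ∈ s, Q ν ⊆ Ω) ∧
      ∀ φ : Euc d → ℝ, ContDiff ℝ ∞ φ → HasCompactSupport φ →
        ∫ x in Ω, φ x ^ 2 ≤ ε * ((∫ x in Ω, φ x ^ 2) + ∫ x in Ω, ‖fderiv ℝ φ x‖ ^ 2)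
          + C * ∑ ν ∈ s, (∫ x in Q ν, φ x) ^ 2 := by
  classical
  obtain ⟨C, hC, η₀, hη₀, hstrip⟩ := hΩ.lintegral_strip_le
  -- the side of the cells
  obtain ⟨η, hη, h1, h2, h3⟩ : ∃ η > 0, √d * η ≤ η₀ ∧ C * (√d * η) * 2 ≤ ε / 2 ∧
      2 ^ d * (√d * η) ^ 2 ≤ ε / 2 := by
    have t1 : Tendsto (fun η : ℝ => √d * η) (𝓝[>] 0) (𝓝 0) := by
      have : Continuous fun η : ℝ => √d * η := by fun_prop
      simpa using (this.tendsto 0).mono_left nhdsWithin_le_nhds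
    have t2 : Tendsto (fun η : ℝ => C * (√d * η) * 2) (𝓝[>] 0) (𝓝 0) := by
      simpa using (t1.const_mul C).mul_const 2
    have t3 : Tendsto (fun η : ℝ => 2 ^ d * (√d * η) ^ 2) (𝓝[>] 0) (𝓝 0) := by
      simpa using (t1.pow 2).const_mul (2 ^ d)
    have h4 := (((t1.eventually (gt_mem_nhds hη₀)).and
      (t2.eventually (gt_mem_nhds (half_pos hε)))).and
      (t3.eventually (gt_mem_nhds (half_pos hε)))).and self_mem_nhdsWithin
    obtain ⟨η, ⟨⟨a1, a2⟩, a3⟩, a4⟩ := h4.exists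
    exact ⟨η, a4, a1.le, a2.le, a3.le⟩
  have hfin := finite_cells hΩ.isBounded hη
  let s : Finset (Fin d → ℤ) := hfin.toFinset.filter fun ν => cell η ν ⊆ Ω
  have hs : ∀ ν ∈ s, cell η ν ⊆ Ω := fun ν hν => (Finset.mem_filter.1 hν).2
  have hvΩ : volume Ω < ⊤ := hΩ.isBounded.measure_lt_top
  refine ⟨s, cell η, ∑ ν ∈ s, (volume.real (cell η ν))⁻¹, measurableSet_cell η, hs,
    fun φ hφ hc => ?_⟩
  have hcφ := hφ.continuous
  have hcf := hφ.continuous_fderiv (by simp)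
  have i2 : ∀ A, Integrable (fun x => φ x ^ 2) (volume.restrict A) := fun A => by
    refine (Continuous.integrable_of_hasCompactSupport (by fun_prop) ?_).restrict
    exact hc.comp_left (g := fun t => t ^ 2) (by simp)
  have i3 : ∀ A, Integrable (fun x => ‖fderiv ℝ φ x‖ ^ 2) (volume.restrict A) := fun A => by
    refine (Continuous.integrable_of_hasCompactSupport (by fun_prop) ?_).restrict
    exact (hc.fderiv ℝ).comp_left (g := fun t => ‖t‖ ^ 2) (by simp)
  let S : Set (Euc d) := {x ∈ Ω | ∃ q ∈ frontier Ω, dist x q ≤ √d * η}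
  -- A cell that meets Ω without being contained in it has a frontier point on a segment inside the
  -- cell, within its diameter √d η of the given point.
  have hcov : Ω ⊆ S ∪ ⋃ ν ∈ s, cell η ν := by
    intro x hx
    by_cases hQ : cell η (fun i => ⌊x i / η⌋) ⊆ Ω
    · refine Or.inr (Set.mem_iUnion₂.2 ⟨fun i => ⌊x i / η⌋, ?_, fun i => rfl⟩)
      refine Finset.mem_filter.2 ⟨hfin.mem_toFinset.2 ⟨x, fun i => rfl, hx⟩, hQ⟩
    · refine Or.inl ⟨hx, ?_⟩
      obtain ⟨y, hy, hyΩ⟩ := Set.not_subset.1 hQ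
      obtain ⟨q, hq, hqf⟩ := exists_mem_segment_frontier hΩ.isOpen hx hyΩ
      refine ⟨q, hqf, ?_⟩
      have hqc := (convex_cell η _).segment_subset (x := x) (fun i => rfl) hy hq
      rw [dist_eq_norm]
      exact norm_sub_le_of_mem_cell hη (fun i => rfl) hqc
  have hS : ∫⁻ x in S, ENNReal.ofReal (φ x ^ 2)
      ≤ ENNReal.ofReal (ε / 2 * ((∫ x in Ω, φ x ^ 2) + ∫ x in Ω, ‖fderiv ℝ φ x‖ ^ 2)) := by
    -- The strip estimate needs a positive width; for d = 0 the strip is empty.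
    rcases (by positivity : 0 ≤ √d * η).eq_or_lt with h0 | h0
    · have hd : (√d : ℝ) = 0 := by
        rcases mul_eq_zero.1 h0.symm with h | h
        · exact h
        · exact absurd h hη.ne'
      have hS0 : S ⊆ ∅ := by
        rintro x ⟨hx, q, hq, hxq⟩
        rw [← h0] at hxq
        have hxq := dist_le_zero.1 hxq
        rw [← hxq, hΩ.isOpen.frontier_eq] at hq
        exact hq.2 hx
      rw [Set.subset_empty_iff.1 hS0]
      simp
    · refine (hstrip _ h0 h1 φ hφ).trans ?_
      have e1 : ∫⁻ x in Ω, energyDensity φ 1 x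
          ≤ ENNReal.ofReal (2 * ((∫ x in Ω, φ x ^ 2) + ∫ x in Ω, ‖fderiv ℝ φ x‖ ^ 2)) := by
        have j : Integrable (fun x => 2 * (φ x ^ 2 + ‖fderiv ℝ φ x‖ ^ 2)) (volume.restrict Ω) :=
          ((i2 _).add (i3 _)).const_mul 2
        rw [← integral_add (i2 _) (i3 _), ← integral_const_mul,
          ofReal_integral_eq_lintegral_ofReal j (ae_of_all _ fun x => by positivity)]
        refine lintegral_mono fun x => ENNReal.ofReal_le_ofReal ?_
        have : 0 ≤ ‖fderiv ℝ φ x‖ ^ 2 := by positivity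
        linarith
      refine (mul_le_mul_right e1 _).trans ?_
      rw [← ENNReal.ofReal_mul (by positivity)]
      refine ENNReal.ofReal_le_ofReal ?_
      rw [← mul_assoc]
      refine mul_le_mul_of_nonneg_right h2 (add_nonneg ?_ ?_) <;>
        exact integral_nonneg fun x => by positivity
  have hcell : ∀ ν ∈ s, ∫⁻ x in cell η ν, ENNReal.ofReal (φ x ^ 2)
      ≤ ENNReal.ofReal ((∑ ν ∈ s, (volume.real (cell η ν))⁻¹) * (∫ x in cell η ν, φ x) ^ 2
        + ε / 2 * ∫ x in cell η ν, ‖fderiv ℝ φ x‖ ^ 2) := fun ν hν => by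
    rw [← ofReal_integral_eq_lintegral_ofReal (i2 _) (ae_of_all _ fun y => sq_nonneg _)]
    refine ENNReal.ofReal_le_ofReal ?_
    refine (DtN.setIntegral_sq_le hφ hc (convex_cell η ν) (measurableSet_cell η ν)
      ((measure_mono (hs ν hν)).trans_lt hvΩ).ne
      fun x hx y hy => norm_sub_le_of_mem_cell hη hx hy).trans ?_
    have hD0 : 0 ≤ ∫ x in cell η ν, ‖fderiv ℝ φ x‖ ^ 2 := integral_nonneg fun x => by positivity
    gcongr
    exact Finset.single_le_sum (f := fun ν => (volume.real (cell η ν))⁻¹)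
      (fun i _ => by positivity) hν
  have hgrad : ∑ ν ∈ s, ∫ x in cell η ν, ‖fderiv ℝ φ x‖ ^ 2 ≤ ∫ x in Ω, ‖fderiv ℝ φ x‖ ^ 2 := by
    rw [← integral_biUnion_finset s (fun ν _ => measurableSet_cell η ν) ?_ fun ν _ => i3 _]
    · refine setIntegral_mono_set (i3 _) (ae_of_all _ fun x => by positivity) ?_
      exact (Set.iUnion₂_subset hs).eventuallyLE
    · intro ν _ μ _ hne
      refine Set.disjoint_left.2 fun x hx hy => hne ?_
      funext i
      rw [← hx i, ← hy i]
  have hD0 : ∀ A, 0 ≤ ∫ x in A, ‖fderiv ℝ φ x‖ ^ 2 := fun A => integral_nonneg fun x => by positivity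
  have hS0 : ∀ A, 0 ≤ ∫ x in A, φ x ^ 2 := fun A => integral_nonneg fun x => by positivity
  have hC0 : 0 ≤ ∑ ν ∈ s, (volume.real (cell η ν))⁻¹ := Finset.sum_nonneg fun ν _ => by positivity
  have htot := (lintegral_mono_set (f := fun x => ENNReal.ofReal (φ x ^ 2)) hcov).trans
    ((lintegral_union_le _ _ _).trans (add_le_add hS
      ((lintegral_biUnion_finset_le _ _ _ _).trans (Finset.sum_le_sum hcell))))
  have hnn : ∀ ν ∈ s, 0 ≤ (∑ ν ∈ s, (volume.real (cell η ν))⁻¹) * (∫ x in cell η ν, φ x) ^ 2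
        + ε / 2 * ∫ x in cell η ν, ‖fderiv ℝ φ x‖ ^ 2 := fun ν _ => by
    have := hD0 (cell η ν)
    positivity
  rw [← ENNReal.ofReal_sum_of_nonneg hnn,
    ← ENNReal.ofReal_add (mul_nonneg (by positivity) (add_nonneg (hS0 _) (hD0 _)))
      (Finset.sum_nonneg hnn),
    ← ofReal_integral_eq_lintegral_ofReal (i2 _) (ae_of_all _ fun y => sq_nonneg _),
    ENNReal.ofReal_le_ofReal_iff (add_nonneg
      (mul_nonneg (by positivity) (add_nonneg (hS0 _) (hD0 _))) (Finset.sum_nonneg hnn)),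
    Finset.sum_add_distrib, ← Finset.mul_sum, ← Finset.mul_sum] at htot
  have h5 := mul_le_mul_of_nonneg_left hgrad (half_pos hε).le
  have h6 := mul_nonneg (half_pos hε).le (hS0 Ω)
  linarith

end Poincare

end DtN

end

noncomputable section

namespace DtN

/-! ### The space of `H¹` functions with a trace -/

section TraceSpace

open scoped ENNReal NNReal

variable {d : ℕ} {Ω : Set (Euc d)}

lemma norm_sq_eq_integral {E : Type*} [NormedAddCommGroup E] [InnerProductSpace ℝ E]
    {μ : Measure (Euc d)} (f : Lp E 2 μ) : ‖f‖ ^ 2 = ∫ x, ‖f x‖ ^ 2 ∂μ := by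
  rw [← real_inner_self_eq_norm_sq, L2.inner_def]
  simp only [real_inner_self_eq_norm_sq]

/-- A continuous function with compact support, as an element of `L²(Ω)`. -/
def testL2 (Ω : Set (Euc d)) {ψ : Euc d → ℝ} (hψ : Continuous ψ) (hc : HasCompactSupport ψ) :
    L2 Ω :=
  ((hψ.memLp_of_hasCompactSupport (μ := volume) (p := 2) hc).restrict Ω).toLp ψ

lemma inner_testL2 (u : L2 Ω) {ψ : Euc d → ℝ} (hψ : Continuous ψ) (hc : HasCompactSupport ψ) :
    ⟪testL2 Ω hψ hc, u⟫ = ∫ x in Ω, u x * ψ x := by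
  rw [L2.inner_def]
  refine integral_congr_ae ?_
  filter_upwards [((hψ.memLp_of_hasCompactSupport (μ := volume) (p := 2) hc).restrict Ω).coeFn_toLp]
    with x hx
  rw [testL2, hx]
  rfl

lemma memLp_smul_const (Ω : Set (Euc d)) {ψ : Euc d → ℝ} (hψ : Continuous ψ)
    (hc : HasCompactSupport ψ) (v : Euc d) :
    MemLp (fun x => ψ x • v) 2 (volume.restrict Ω) :=
  ((hψ.smul continuous_const).memLp_of_hasCompactSupport (μ := volume) (p := 2)
    (hc.smul_right (f' := fun _ => v))).restrict Ω

/-- A continuous function with compact support times a vector, as an element of `L²(Ω; ℝ^d)`. -/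
def testL2Vec (Ω : Set (Euc d)) {ψ : Euc d → ℝ} (hψ : Continuous ψ) (hc : HasCompactSupport ψ)
    (v : Euc d) : L2Vec Ω :=
  (memLp_smul_const Ω hψ hc v).toLp fun x => ψ x • v

lemma inner_testL2Vec (u : L2Vec Ω) {ψ : Euc d → ℝ} (hψ : Continuous ψ) (hc : HasCompactSupport ψ)
    (v : Euc d) : ⟪testL2Vec Ω hψ hc v, u⟫ = ∫ x in Ω, ⟪u x, v⟫ * ψ x := by
  rw [L2.inner_def]
  refine integral_congr_ae ?_
  filter_upwards [(memLp_smul_const Ω hψ hc v).coeFn_toLp] with x hx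
  rw [testL2Vec, hx]
  simp only [real_inner_smul_left, real_inner_comm (u x) v, mul_comm]

/-- Each defining identity equates inner products with fixed `L²` elements, hence is a closed
condition. -/
lemma isClosed_H1 (Ω : Set (Euc d)) : IsClosed (H1 Ω : Set (L2 Ω × L2Vec Ω)) := by
  have h : (H1 Ω : Set (L2 Ω × L2Vec Ω)) = {p | ∀ φ : Euc d → ℝ, ContDiff ℝ ∞ φ →
      HasCompactSupport φ → tsupport φ ⊆ Ω →
      ∀ v : Euc d, ∫ x in Ω, p.1 x * fderiv ℝ φ x v = - ∫ x in Ω, ⟪p.2 x, v⟫ * φ x} := rfl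
  rw [h]
  simp only [Set.ofPred_forall]
  refine isClosed_iInter fun φ => isClosed_iInter fun hφ => isClosed_iInter fun hc =>
    isClosed_iInter fun hs => isClosed_iInter fun v => ?_
  have cd : Continuous (fun x => fderiv ℝ φ x v) :=
    (hφ.continuous_fderiv (by simp)).clm_apply continuous_const
  have cc : HasCompactSupport (fun x => fderiv ℝ φ x v) := hc.fderiv_apply ℝ v
  simp only [← inner_testL2 _ cd cc, ← inner_testL2Vec _ hφ.continuous hc v]
  exact isClosed_eq (by fun_prop) (by fun_prop)

/-- The Hilbert space `L²(Ω) × L²(Ω; ℝ^d) × L²(∂Ω)`. -/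
abbrev TripleL2 (Ω : Set (Euc d)) : Type := WithLp 2 (L2 Ω × WithLp 2 (L2Vec Ω × L2Bdry Ω))

/-- The identification of triples with elements of `TripleL2`. -/
def tripleEquiv (Ω : Set (Euc d)) : ((L2 Ω × L2Vec Ω) × L2Bdry Ω) ≃L[ℝ] TripleL2 Ω :=
  (ContinuousLinearEquiv.prodAssoc ℝ (L2 Ω) (L2Vec Ω) (L2Bdry Ω)).trans
    (((ContinuousLinearEquiv.refl ℝ (L2 Ω)).prodCongr
      (WithLp.prodContinuousLinearEquiv 2 ℝ (L2Vec Ω) (L2Bdry Ω)).symm).trans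
      (WithLp.prodContinuousLinearEquiv 2 ℝ (L2 Ω) (WithLp 2 (L2Vec Ω × L2Bdry Ω))).symm)

/-- The map `(U, u) ↦ (U, ∇U, u)`. -/
def toTriple (Ω : Set (Euc d)) : (H1 Ω × L2Bdry Ω) →L[ℝ] TripleL2 Ω :=
  (tripleEquiv Ω : _ →L[ℝ] TripleL2 Ω) ∘L
    ((H1 Ω).subtypeL.prodMap (ContinuousLinearMap.id ℝ (L2Bdry Ω)))

lemma isClosedEmbedding_toTriple (Ω : Set (Euc d)) : IsClosedEmbedding (toTriple Ω) :=
  (tripleEquiv Ω).toHomeomorph.isClosedEmbedding.comp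
    ((isClosed_H1 Ω).isClosedEmbedding_subtypeVal.prodMap IsClosedEmbedding.id)

/-- The functions in `H¹(Ω)` which have a trace, with the norm
`‖U‖² + ‖∇U‖² + ‖U|_∂Ω‖²`. -/
def traceSpace (Ω : Set (Euc d)) : Submodule ℝ (TripleL2 Ω) :=
  (traceGraph Ω).map (toTriple Ω : (H1 Ω × L2Bdry Ω) →ₗ[ℝ] TripleL2 Ω)

instance (Ω : Set (Euc d)) : CompleteSpace (traceSpace Ω) := by
  have h : IsClosed (traceSpace Ω : Set (TripleL2 Ω)) := by
    rw [traceSpace, Submodule.map_coe]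
    exact (isClosedEmbedding_toTriple Ω).isClosedMap _ (Submodule.isClosed_topologicalClosure _)
  exact h.completeSpace_coe

/-- The components of an element of `traceSpace Ω`. -/
def componentsL (Ω : Set (Euc d)) : traceSpace Ω →L[ℝ] (L2 Ω × L2Vec Ω) × L2Bdry Ω :=
  ((tripleEquiv Ω).symm.toContinuousLinearMap).comp (traceSpace Ω).subtypeL

/-- The bounded operators between two real Hilbert spaces. -/
abbrev HilbertMap (X Y : Type*) [NormedAddCommGroup X] [InnerProductSpace ℝ X]
    [NormedAddCommGroup Y] [InnerProductSpace ℝ Y] : Type _ := X →L[ℝ] Y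

/-- The function underlying an element of `traceSpace Ω`. -/
def fnL (Ω : Set (Euc d)) : HilbertMap (traceSpace Ω) (L2 Ω) :=
  (ContinuousLinearMap.fst ℝ _ _).comp ((ContinuousLinearMap.fst ℝ _ _).comp (componentsL Ω))

/-- The gradient of an element of `traceSpace Ω`. -/
def gradL (Ω : Set (Euc d)) : HilbertMap (traceSpace Ω) (L2Vec Ω) :=
  (ContinuousLinearMap.snd ℝ _ _).comp ((ContinuousLinearMap.fst ℝ _ _).comp (componentsL Ω))

/-- The trace of an element of `traceSpace Ω`. -/
def traceL (Ω : Set (Euc d)) : HilbertMap (traceSpace Ω) (L2Bdry Ω) :=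
  (ContinuousLinearMap.snd ℝ _ _).comp (componentsL Ω)

/-- The element of `traceSpace Ω` given by a function in `H¹(Ω)` and its trace. -/
def ofHasTrace {U : H1 Ω} {u : L2Bdry Ω} (h : HasTrace U u) : traceSpace Ω :=
  ⟨toTriple Ω (U, u), Submodule.mem_map_of_mem h⟩

lemma fnL_ofHasTrace {U : H1 Ω} {u : L2Bdry Ω} (h : HasTrace U u) : fnL Ω (ofHasTrace h) = fn U :=
  rfl

lemma gradL_ofHasTrace {U : H1 Ω} {u : L2Bdry Ω} (h : HasTrace U u) :
    gradL Ω (ofHasTrace h) = grad U := rfl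

lemma traceL_ofHasTrace {U : H1 Ω} {u : L2Bdry Ω} (h : HasTrace U u) :
    traceL Ω (ofHasTrace h) = u := rfl

lemma exists_ofHasTrace (x : traceSpace Ω) :
    ∃ (U : H1 Ω) (u : L2Bdry Ω) (h : HasTrace U u), ofHasTrace h = x := by
  obtain ⟨x, ⟨U, u⟩, h, rfl⟩ := x
  exact ⟨U, u, h, rfl⟩

lemma inner_traceSpace (x y : traceSpace Ω) :
    ⟪x, y⟫ = ⟪fnL Ω x, fnL Ω y⟫ + ⟪gradL Ω x, gradL Ω y⟫ + ⟪traceL Ω x, traceL Ω y⟫ := by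
  rw [add_assoc]
  rfl

lemma norm_sq_traceSpace (x : traceSpace Ω) :
    ‖x‖ ^ 2 = ‖fnL Ω x‖ ^ 2 + ‖gradL Ω x‖ ^ 2 + ‖traceL Ω x‖ ^ 2 := by
  simp only [← real_inner_self_eq_norm_sq, inner_traceSpace]

lemma smooth_hasTrace {p : H1 Ω × L2Bdry Ω} (h : p ∈ smoothTraceGraph Ω) : HasTrace p.1 p.2 :=
  (smoothTraceGraph Ω).le_topologicalClosure h

/-- Closed conditions on `traceSpace Ω` may be checked for smooth functions. -/
lemma traceSpace_induction {P : traceSpace Ω → Prop} (hP : IsClosed {x | P x})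
    (h : ∀ p (hp : p ∈ smoothTraceGraph Ω), P (ofHasTrace (smooth_hasTrace hp)))
    (x : traceSpace Ω) : P x := by
  obtain ⟨U, u, hU, rfl⟩ := exists_ofHasTrace x
  have h1 : (U, u) ∈ closure (smoothTraceGraph Ω : Set (H1 Ω × L2Bdry Ω)) := hU
  obtain ⟨p, hp, hlim⟩ := mem_closure_iff_seq_limit.1 h1
  refine hP.mem_of_tendsto (f := fun n => ofHasTrace (smooth_hasTrace (hp n))) (b := atTop) ?_
    (Eventually.of_forall fun n => h _ (hp n))
  rw [tendsto_subtype_rng]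
  exact ((toTriple Ω).continuous.tendsto _).comp hlim

/-! ### Compactness of the embedding and of the trace -/

lemma norm_sq_fn_of_isRepr {U : H1 Ω} {φ : Euc d → ℝ} (h : IsRepr U φ) :
    ‖fn U‖ ^ 2 = ∫ x in Ω, φ x ^ 2 := by
  rw [norm_sq_eq_integral]
  refine integral_congr_ae ?_
  filter_upwards [h.1] with x hx
  rw [hx, Real.norm_eq_abs, sq_abs]

lemma norm_sq_grad_of_isRepr {U : H1 Ω} {φ : Euc d → ℝ} (h : IsRepr U φ) :
    ‖grad U‖ ^ 2 = ∫ x in Ω, ‖fderiv ℝ φ x‖ ^ 2 := by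
  rw [norm_sq_eq_integral]
  refine integral_congr_ae ?_
  filter_upwards [h.2] with x hx
  rw [hx, gradient, LinearIsometryEquiv.norm_map]

/-- Rellich's theorem. -/
lemma IsBoundedLipschitzDomain.cc_fnL (hΩ : IsBoundedLipschitzDomain Ω) : CC (fnL Ω) := by
  refine CC.of_norm_sq_le_add fun ε hε => ?_
  obtain ⟨s, Q, C, hm, hs, hle⟩ := hΩ.setIntegral_sq_le hε
  have hv : volume Ω < ⊤ := hΩ.isBounded.measure_lt_top
  have hfin : ∀ ν, (volume.restrict Ω) (Q ν) ≠ ⊤ := fun ν =>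
    ((measure_mono (Set.subset_univ _)).trans_lt (by
      rw [Measure.restrict_apply_univ]
      exact hv)).ne
  -- These vectors represent the integrals over the cubes as inner products, which makes them weakly
  -- continuous.
  let w : (Fin d → ℤ) → traceSpace Ω := fun ν =>
    (fnL Ω).adjoint     (indicatorConstLp 2 (hm ν) (hfin ν) (1 : ℝ))
  have hw : ∀ ν ∈ s, ∀ x : traceSpace Ω, ⟪x, w ν⟫ = ∫ y in Q ν, fnL Ω x y := fun ν hν x => by
    rw [ContinuousLinearMap.adjoint_inner_right, real_inner_comm,
      L2.inner_indicatorConstLp_one, Measure.restrict_restrict (hm ν),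
      Set.inter_eq_left.2 (hs ν hν)]
  refine ⟨fun x => C * ∑ ν ∈ s, ⟪x, w ν⟫ ^ 2, fun x x₀ hx => ?_, ?_⟩
  · have h1 : ∀ ν, Tendsto (fun n => ⟪x n - x₀, w ν⟫) (hyperfilter ℕ : Filter ℕ) (𝓝 0) := fun ν => by
      simp only [inner_sub_left]
      simpa using (hx.2 (w ν)).sub_const ⟪x₀, w ν⟫
    simpa using (tendsto_finsetSum s fun ν _ => (h1 ν).pow 2).const_mul C
  · intro x
    have h1 : ‖fnL Ω x‖ ^ 2 ≤ ε * (‖fnL Ω x‖ ^ 2 + ‖gradL Ω x‖ ^ 2)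
        + C * ∑ ν ∈ s, ⟪x, w ν⟫ ^ 2 := by
      induction x using traceSpace_induction with
      | hP => exact isClosed_le (by fun_prop) (by fun_prop)
      | h p hp =>
        obtain ⟨φ, hφ, hc, hr, -⟩ := hp
        have h2 := hle φ hφ hc
        rw [← norm_sq_fn_of_isRepr hr, ← norm_sq_grad_of_isRepr hr] at h2
        refine h2.trans (le_of_eq ?_)
        congr 2
        refine Finset.sum_congr rfl fun ν hν => ?_
        rw [hw ν hν]
        congr 1
        refine integral_congr_ae ?_
        filter_upwards [ae_restrict_of_ae_restrict_of_subset (hs ν hν) hr.1] with y hy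
        exact hy.symm
    refine h1.trans ?_
    rw [norm_sq_traceSpace x]
    have h2 := mul_nonneg hε.le (sq_nonneg ‖traceL Ω x‖)
    linarith

/-- The trace inequality. -/
lemma IsBoundedLipschitzDomain.norm_sq_traceL_le (hΩ : IsBoundedLipschitzDomain Ω) :
    ∃ C, 0 ≤ C ∧ ∃ τ₀ > 0, ∀ τ, 0 < τ → τ ≤ τ₀ → ∀ x : traceSpace Ω,
      ‖traceL Ω x‖ ^ 2 ≤ C * (2 / τ * ‖fnL Ω x‖ ^ 2 + τ * ‖gradL Ω x‖ ^ 2) := by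
  obtain ⟨C, τ₀, hτ₀, hle⟩ := hΩ.lintegral_surface_le
  refine ⟨C, C.coe_nonneg, τ₀, hτ₀, fun τ hτ hττ x => ?_⟩
  induction x using traceSpace_induction with
  | hP => exact isClosed_le (by fun_prop) (by fun_prop)
  | h p hp =>
    obtain ⟨φ, hφ, hc, hr, ht⟩ := hp
    have hcφ := hφ.continuous
    have hcf := hφ.continuous_fderiv (by simp)
    rw [traceL_ofHasTrace, fnL_ofHasTrace, gradL_ofHasTrace, norm_sq_fn_of_isRepr hr,
      norm_sq_grad_of_isRepr hr, norm_sq_eq_integral]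
    have i2 : Integrable (fun x => φ x ^ 2) (volume.restrict Ω) := by
      refine (Continuous.integrable_of_hasCompactSupport (by fun_prop) ?_).restrict
      exact hc.comp_left (g := fun t => t ^ 2) (by simp)
    have i3 : Integrable (fun x => ‖fderiv ℝ φ x‖ ^ 2) (volume.restrict Ω) := by
      refine (Continuous.integrable_of_hasCompactSupport (by fun_prop) ?_).restrict
      exact (hc.fderiv ℝ).comp_left (g := fun t => ‖t‖ ^ 2) (by simp)
    have j : Integrable (fun x => 2 / τ * φ x ^ 2 + τ * ‖fderiv ℝ φ x‖ ^ 2) (volume.restrict Ω) :=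
      (i2.const_mul _).add (i3.const_mul _)
    have h1 := hle τ hτ hττ φ hφ
    simp only [energyDensity] at h1
    rw [← ofReal_integral_eq_lintegral_ofReal j (ae_of_all _ fun x => by positivity),
      integral_add (i2.const_mul _) (i3.const_mul _), integral_const_mul, integral_const_mul,
      ← ENNReal.ofReal_coe_nnreal, ← ENNReal.ofReal_mul C.coe_nonneg] at h1
    have h2 : ∫ x, ‖p.2 x‖ ^ 2 ∂(surfaceMeasure Ω) = ∫ x, φ x ^ 2 ∂(surfaceMeasure Ω) := by
      refine integral_congr_ae ?_
      filter_upwards [ht] with x hx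
      rw [hx, Real.norm_eq_abs, sq_abs]
    rw [h2, integral_eq_lintegral_of_nonneg_ae (ae_of_all _ fun x => by positivity)
      (by fun_prop)]
    refine ENNReal.toReal_le_of_le_ofReal ?_ h1
    have : 0 ≤ ∫ x in Ω, φ x ^ 2 := integral_nonneg fun x => by positivity
    have : 0 ≤ ∫ x in Ω, ‖fderiv ℝ φ x‖ ^ 2 := integral_nonneg fun x => by positivity
    positivity

/-- The gradient term of the trace inequality carries an arbitrarily small τ, and the `L²` term is
compact by Rellich's theorem. -/
lemma IsBoundedLipschitzDomain.cc_traceL (hΩ : IsBoundedLipschitzDomain Ω) : CC (traceL Ω) := by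
  obtain ⟨C, hC, τ₀, hτ₀, hle⟩ := hΩ.norm_sq_traceL_le
  refine CC.of_norm_sq_le hΩ.cc_fnL fun ε hε => ?_
  have h1 : 0 < ε / (C + 1) := by positivity
  refine ⟨C * (2 / min τ₀ (ε / (C + 1))), fun x => ?_⟩
  refine (hle _ (lt_min hτ₀ h1) (min_le_left _ _) x).trans ?_
  have h2 : C * min τ₀ (ε / (C + 1)) ≤ ε := by
    calc C * min τ₀ (ε / (C + 1)) ≤ (C + 1) * (ε / (C + 1)) :=
          mul_le_mul (by linarith) (min_le_right _ _) (le_min hτ₀.le h1.le) (by linarith)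
      _ = ε := by field_simp
  have h3 : ‖gradL Ω x‖ ^ 2 ≤ ‖x‖ ^ 2 := by
    rw [norm_sq_traceSpace x]
    linarith [sq_nonneg ‖traceL Ω x‖, sq_nonneg ‖fnL Ω x‖]
  have h4 := mul_le_mul h2 h3 (sq_nonneg _) hε.le
  rw [mul_add]
  linarith

end TraceSpace

end DtN

end

noncomputable section

namespace DtN

/-! ### Functions with zero trace -/

section ZeroTrace

open scoped ENNReal NNReal

variable {d : ℕ} {Ω : Set (Euc d)}

lemma memLp_gradient (Ω : Set (Euc d)) {φ : Euc d → ℝ} (hφ : ContDiff ℝ ∞ φ)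
    (hc : HasCompactSupport φ) : MemLp (gradient φ) 2 (volume.restrict Ω) := by
  have h1 : Continuous (gradient φ) :=
    (InnerProductSpace.toDual ℝ (Euc d)).symm.continuous.comp (hφ.continuous_fderiv (by simp))
  have h2 : HasCompactSupport (gradient φ) :=
    (hc.fderiv ℝ).comp_left (g := (InnerProductSpace.toDual ℝ (Euc d)).symm) (map_zero _)
  exact (h1.memLp_of_hasCompactSupport (μ := volume) (p := 2) h2).restrict Ω

/-- A smooth function with compact support, as an element of `H¹(Ω)`. -/
def smoothH1 (Ω : Set (Euc d)) {φ : Euc d → ℝ} (hφ : ContDiff ℝ ∞ φ) (hc : HasCompactSupport φ) :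
    H1 Ω := ⟨(testL2 Ω hφ.continuous hc, (memLp_gradient Ω hφ hc).toLp _), by
  intro ψ hψ hcψ hs v
  have cd : Continuous (fun x => fderiv ℝ φ x v) :=
    (hφ.continuous_fderiv (by simp)).clm_apply continuous_const
  have cdψ : Continuous (fun x => fderiv ℝ ψ x v) :=
    (hψ.continuous_fderiv (by simp)).clm_apply continuous_const
  have hcφ := hφ.continuous
  have hcψ' := hψ.continuous
  have h1 : ∫ x in Ω, testL2 Ω hφ.continuous hc x * fderiv ℝ ψ x v
      = ∫ x, φ x * fderiv ℝ ψ x v := by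
    refine Eq.trans ?_ (setIntegral_eq_integral_of_forall_compl_eq_zero (s := Ω) ?_)
    · refine integral_congr_ae ?_
      filter_upwards [((hφ.continuous.memLp_of_hasCompactSupport (μ := volume) (p := 2)
        hc).restrict Ω).coeFn_toLp] with x hx
      rw [testL2, hx]
    · intro x hx
      have h0 : fderiv ℝ ψ x = 0 :=
        image_eq_zero_of_notMem_tsupport fun h => hx (hs (tsupport_fderiv_subset ℝ h))
      simp [h0]
  have h2 : ∫ x in Ω, ⟪(memLp_gradient Ω hφ hc).toLp (gradient φ) x, v⟫ * ψ x
      = ∫ x, fderiv ℝ φ x v * ψ x := by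
    refine Eq.trans ?_ (setIntegral_eq_integral_of_forall_compl_eq_zero (s := Ω) ?_)
    · refine integral_congr_ae ?_
      filter_upwards [(memLp_gradient Ω hφ hc).coeFn_toLp] with x hx
      rw [hx, inner_gradient_left]
    · intro x hx
      rw [image_eq_zero_of_notMem_tsupport fun h => hx (hs h), mul_zero]
  rw [h1, h2]
  refine integral_mul_fderiv_eq_neg_fderiv_mul_of_integrable ?_ ?_ ?_
    (fun x _ => hφ.differentiable (by simp) x) fun x _ => hψ.differentiable (by simp) x
  · exact (cd.mul hcψ').integrable_of_hasCompactSupport hcψ.mul_left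
  · exact (hcφ.mul cdψ).integrable_of_hasCompactSupport hc.mul_right
  · exact (hcφ.mul hcψ').integrable_of_hasCompactSupport hc.mul_right⟩

lemma isRepr_smoothH1 (Ω : Set (Euc d)) {φ : Euc d → ℝ} (hφ : ContDiff ℝ ∞ φ)
    (hc : HasCompactSupport φ) : IsRepr (smoothH1 Ω hφ hc) φ :=
  ⟨((hφ.continuous.memLp_of_hasCompactSupport (μ := volume) (p := 2) hc).restrict Ω).coeFn_toLp,
    (memLp_gradient Ω hφ hc).coeFn_toLp⟩

/-- The weak gradient is unique. -/
lemma H1.ext_fn (hΩ : IsOpen Ω) {U V : H1 Ω} (h : fn U = fn V) : U = V := by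
  rw [← sub_eq_zero]
  obtain ⟨W, hW⟩ : ∃ W, W = U - V := ⟨_, rfl⟩
  have hf : fn W = 0 := by
    rw [hW]
    exact sub_eq_zero.2 h
  rw [← hW]
  have hg : grad W = 0 := by
    have hloc : ∀ v : Euc d, LocallyIntegrableOn (fun x => ⟪grad W x, v⟫) Ω volume := fun v => by
      have h1 : MemLp (fun x => ⟪grad W x, v⟫) 2 (volume.restrict Ω) :=
        (Lp.memLp (grad W)).inner_const v
      rw [locallyIntegrableOn_iff hΩ.isLocallyClosed]
      intro k hk hkc
      have h2 : MemLp (fun x => ⟪grad W x, v⟫) 2 (volume.restrict k) := by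
        have := h1.restrict k
        rwa [Measure.restrict_restrict hkc.measurableSet, Set.inter_eq_left.2 hk] at this
      have : IsFiniteMeasure ((volume : Measure (Euc d)).restrict k) := ⟨by
        rw [Measure.restrict_apply_univ]
        exact hkc.measure_lt_top⟩
      exact h2.integrable (by norm_num)
    have h0 : ∀ v : Euc d, ∀ᵐ x ∂(volume : Measure (Euc d)), x ∈ Ω → ⟪grad W x, v⟫ = 0 := fun v => by
      refine hΩ.ae_eq_zero_of_integral_contDiff_smul_eq_zero (hloc v) fun φ hφ hc hs => ?_
      have h1 := W.2 φ hφ hc hs v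
      have h2 : ∫ x in Ω, (W : L2 Ω × L2Vec Ω).1 x * fderiv ℝ φ x v = 0 := by
        refine (integral_congr_ae ?_).trans (integral_zero _ _)
        have h3 : (W : L2 Ω × L2Vec Ω).1 = 0 := hf
        rw [h3]
        filter_upwards [Lp.coeFn_zero ℝ 2 (volume.restrict Ω)] with x hx
        rw [hx, Pi.zero_apply, zero_mul]
      rw [h2, eq_comm, neg_eq_zero] at h1
      rw [← setIntegral_eq_integral_of_forall_compl_eq_zero (s := Ω)]
      · rw [← h1]
        refine integral_congr_ae (ae_of_all _ fun x => ?_)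
        exact mul_comm _ _
      · intro x hx
        rw [image_eq_zero_of_notMem_tsupport fun h => hx (hs h), zero_smul]
    have h1 : ∀ᵐ x ∂(volume : Measure (Euc d)), ∀ i : Fin d, x ∈ Ω →
        ⟪grad W x, EuclideanSpace.single i (1 : ℝ)⟫ = 0 := ae_all_iff.2 fun i => h0 _
    refine Lp.ext ?_
    filter_upwards [(ae_restrict_iff' hΩ.measurableSet).2 (h1.mono fun x hx hxΩ i => hx i hxΩ),
      Lp.coeFn_zero (Euc d) 2 (volume.restrict Ω)] with x hx hx0
    rw [hx0]
    ext i
    have := hx i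
    simpa [EuclideanSpace.inner_single_right] using this
  exact Subtype.ext (Prod.ext hf hg)

lemma lintegral_norm_sq {E : Type*} [NormedAddCommGroup E] [InnerProductSpace ℝ E]
    {μ : Measure (Euc d)} (f : Lp E 2 μ) :
    ∫⁻ x, ENNReal.ofReal (‖f x‖ ^ 2) ∂μ = ENNReal.ofReal (‖f‖ ^ 2) := by
  rw [norm_sq_eq_integral, ofReal_integral_eq_lintegral_ofReal _
    (ae_of_all _ fun x => sq_nonneg _)]
  exact (Lp.memLp f).integrable_norm_pow two_ne_zero

/-- A truncated multiple of the distance to the complement, equal to 0 up to distance η/4 and to 1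
from η/2 on, is mollified at scale η/8. Averaging preserves the Lipschitz constant 4/η and leaves
margins at both ends. The bounds by 2 are crude. -/
lemma exists_cutoff (hΩ : IsOpen Ω) (hb : Bornology.IsBounded Ω) (hne : Ωᶜ.Nonempty) {η : ℝ}
    (hη : 0 < η) :
    ∃ χ : Euc d → ℝ, ContDiff ℝ ∞ χ ∧ HasCompactSupport χ ∧ tsupport χ ⊆ Ω ∧
      (∀ x, |χ x| ≤ 2) ∧ (∀ x, |χ x - 1| ≤ 2) ∧ (∀ x, ‖fderiv ℝ χ x‖ ≤ 4 / η) ∧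
      ∀ x ∈ Ω, (¬ ∃ q ∈ frontier Ω, dist x q ≤ η) → χ x = 1 ∧ fderiv ℝ χ x = 0 := by
  let δ : Euc d → ℝ := fun x => Metric.infDist x Ωᶜ
  have hδ : ∀ x y, |δ x - δ y| ≤ dist x y := fun x y => by
    have := (Metric.lipschitz_infDist_pt Ωᶜ).dist_le_mul x y
    rwa [NNReal.coe_one, one_mul, Real.dist_eq] at this
  have hδc : Continuous δ := Metric.continuous_infDist_pt _
  let f : Euc d → ℝ := fun x => max 0 (min 1 (4 / η * δ x - 1))
  have hfc : Continuous f := by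
    simp only [f]
    fun_prop
  have hf0 : ∀ x, 0 ≤ f x := fun x => le_max_left _ _
  have hf1 : ∀ x, f x ≤ 1 := fun x => max_le zero_le_one (min_le_left _ _)
  have hfL : ∀ x y, |f x - f y| ≤ 4 / η * ‖x - y‖ := fun x y => by
    refine (abs_max_sub_max_le_max _ _ _ _).trans (max_le (by simp; positivity) ?_)
    refine (abs_min_sub_min_le_max _ _ _ _).trans (max_le (by simp; positivity) ?_)
    rw [sub_sub_sub_cancel_right, ← mul_sub, abs_mul, abs_of_pos (by positivity), ← dist_eq_norm]
    have := hδ x y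
    gcongr
  let b : ContDiffBump (0 : Euc d) := ⟨η / 16, η / 8, by positivity, by linarith⟩
  let χ : Euc d → ℝ := convolution (b.normed volume) f (ContinuousLinearMap.lsmul ℝ ℝ) volume
  have hdist : ∀ x ε, (∀ y ∈ Metric.ball x (η / 8), dist (f y) (f x) ≤ ε) →
      dist (χ x) (f x) ≤ ε := fun x ε h =>
    ContDiffBump.dist_normed_convolution_le hfc.aestronglyMeasurable h
  have hsm : ContDiff ℝ ∞ χ := b.hasCompactSupport_normed.contDiff_convolution_left _
    b.contDiff_normed hfc.locallyIntegrable
  have hnear : ∀ x, |χ x - f x| ≤ 1 := fun x => by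
    rw [← Real.dist_eq]
    refine hdist x 1 fun y _ => ?_
    rw [Real.dist_eq, abs_le]
    constructor <;> linarith [hf0 x, hf0 y, hf1 x, hf1 y]
  have hzero : ∀ x, δ x < η / 8 → χ x = 0 := fun x hx => by
    have h1 : ∀ y, δ y ≤ η / 4 → f y = 0 := fun y hy => by
      refine max_eq_left ((min_le_right _ _).trans ?_)
      rw [sub_nonpos]
      calc 4 / η * δ y ≤ 4 / η * (η / 4) := by gcongr
        _ = 1 := by field_simp
    have hfx := h1 x (by linarith)
    have h2 := hdist x 0 fun y hy => by
      have h3 := (abs_le.1 (hδ y x)).2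
      rw [Metric.mem_ball] at hy
      rw [hfx, h1 y (by linarith), dist_self]
    rw [hfx] at h2
    exact dist_le_zero.1 h2
  have hone : ∀ x, 5 * η / 8 < δ x → χ x = 1 := fun x hx => by
    have h1 : ∀ y, η / 2 ≤ δ y → f y = 1 := fun y hy => by
      have h2 : 1 ≤ 4 / η * δ y - 1 := by
        calc (1 : ℝ) = 4 / η * (η / 2) - 1 := by field_simp; norm_num
          _ ≤ _ := by gcongr
      simp only [f, min_eq_left h2]
      simp
    have hfx := h1 x (by linarith)
    have h2 := hdist x 0 fun y hy => by
      have h3 := (abs_le.1 (hδ y x)).1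
      rw [Metric.mem_ball] at hy
      rw [hfx, h1 y (by linarith), dist_self]
    rw [hfx] at h2
    exact dist_le_zero.1 h2
  have hsup : tsupport χ ⊆ {x | η / 8 ≤ δ x} := by
    refine closure_minimal (fun x hx => ?_) (isClosed_le continuous_const hδc)
    by_contra hlt
    exact hx (hzero x (not_le.1 hlt))
  have hsΩ : tsupport χ ⊆ Ω := fun x hx => by
    by_contra hxΩ
    have h1 : η / 8 ≤ δ x := hsup hx
    have h2 : δ x = 0 := Metric.infDist_zero_of_mem hxΩ
    linarith
  refine ⟨χ, hsm, ?_, hsΩ, fun x => ?_, fun x => ?_, fun x => ?_, fun x hx hq => ?_⟩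
  · exact Metric.isCompact_of_isClosed_isBounded (isClosed_tsupport χ) (hb.subset hsΩ)
  · have := abs_le.1 (hnear x)
    rw [abs_le]
    constructor <;> linarith [hf0 x, hf1 x]
  · have := abs_le.1 (hnear x)
    rw [abs_le]
    constructor <;> linarith [hf0 x, hf1 x]
  · have hL : LipschitzWith (Real.toNNReal (4 / η)) χ := by
      refine LipschitzWith.of_dist_le_mul fun x y => ?_
      rw [Real.coe_toNNReal _ (by positivity), Real.dist_eq, dist_eq_norm]
      have hi : ∀ z, Integrable (fun t => b.normed volume t * f (z - t)) volume := fun z => by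
        refine Continuous.integrable_of_hasCompactSupport ?_ ?_
        · exact b.continuous_normed.mul (hfc.comp (by fun_prop))
        · exact b.hasCompactSupport_normed.mul_right
      have e1 : χ x - χ y = ∫ t, b.normed volume t * (f (x - t) - f (y - t)) := by
        simp only [mul_sub]
        rw [integral_sub (hi x) (hi y)]
        rfl
      rw [e1, ← Real.norm_eq_abs]
      have e2 : 4 / η * ‖x - y‖ = ∫ t, b.normed volume t * (4 / η * ‖x - y‖) := by
        rw [integral_mul_const, b.integral_normed, one_mul]
      rw [e2]
      refine norm_integral_le_of_norm_le (b.integrable_normed.mul_const _) (ae_of_all _ fun t => ?_)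
      rw [norm_mul, Real.norm_of_nonneg (b.nonneg_normed t)]
      refine mul_le_mul_of_nonneg_left ?_ (b.nonneg_normed t)
      have := hfL (x - t) (y - t)
      rwa [sub_sub_sub_cancel_right] at this
    have := norm_fderiv_le_of_lipschitz ℝ (x₀ := x) hL
    rwa [Real.coe_toNNReal _ (by positivity)] at this
  · have h1 : η < δ x := by
      obtain ⟨y, hy, hxy⟩ := hΩ.isClosed_compl.exists_infDist_eq_dist hne x
      obtain ⟨q, hqs, hqf⟩ := exists_mem_segment_frontier hΩ hx hy
      by_contra! hle
      refine hq ⟨q, hqf, ?_⟩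
      have h2 : dist x q ≤ dist x y := by
        have := dist_add_dist_of_mem_segment hqs
        have := dist_nonneg (x := q) (y := y)
        linarith
      rw [← hxy] at h2
      exact h2.trans hle
    refine ⟨hone x (by linarith), ?_⟩
    have h2 : χ =ᶠ[𝓝 x] fun _ => 1 := by
      filter_upwards [(isOpen_lt continuous_const hδc).mem_nhds
        (show 5 * η / 8 < δ x by linarith)] with y hy
      exact hone y hy
    rw [h2.fderiv_eq]
    simp

/-- Smooth functions which are small on the boundary are approximated by test functions. -/
lemma IsBoundedLipschitzDomain.exists_test_approx (hΩ : IsBoundedLipschitzDomain Ω)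
    (hne : Ωᶜ.Nonempty) :
    ∃ C : ℝ, 0 ≤ C ∧ ∃ η₀ > 0, ∀ η, 0 < η → η ≤ η₀ → ∀ p ∈ smoothTraceGraph Ω, ‖p.2‖ ^ 2 ≤ η →
      ∃ W ∈ testSpace Ω, ‖fn W - fn p.1‖ ^ 2 ≤ C * η ^ 2 * (1 + ‖grad p.1‖ ^ 2) ∧
        ‖grad W‖ ^ 2 ≤ C * (1 + ‖grad p.1‖ ^ 2) := by
  obtain ⟨C, hC, η₀, hη₀, hstrip⟩ := hΩ.lintegral_strip_le_add
  -- The gradient of χφ contributes 2·(4/η)² = 32/η² times the mass of φ² in the strip, which is at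
  -- most Cη²(1 + G), and 2·2² = 8 times the squared gradient norm G of φ.
  refine ⟨32 * C + 8, by positivity, η₀, hη₀, fun η hη hηη p hp hpη => ?_⟩
  obtain ⟨φ, hφ, hc, hr, ht⟩ := hp
  obtain ⟨χ, hχ, hχc, hχs, hχ2, hχ1, hχ', hχn⟩ := exists_cutoff hΩ.isOpen hΩ.isBounded hne hη
  obtain ⟨S, hS⟩ : ∃ S, S = {x ∈ Ω | ∃ q ∈ frontier Ω, dist x q ≤ η} := ⟨_, rfl⟩
  obtain ⟨G, hG⟩ : ∃ G, G = ‖grad p.1‖ ^ 2 := ⟨_, rfl⟩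
  have hG0 : 0 ≤ G := hG ▸ sq_nonneg _
  have eG : ∫⁻ x in Ω, ENNReal.ofReal (‖fderiv ℝ φ x‖ ^ 2) = ENNReal.ofReal G := by
    rw [hG, ← lintegral_norm_sq]
    refine lintegral_congr_ae ?_
    filter_upwards [hr.2] with x hx
    rw [hx, gradient, LinearIsometryEquiv.norm_map]
  have eB : ∫⁻ x, ENNReal.ofReal (φ x ^ 2) ∂(surfaceMeasure Ω) ≤ ENNReal.ofReal η := by
    refine le_trans (le_of_eq ?_) (ENNReal.ofReal_le_ofReal hpη)
    rw [← lintegral_norm_sq]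
    refine lintegral_congr_ae ?_
    filter_upwards [ht] with x hx
    rw [hx, Real.norm_eq_abs, sq_abs]
  have hA : ∫⁻ x in S, ENNReal.ofReal (φ x ^ 2) ≤ ENNReal.ofReal (C * η ^ 2 * (1 + G)) := by
    rw [hS]
    refine (hstrip η hη hηη φ hφ).trans ?_
    rw [eG]
    refine (add_le_add_left (mul_le_mul_right eB _) _).trans ?_
    rw [← ENNReal.ofReal_mul (by positivity), ← ENNReal.ofReal_mul (by positivity),
      ← ENNReal.ofReal_add (by positivity) (by positivity)]
    refine ENNReal.ofReal_le_ofReal (le_of_eq ?_)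
    ring
  have hind : ∀ c : ℝ, 0 ≤ c → ∫⁻ x in Ω, S.indicator (fun x => ENNReal.ofReal (c * φ x ^ 2)) x
      ≤ ENNReal.ofReal (c * (C * η ^ 2 * (1 + G))) := fun c hc0 => by
    refine (lintegral_indicator_le _ _).trans ?_
    refine (lintegral_mono' (Measure.restrict_mono_measure Measure.restrict_le_self S)
      le_rfl).trans ?_
    simp only [ENNReal.ofReal_mul hc0]
    rw [lintegral_const_mul' _ _ ENNReal.ofReal_ne_top]
    gcongr
  have hψ : ContDiff ℝ ∞ fun x => χ x * φ x := hχ.mul hφ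
  have hψc : HasCompactSupport fun x => χ x * φ x := hχc.mul_right
  have hψs : tsupport (fun x => χ x * φ x) ⊆ Ω := (tsupport_mul_subset_left).trans hχs
  have hcase : ∀ x ∈ Ω, x ∉ S → χ x = 1 ∧ fderiv ℝ χ x = 0 := fun x hx hxS =>
    hχn x hx fun hq => hxS (by rw [hS]; exact ⟨hx, hq⟩)
  have hrW := isRepr_smoothH1 Ω hψ hψc
  refine ⟨smoothH1 Ω hψ hψc, ⟨_, hψ, hψc, hψs, hrW⟩, ?_, ?_⟩
  · have h1 : ENNReal.ofReal (‖fn (smoothH1 Ω hψ hψc) - fn p.1‖ ^ 2)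
        ≤ ENNReal.ofReal (4 * (C * η ^ 2 * (1 + G))) := by
      rw [← lintegral_norm_sq]
      refine le_trans (lintegral_mono_ae ?_) (hind 4 (by norm_num))
      filter_upwards [Lp.coeFn_sub (fn (smoothH1 Ω hψ hψc)) (fn p.1), hrW.1, hr.1,
        ae_restrict_mem hΩ.isOpen.measurableSet] with x h1 h2 h3 hx
      rw [h1, Pi.sub_apply, h2, h3]
      by_cases hxS : x ∈ S
      · rw [Set.indicator_of_mem hxS]
        refine ENNReal.ofReal_le_ofReal ?_
        rw [Real.norm_eq_abs, sq_abs, show χ x * φ x - φ x = (χ x - 1) * φ x by ring, mul_pow,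
          ← sq_abs (χ x - 1)]
        have := pow_le_pow_left₀ (abs_nonneg _) (hχ1 x) 2
        nlinarith [sq_nonneg (φ x)]
      · rw [Set.indicator_of_notMem hxS, (hcase x hx hxS).1]
        simp
    rw [ENNReal.ofReal_le_ofReal_iff (by positivity)] at h1
    rw [← hG]
    have : 0 ≤ (28 * C + 8) * η ^ 2 * (1 + G) := by positivity
    linarith
  · have h1 : ENNReal.ofReal (‖grad (smoothH1 Ω hψ hψc)‖ ^ 2)
        ≤ ENNReal.ofReal (32 / η ^ 2 * (C * η ^ 2 * (1 + G))) + ENNReal.ofReal (8 * G) := by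
      rw [← lintegral_norm_sq]
      have h0 : ∫⁻ x in Ω, ENNReal.ofReal (8 * ‖fderiv ℝ φ x‖ ^ 2) = ENNReal.ofReal (8 * G) := by
        simp only [ENNReal.ofReal_mul (show (0 : ℝ) ≤ 8 by norm_num)]
        rw [lintegral_const_mul' _ _ ENNReal.ofReal_ne_top, eG]
      rw [← h0]
      refine le_trans (lintegral_mono_ae ?_) ((lintegral_add_right _ ?_).le.trans
        (add_le_add_left (hind (32 / η ^ 2) (by positivity)) _))
      · filter_upwards [hrW.2, ae_restrict_mem hΩ.isOpen.measurableSet] with x h2 hx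
        rw [h2, gradient, LinearIsometryEquiv.norm_map]
        have e1 : fderiv ℝ (fun x => χ x * φ x) x = χ x • fderiv ℝ φ x + φ x • fderiv ℝ χ x :=
          fderiv_mul (hχ.differentiable (by simp) x) (hφ.differentiable (by simp) x)
        have e2 : ‖fderiv ℝ (fun x => χ x * φ x) x‖
            ≤ 2 * ‖fderiv ℝ φ x‖ + |φ x| * ‖fderiv ℝ χ x‖ := by
          rw [e1]
          refine (norm_add_le _ _).trans ?_
          rw [norm_smul, norm_smul, Real.norm_eq_abs, Real.norm_eq_abs]
          have := hχ2 x
          gcongr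
        have e3 := pow_le_pow_left₀ (norm_nonneg _) e2 2
        by_cases hxS : x ∈ S
        · rw [Set.indicator_of_mem hxS, ← ENNReal.ofReal_add (by positivity) (by positivity)]
          refine ENNReal.ofReal_le_ofReal (e3.trans ?_)
          have e4 : |φ x| * ‖fderiv ℝ χ x‖ ≤ |φ x| * (4 / η) := by
            have := hχ' x
            gcongr
          have e5 := pow_le_pow_left₀ (by positivity) e4 2
          have e6 : (|φ x| * (4 / η)) ^ 2 = 16 / η ^ 2 * φ x ^ 2 := by
            rw [mul_pow, sq_abs]
            ring
          rw [e6] at e5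
          have e7 : 32 / η ^ 2 * φ x ^ 2 = 2 * (16 / η ^ 2 * φ x ^ 2) := by ring
          rw [e7]
          nlinarith [sq_nonneg (2 * ‖fderiv ℝ φ x‖ - |φ x| * ‖fderiv ℝ χ x‖)]
        · rw [Set.indicator_of_notMem hxS, zero_add]
          refine ENNReal.ofReal_le_ofReal (e3.trans ?_)
          rw [(hcase x hx hxS).2, norm_zero, mul_zero, add_zero]
          nlinarith [sq_nonneg ‖fderiv ℝ φ x‖]
      · have hcf := hφ.continuous_fderiv (by simp)
        fun_prop
    rw [← ENNReal.ofReal_add (by positivity) (by positivity),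
      ENNReal.ofReal_le_ofReal_iff (by positivity)] at h1
    rw [← hG]
    have e1 : 32 / η ^ 2 * (C * η ^ 2 * (1 + G)) = 32 * C * (1 + G) := by
      field_simp
    rw [e1] at h1
    linarith

lemma hasTrace_zero_of_mem_testSpace (hΩ : IsOpen Ω) {W : H1 Ω} (hW : W ∈ testSpace Ω) :
    HasTrace W 0 := by
  obtain ⟨φ, hφ, hc, hs, hr⟩ := hW
  refine (smoothTraceGraph Ω).le_topologicalClosure ⟨φ, hφ, hc, hr, ?_⟩
  have h2 : ∀ᵐ x ∂(surfaceMeasure Ω), x ∈ frontier Ω :=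
    ae_restrict_mem isClosed_frontier.measurableSet
  filter_upwards [h2, Lp.coeFn_zero ℝ 2 (surfaceMeasure Ω)] with x hx hx0
  rw [hx0, Pi.zero_apply]
  refine (image_eq_zero_of_notMem_tsupport fun hxs => ?_).symm
  rw [hΩ.frontier_eq] at hx
  exact hx.2 (hs hxs)

lemma hasTrace_zero_of_mem_H10 (hΩ : IsOpen Ω) {W : H1 Ω} (hW : W ∈ H10 Ω) : HasTrace W 0 := by
  have hcl : IsClosed {W : H1 Ω | HasTrace W 0} :=
    (Submodule.isClosed_topologicalClosure (smoothTraceGraph Ω)).preimage (by fun_prop)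
  exact closure_minimal (fun W hW => hasTrace_zero_of_mem_testSpace hΩ hW) hcl hW

/-- The element of `H¹(Ω)` underlying an element of `traceSpace Ω`. -/
def toH1L (Ω : Set (Euc d)) : traceSpace Ω →L[ℝ] H1 Ω :=
  ((ContinuousLinearMap.fst ℝ _ _).comp (componentsL Ω)).codRestrict (H1 Ω) fun x => by
    obtain ⟨U, u, h, rfl⟩ := exists_ofHasTrace x
    exact U.2

lemma fn_toH1L (x : traceSpace Ω) : fn (toH1L Ω x) = fnL Ω x := rfl

/-- Functions with zero trace belong to `H¹₀(Ω)`. -/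
theorem IsBoundedLipschitzDomain.mem_H10_of_hasTrace_zero (hΩ : IsBoundedLipschitzDomain Ω)
    (hne : Ωᶜ.Nonempty) {U : H1 Ω} (h : HasTrace U 0) : U ∈ H10 Ω := by
  obtain ⟨C, hC, η₀, hη₀, happ⟩ := hΩ.exists_test_approx hne
  have h1 : (U, (0 : L2Bdry Ω)) ∈ closure (smoothTraceGraph Ω : Set (H1 Ω × L2Bdry Ω)) := h
  obtain ⟨p, hp, hlim⟩ := mem_closure_iff_seq_limit.1 h1
  have hlim1 : Tendsto (fun n => fn (p n).1) atTop (𝓝 (fn U)) := by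
    have hcont : Continuous fun q : H1 Ω × L2Bdry Ω => fn q.1 := by
      unfold fn
      fun_prop
    exact (hcont.tendsto _).comp hlim
  have hlim2 : Tendsto (fun n => grad (p n).1) atTop (𝓝 (grad U)) := by
    have hcont : Continuous fun q : H1 Ω × L2Bdry Ω => grad q.1 := by
      unfold grad
      fun_prop
    exact (hcont.tendsto _).comp hlim
  have hlim3 : Tendsto (fun n => ‖(p n).2‖ ^ 2) atTop (𝓝 0) := by
    have hcont : Continuous fun q : H1 Ω × L2Bdry Ω => ‖q.2‖ ^ 2 := by fun_prop
    have h2 := (hcont.tendsto _).comp hlim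
    simp only [norm_zero, ne_eq, OfNat.ofNat_ne_zero, not_false_eq_true, zero_pow] at h2
    exact h2
  obtain ⟨G, hG⟩ : ∃ G, ∀ n, ‖grad (p n).1‖ ^ 2 ≤ G := by
    obtain ⟨G, hG⟩ := (hlim2.norm.pow 2).bddAbove_range
    exact ⟨G, fun n => hG ⟨n, rfl⟩⟩
  have hG0 : 0 ≤ G := (sq_nonneg _).trans (hG 0)
  -- The widths tend to 0, and for each width an approximant with small enough trace is selected.
  -- The cut-off functions then converge to U in `L²`, but their gradients are only known to be
  -- bounded.
  let η : ℕ → ℝ := fun m => η₀ / (m + 1)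
  have hη : ∀ m, 0 < η m := fun m => by positivity
  have hη1 : ∀ m, η m ≤ η₀ := fun m => div_le_self hη₀.le (by linarith [m.cast_nonneg (α := ℝ)])
  have hη2 : Tendsto η atTop (𝓝 0) := by
    simpa [η, div_eq_mul_inv] using tendsto_one_div_add_atTop_nhds_zero_nat.const_mul η₀
  have hn : ∀ m, ∃ n, m ≤ n ∧ ‖(p n).2‖ ^ 2 ≤ η m := fun m =>
    ((eventually_ge_atTop m).and (hlim3.eventually (ge_mem_nhds (hη m)))).exists
  choose n hmn hnη using hn
  choose W hW hW1 hW2 using fun m => happ (η m) (hη m) (hη1 m) _ (hp (n m)) (hnη m)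
  have hfn : Tendsto (fun m => fn (W m)) atTop (𝓝 (fn U)) := by
    have h2 : Tendsto (fun m => fn (p (n m)).1) atTop (𝓝 (fn U)) :=
      hlim1.comp (tendsto_atTop_mono hmn tendsto_id)
    have h3 : Tendsto (fun m => ‖fn (W m) - fn (p (n m)).1‖ ^ 2) atTop (𝓝 0) := by
      refine squeeze_zero (fun m => sq_nonneg _)
        (fun m => (hW1 m).trans (mul_le_mul_of_nonneg_left 
          (show 1 + ‖grad (p (n m)).1‖ ^ 2 ≤ 1 + G by linarith [hG (n m)]) (by positivity))) ?_
      simpa using ((hη2.pow 2).const_mul C).mul_const (1 + G)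
    have h4 : Tendsto (fun m => fn (W m) - fn (p (n m)).1) atTop (𝓝 0) := by
      rw [tendsto_zero_iff_norm_tendsto_zero]
      simpa [Real.sqrt_sq] using h3.sqrt
    simpa using h4.add h2
  let x : ℕ → traceSpace Ω := fun m => ofHasTrace (hasTrace_zero_of_mem_testSpace hΩ.isOpen (hW m))
  obtain ⟨B, hB⟩ : ∃ B, ∀ m, ‖fn (W m)‖ ^ 2 ≤ B := by
    obtain ⟨B, hB⟩ := (hfn.norm.pow 2).bddAbove_range
    exact ⟨B, fun n => hB ⟨n, rfl⟩⟩
  have hx : ∀ m, ‖x m‖ ≤ √(B + C * (1 + G)) := fun m => by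
    refine Real.le_sqrt_of_sq_le ?_
    rw [norm_sq_traceSpace, fnL_ofHasTrace, gradL_ofHasTrace, traceL_ofHasTrace, norm_zero]
    have h2 := (hW2 m).trans (mul_le_mul_of_nonneg_left
      (show 1 + ‖grad (p (n m)).1‖ ^ 2 ≤ 1 + G by linarith [hG (n m)]) hC)
    have h3 := hB m
    rw [zero_pow two_ne_zero]
    linarith
  obtain ⟨x₀, hx₀⟩ := exists_weakLim hx
  -- A closed subspace is weakly closed. Boundedness of the gradients therefore suffices, and
  -- Rellich's theorem with uniqueness of the weak gradient identifies the weak limit with U.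
  have hmem : x₀ ∈ (H10 Ω).comap (toH1L Ω : traceSpace Ω →ₗ[ℝ] H1 Ω) := by
    have hcl : IsClosed ((H10 Ω).comap (toH1L Ω : traceSpace Ω →ₗ[ℝ] H1 Ω) :
        Set (traceSpace Ω)) :=
      (Submodule.isClosed_topologicalClosure (testSpace Ω)).preimage (toH1L Ω).continuous
    have := hcl.completeSpace_coe
    exact hx₀.mem fun m => (testSpace Ω).le_topologicalClosure (hW m)
  have heq : fnL Ω x₀ = fn U :=
    tendsto_nhds_unique (hΩ.cc_fnL x x₀ hx₀) (hfn.mono_left Nat.hyperfilter_le_atTop)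
  have h5 : toH1L Ω x₀ = U := H1.ext_fn hΩ.isOpen heq
  rw [← h5]
  exact hmem

end ZeroTrace

end DtN

end

noncomputable section

namespace DtN

/-! ### The Dirichlet-to-Neumann operator in terms of the form -/

section Fredholm

variable {G H B : Type*} [NormedAddCommGroup G] [InnerProductSpace ℝ G] [CompleteSpace G]
  [NormedAddCommGroup H] [InnerProductSpace ℝ H] [CompleteSpace H]
  [NormedAddCommGroup B] [InnerProductSpace ℝ B]
  {J : G →L[ℝ] H} {γ : G →L[ℝ] B} {Λ : ℝ}

/-- The Fredholm alternative for the Dirichlet problem. -/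
lemma Regular.exists_solution (h : Regular J γ Λ) (hJ : CC J) (f : H) :
    ∃ x, γ x = 0 ∧ ∀ y, γ y = 0 → ⟪x, y⟫ - (1 + Λ) * ⟪J x, J y⟫ = ⟪f, J y⟫ := by
  obtain ⟨K, hK⟩ : ∃ K : Submodule ℝ G, K = (γ : G →ₗ[ℝ] B).ker := ⟨_, rfl⟩
  have hmem : ∀ x, x ∈ K ↔ γ x = 0 := fun x => by
    rw [hK, LinearMap.mem_ker]
    rfl
  have hcl : IsClosed (K : Set G) := by
    rw [hK]
    exact γ.isClosed_ker
  have := hcl.completeSpace_coe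
  obtain ⟨A, hA⟩ : ∃ A : K →L[ℝ] H, A = J ∘L K.subtypeL := ⟨_, rfl⟩
  have hAx : ∀ x : K, A x = J x := fun x => by
    rw [hA]
    rfl
  have hccA : CC A := by
    rw [hA]
    exact hJ.comp_right _
  obtain ⟨C, hC⟩ : ∃ C : K →L[ℝ] K, C = (1 + Λ) • (A.adjoint ∘L A) := ⟨_, rfl⟩
  have hCi : ∀ x y : K, ⟪C x, y⟫ = (1 + Λ) * ⟪A x, A y⟫ := fun x y => by
    rw [hC, smul_apply, real_inner_smul_left, ContinuousLinearMap.comp_apply,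
      ContinuousLinearMap.adjoint_inner_left]
  have hCs : IsSelfAdjoint C := isSelfAdjoint_of_inner fun x y => by
    rw [hCi, real_inner_comm (C y) x, hCi, real_inner_comm]
  have hCc : CC C := by
    rw [hC]
    exact (hccA.comp_left _).smul _
  have hinj : ∀ x, C x = x → x = 0 := fun x hx => by
    refine Subtype.ext (h _ ((hmem _).1 x.2) fun y hy => ?_)
    have h1 := hCi x ⟨y, (hmem y).2 hy⟩
    rw [hx, hAx, hAx] at h1
    exact h1
  obtain ⟨T, hT⟩ := isUnit_one_sub_of_injective hCc hCs hinj
  obtain ⟨x, hx⟩ : ∃ x : K, x - C x = A.adjoint f := by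
    refine ⟨(↑T⁻¹ : K →L[ℝ] K) (A.adjoint f), ?_⟩
    have h1 : (T : K →L[ℝ] K) ((↑T⁻¹ : K →L[ℝ] K) (A.adjoint f)) = A.adjoint f := by
      rw [← mul_apply_eq_comp, Units.mul_inv]
      rfl
    rw [hT] at h1
    exact h1
  refine ⟨x, (hmem _).1 x.2, fun y hy => ?_⟩
  have h1 : ⟪x - C x, (⟨y, (hmem _).2 hy⟩ : K)⟫ = ⟪f, J y⟫ := by
    rw [hx, ContinuousLinearMap.adjoint_inner_left, hAx]
  rw [inner_sub_left, hCi, hAx, hAx] at h1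
  exact h1

end Fredholm

/-! ### Dictionary between the boundary value problem and the abstract pencil -/

section Translation

variable {d : ℕ} {Ω : Set (Euc d)} {Λ σ : ℝ}

lemma eq_zero_of_inner_testSpace (hΩ : IsOpen Ω) {f : L2 Ω}
    (h : ∀ Φ ∈ testSpace Ω, ⟪f, fn Φ⟫ = 0) : f = 0 := by
  have hloc : LocallyIntegrableOn f Ω volume := by
    rw [locallyIntegrableOn_iff hΩ.isLocallyClosed]
    intro k hk hkc
    have h2 : MemLp f 2 (volume.restrict k) := by
      have := (Lp.memLp f).restrict k
      rwa [Measure.restrict_restrict hkc.measurableSet, Set.inter_eq_left.2 hk] at this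
    have : IsFiniteMeasure ((volume : Measure (Euc d)).restrict k) := ⟨by
      rw [Measure.restrict_apply_univ]
      exact hkc.measure_lt_top⟩
    exact h2.integrable (by norm_num)
  have h0 : ∀ᵐ x ∂(volume : Measure (Euc d)), x ∈ Ω → f x = 0 := by
    refine hΩ.ae_eq_zero_of_integral_contDiff_smul_eq_zero hloc fun φ hφ hc hs => ?_
    have h1 := h (smoothH1 Ω hφ hc) ⟨φ, hφ, hc, hs, isRepr_smoothH1 Ω hφ hc⟩
    rw [real_inner_comm] at h1
    have h2 : ∫ x in Ω, f x * φ x = 0 := by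
      rw [← h1]
      exact (inner_testL2 f hφ.continuous hc).symm
    rw [← setIntegral_eq_integral_of_forall_compl_eq_zero (s := Ω)]
    · rw [← h2]
      exact integral_congr_ae (ae_of_all _ fun x => mul_comm _ _)
    · intro x hx
      rw [image_eq_zero_of_notMem_tsupport fun h => hx (hs h), zero_smul]
  refine Lp.ext ?_
  filter_upwards [(ae_restrict_iff' hΩ.measurableSet).2 h0,
    Lp.coeFn_zero ℝ 2 (volume.restrict Ω)] with x hx hx0
  rw [hx, hx0, Pi.zero_apply]

lemma HasNegLaplacian.inner_H10 {U : H1 Ω} {f : L2 Ω} (h : HasNegLaplacian U f) {Z : H1 Ω}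
    (hZ : Z ∈ H10 Ω) : ⟪grad U, grad Z⟫ = ⟪f, fn Z⟫ := by
  have hcl : IsClosed {Z : H1 Ω | ⟪grad U, grad Z⟫ = ⟪f, fn Z⟫} := by
    have c1 : Continuous fun Z : H1 Ω => grad Z := by
      unfold grad
      fun_prop
    have c2 : Continuous fun Z : H1 Ω => fn Z := by
      unfold fn
      fun_prop
    exact isClosed_eq (by fun_prop) (by fun_prop)
  exact closure_minimal (fun W hW => h W hW) hcl hZ

lemma ofHasTrace_toH1L (x : traceSpace Ω) :
    ∃ h : HasTrace (toH1L Ω x) (traceL Ω x), ofHasTrace h = x := by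
  obtain ⟨U, u, h, rfl⟩ := exists_ofHasTrace x
  exact ⟨h, rfl⟩

lemma toH1L_mem_H10 (hΩ : IsBoundedLipschitzDomain Ω) (hne : Ωᶜ.Nonempty) {x : traceSpace Ω}
    (hx : traceL Ω x = 0) : toH1L Ω x ∈ H10 Ω := by
  obtain ⟨h, -⟩ := ofHasTrace_toH1L x
  rw [hx] at h
  exact hΩ.mem_H10_of_hasTrace_zero hne h

/-- The abstract test elements have zero trace, while the distributional ones are smooth with
compact support. The two agree because elements of zero trace are `H¹` limits of test functions. -/
lemma isHarm_iff (hΩ : IsBoundedLipschitzDomain Ω) (hne : Ωᶜ.Nonempty) (x : traceSpace Ω) :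
    IsHarm (fnL Ω) (traceL Ω) Λ x ↔ IsHarmonic Λ (toH1L Ω x) := by
  constructor
  · intro h Φ hΦ
    have h1 := h (ofHasTrace (hasTrace_zero_of_mem_testSpace hΩ.isOpen hΦ)) (traceL_ofHasTrace _)
    rw [inner_traceSpace, fnL_ofHasTrace, gradL_ofHasTrace, traceL_ofHasTrace,
      inner_zero_right] at h1
    rw [real_inner_smul_left]
    have h2 : ⟪grad (toH1L Ω x), grad Φ⟫ = ⟪gradL Ω x, grad Φ⟫ := rfl
    rw [h2, fn_toH1L]
    linarith
  · intro h y hy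
    have h1 := h.inner_H10 (toH1L_mem_H10 hΩ hne hy)
    rw [real_inner_smul_left, fn_toH1L, fn_toH1L] at h1
    have h2 : ⟪grad (toH1L Ω x), grad (toH1L Ω y)⟫ = ⟪gradL Ω x, gradL Ω y⟫ := rfl
    rw [h2] at h1
    rw [inner_traceSpace, hy, inner_zero_right]
    linarith

lemma inner_pencil_traceSpace (x y : traceSpace Ω) :
    ⟪pencil (fnL Ω) (traceL Ω) Λ σ x, y⟫
      = ⟪gradL Ω x, gradL Ω y⟫ - Λ * ⟪fnL Ω x, fnL Ω y⟫ - σ * ⟪traceL Ω x, traceL Ω y⟫ := by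
  rw [inner_pencil, inner_traceSpace]
  ring

/-- Green's formula with ∂_n U = σu says exactly that the form of the pencil vanishes against every
function with a trace. -/
lemma mem_dtnEigenspace_iff (hΩ : IsBoundedLipschitzDomain Ω) (u : Hhalf Ω) :
    u ∈ dtnEigenspace Ω Λ σ ↔ (u : L2Bdry Ω) ∈ eigSpace (fnL Ω) (traceL Ω) Λ σ := by
  rw [mem_eigSpace]
  constructor
  · rintro ⟨U, ⟨hU, hUu⟩, f, hf, hN⟩
    have hUu : HasTrace U (u : L2Bdry Ω) := hUu
    -- The function f in the normal derivative is not prescribed, but the distributional Laplacian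
    -- of U determines it.
    have hfU : f = Λ • fn U := by
      rw [← sub_eq_zero]
      refine eq_zero_of_inner_testSpace hΩ.isOpen fun Φ hΦ => ?_
      rw [inner_sub_left, ← hf Φ hΦ, ← hU Φ hΦ, sub_self]
    refine ⟨ofHasTrace hUu, ?_, traceL_ofHasTrace _⟩
    refine ext_inner_right ℝ fun y => ?_
    rw [inner_zero_left, inner_pencil_traceSpace]
    obtain ⟨V, v, hV, rfl⟩ := exists_ofHasTrace y
    have h1 := hN V ⟨v, Submodule.mem_map.2 ⟨(V, v), hV, rfl⟩⟩ hV
    rw [hfU, real_inner_smul_left] at h1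
    have h2 : (σ • bdryPairing Ω u) ⟨v, Submodule.mem_map.2 ⟨(V, v), hV, rfl⟩⟩
        = σ * ⟪(u : L2Bdry Ω), v⟫ := rfl
    simp only [gradL_ofHasTrace, fnL_ofHasTrace, traceL_ofHasTrace]
    have h3 := h2.symm.trans h1
    linarith
  · rintro ⟨x, hx, hxu⟩
    have hform : ∀ y : traceSpace Ω, ⟪gradL Ω x, gradL Ω y⟫ - Λ * ⟪fnL Ω x, fnL Ω y⟫
        - σ * ⟪traceL Ω x, traceL Ω y⟫ = 0 := fun y => by
      rw [← inner_pencil_traceSpace, hx, inner_zero_left]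
    obtain ⟨U, u', h, rfl⟩ := exists_ofHasTrace x
    rw [traceL_ofHasTrace] at hxu
    have hharm : IsHarmonic Λ U := fun Φ hΦ => by
      have h1 := hform (ofHasTrace (hasTrace_zero_of_mem_testSpace hΩ.isOpen hΦ))
      simp only [gradL_ofHasTrace, fnL_ofHasTrace, traceL_ofHasTrace, inner_zero_right] at h1
      rw [real_inner_smul_left]
      linarith
    refine ⟨U, ⟨hharm, ?_⟩, Λ • fn U, hharm, fun V v hV => ?_⟩
    · rw [hxu] at h
      exact h
    · have h1 := hform (ofHasTrace hV)
      simp only [gradL_ofHasTrace, fnL_ofHasTrace, traceL_ofHasTrace, hxu] at h1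
      have h2 : (σ • bdryPairing Ω u) v = σ * ⟪(u : L2Bdry Ω), (v : L2Bdry Ω)⟫ := rfl
      rw [real_inner_smul_left]
      refine h2.trans ?_
      linarith

lemma map_dtnEigenspace (hΩ : IsBoundedLipschitzDomain Ω) (Λ σ : ℝ) :
    (dtnEigenspace Ω Λ σ).map (Hhalf Ω).subtype = eigSpace (fnL Ω) (traceL Ω) Λ σ := by
  ext u
  constructor
  · rintro ⟨u, hu, rfl⟩
    exact (mem_dtnEigenspace_iff hΩ u).1 hu
  · intro hu
    obtain ⟨x, -, hx⟩ := mem_eigSpace.1 hu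
    obtain ⟨U, u', h, rfl⟩ := exists_ofHasTrace x
    rw [traceL_ofHasTrace] at hx
    subst hx
    exact ⟨⟨u', Submodule.mem_map.2 ⟨(U, u'), h, rfl⟩⟩, (mem_dtnEigenspace_iff hΩ _).2 hu, rfl⟩

lemma finrank_dtnEigenspace (hΩ : IsBoundedLipschitzDomain Ω) (Λ σ : ℝ) :
    Module.finrank ℝ (dtnEigenspace Ω Λ σ)
      = Module.finrank ℝ (eigSpace (fnL Ω) (traceL Ω) Λ σ) := by
  rw [← map_dtnEigenspace hΩ]
  exact (Submodule.equivMapOfInjective _ (Hhalf Ω).subtype_injective _).finrank_eq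

lemma dtnEigenvalue_eq (hΩ : IsBoundedLipschitzDomain Ω) (Λ : ℝ) (k : ℕ+) :
    dtnEigenvalue Ω Λ k = eigVal (fnL Ω) (traceL Ω) Λ k := by
  have h : ∀ s : ℝ, Module.rank ℝ (⨆ τ ∈ Set.Iic s, dtnEigenspace Ω Λ τ : Submodule ℝ (Hhalf Ω))
      = Module.rank ℝ (eigSpan (fnL Ω) (traceL Ω) Λ s) := fun s => by
    have h1 : (⨆ τ ∈ Set.Iic s, dtnEigenspace Ω Λ τ : Submodule ℝ (Hhalf Ω)).map (Hhalf Ω).subtype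
        = eigSpan (fnL Ω) (traceL Ω) Λ s := by
      simp only [Submodule.map_iSup, map_dtnEigenspace hΩ]
      rfl
    rw [← h1]
    exact (Submodule.equivMapOfInjective _ (Hhalf Ω).subtype_injective _).rank_eq
  simp only [dtnEigenvalue, eigVal, h]

lemma eq_zero_of_fnL_eq_zero (hΩ : IsOpen Ω) {x : traceSpace Ω} (h1 : fnL Ω x = 0)
    (h2 : traceL Ω x = 0) : x = 0 := by
  obtain ⟨U, u, h, rfl⟩ := exists_ofHasTrace x
  have h3 : U = 0 := H1.ext_fn hΩ h1
  rw [traceL_ofHasTrace] at h2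
  subst h2 h3
  refine Subtype.ext ?_
  exact map_zero (toTriple Ω)

lemma regular_of_notMem_dirichletSpectrum (hΩ : IsBoundedLipschitzDomain Ω) (hne : Ωᶜ.Nonempty)
    (h : Λ ∉ dirichletSpectrum Ω) : Regular (fnL Ω) (traceL Ω) Λ := by
  intro x hx0 hx
  have hu : ∀ f : L2 Ω, ∃! V : L2 Ω, DirichletEq Ω Λ V f := not_not.1 h
  refine eq_zero_of_fnL_eq_zero hΩ.isOpen ?_ hx0
  refine (hu 0).unique ⟨toH1L Ω x, toH1L_mem_H10 hΩ hne hx0, rfl, fun Z hZ => ?_⟩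
    ⟨0, (H10 Ω).zero_mem, rfl, fun Z _ => ?_⟩
  · rw [zero_add]
    exact ((isHarm_iff hΩ hne x).1 hx).inner_H10 hZ
  · rw [smul_zero, add_zero, inner_zero_left]
    exact inner_zero_left _

lemma notMem_dirichletSpectrum_of_regular (hΩ : IsBoundedLipschitzDomain Ω) (hne : Ωᶜ.Nonempty)
    (h : Regular (fnL Ω) (traceL Ω) Λ) : Λ ∉ dirichletSpectrum Ω := by
  refine not_not.2 fun f => ?_
  obtain ⟨x, hx0, hx⟩ := h.exists_solution hΩ.cc_fnL f
  refine ⟨fnL Ω x, ⟨toH1L Ω x, toH1L_mem_H10 hΩ hne hx0, rfl, fun Z hZ => ?_⟩, ?_⟩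
  · have hz := hasTrace_zero_of_mem_H10 hΩ.isOpen hZ
    have h1 := hx _ (traceL_ofHasTrace hz)
    rw [inner_traceSpace, fnL_ofHasTrace, gradL_ofHasTrace, traceL_ofHasTrace,
      inner_zero_right] at h1
    rw [inner_add_left, real_inner_smul_left]
    have h2 : ⟪grad (toH1L Ω x), grad Z⟫ = ⟪gradL Ω x, grad Z⟫ := rfl
    rw [h2]
    linarith
  · rintro V ⟨W, hW, rfl, hWe⟩
    have hz := hasTrace_zero_of_mem_H10 hΩ.isOpen hW
    have h0 : ofHasTrace hz - x = 0 := by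
      refine h _ ?_ fun y hy => ?_
      · rw [map_sub, hx0, traceL_ofHasTrace, sub_zero]
      · have h1 := hx y hy
        have h2 := hWe _ (toH1L_mem_H10 hΩ hne hy)
        rw [inner_add_left, real_inner_smul_left, fn_toH1L] at h2
        have h3 : ⟪grad W, grad (toH1L Ω y)⟫ = ⟪grad W, gradL Ω y⟫ := rfl
        rw [h3] at h2
        rw [inner_sub_left, map_sub, inner_sub_left, inner_traceSpace (ofHasTrace hz), hy,
          inner_zero_right, fnL_ofHasTrace, gradL_ofHasTrace]
        linarith
    rw [← sub_eq_zero.1 h0]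
    rfl

lemma regular_of_neg (hΩ : IsOpen Ω) (h : Λ < 0) : Regular (fnL Ω) (traceL Ω) Λ := by
  intro x hx0 hx
  refine eq_zero_of_fnL_eq_zero hΩ ?_ hx0
  have h1 := hx x hx0
  rw [real_inner_self_eq_norm_sq, real_inner_self_eq_norm_sq, norm_sq_traceSpace x, hx0,
    norm_zero] at h1
  have h2 : ‖fnL Ω x‖ ^ 2 = 0 := by
    nlinarith [sq_nonneg ‖gradL Ω x‖, sq_nonneg ‖fnL Ω x‖]
  exact norm_eq_zero.1 (pow_eq_zero_iff two_ne_zero |>.1 h2)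

/-- Negative parameters are regular and hence outside the spectrum. So the spectrum is bounded below
by 0 and its infimum does exclude smaller parameters. -/
lemma regular_of_lt_firstDirichletEigenvalue (hΩ : IsBoundedLipschitzDomain Ω)
    (hne : Ωᶜ.Nonempty) (h : Λ < firstDirichletEigenvalue Ω) :
    Regular (fnL Ω) (traceL Ω) Λ := by
  refine regular_of_notMem_dirichletSpectrum hΩ hne (notMem_of_lt_csInf h ⟨0, fun μ hμ => ?_⟩)
  by_contra! hlt
  exact notMem_dirichletSpectrum_of_regular hΩ hne (regular_of_neg hΩ.isOpen hlt) hμ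

lemma Regular.ofHasTrace_eq (h : Regular (fnL Ω) (traceL Ω) Λ) (hΩ : IsBoundedLipschitzDomain Ω)
    (hne : Ωᶜ.Nonempty) {u : Hhalf Ω} {U : H1 Ω} (hU : IsHarmonicExtension Λ u U) {x : traceSpace Ω}
    (hx : pencil (fnL Ω) (traceL Ω) Λ σ x = 0) (hxu : traceL Ω x = u) : ofHasTrace hU.2 = x := by
  rw [← sub_eq_zero]
  refine h _ ?_ fun y hy => ?_
  · rw [map_sub, hxu, traceL_ofHasTrace, sub_self]
  · have h1 := (isHarm_iff hΩ hne (ofHasTrace hU.2)).2 hU.1 y hy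
    have h2 := inner_pencil (J := fnL Ω) (γ := traceL Ω) (Λ := Λ) (σ := σ) x y
    rw [hx, inner_zero_left, hy, inner_zero_right] at h2
    rw [inner_sub_left, map_sub, inner_sub_left]
    linarith

lemma dirichletEq_dirichletResolvent (h : Λ ∉ dirichletSpectrum Ω) (f : L2 Ω) :
    DirichletEq Ω Λ (dirichletResolvent Ω Λ f) f := by
  have hu : ∀ f : L2 Ω, ∃! V : L2 Ω, DirichletEq Ω Λ V f := not_not.1 h
  rw [dirichletResolvent, dif_pos hu]
  exact (hu f).choose_spec.1

/-- The cutoff is built from the distance to the complement, which must therefore have a point; the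
whole space is unbounded once d > 0. -/
lemma IsBoundedLipschitzDomain.compl_nonempty (hΩ : IsBoundedLipschitzDomain Ω) (hd : 0 < d) :
    Ωᶜ.Nonempty := by
  rw [Set.nonempty_compl]
  rintro rfl
  have : Nonempty (Fin d) := ⟨⟨0, hd⟩⟩
  exact NormedSpace.unbounded_univ ℝ (Euc d) hΩ.isBounded

end Translation

end DtN

end

/-! ### Proof of the proposition from the abstract results -/

theorem proposition4p3 (d : ℕ) (hd : 2 ≤ d) (Ω : Set (DtN.Euc d))
    (hΩ : DtN.IsBoundedLipschitzDomain Ω) :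
    (∀ Λ₀ : ℝ, Λ₀ ∉ DtN.dirichletSpectrum Ω →
      ∀ k : ℕ+,
      -- the eigenvalue with index `k` is simple at `Λ₀`
      Module.finrank ℝ (DtN.dtnEigenspace Ω Λ₀ (DtN.dtnEigenvalue Ω Λ₀ k)) = 1 →
      -- orthonormal eigenfunctions and their `Λ₀`-harmonic extensions
      ∀ (u : ℕ+ → DtN.Hhalf Ω) (U : ℕ+ → DtN.H1 Ω),
      Orthonormal ℝ (fun j => (u j : DtN.L2Bdry Ω)) →
      (∀ j, u j ∈ DtN.dtnEigenspace Ω Λ₀ (DtN.dtnEigenvalue Ω Λ₀ j)) →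
      (∀ j, DtN.IsHarmonicExtension Λ₀ (u j) (U j)) →
        -- the first derivative
        HasDerivAt (fun Λ => DtN.dtnEigenvalue Ω Λ k) (-‖DtN.fn (U k)‖ ^ 2) Λ₀ ∧
        -- the second derivative
        (∀ᶠ Λ in 𝓝 Λ₀, DifferentiableAt ℝ (fun Λ => DtN.dtnEigenvalue Ω Λ k) Λ) ∧
        Summable (fun j : {j : ℕ+ // j ≠ k} =>
          ⟪DtN.fn (U j), DtN.fn (U k)⟫ ^ 2 /
            (DtN.dtnEigenvalue Ω Λ₀ j - DtN.dtnEigenvalue Ω Λ₀ k)) ∧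
        HasDerivAt (deriv (fun Λ => DtN.dtnEigenvalue Ω Λ k))
          (-2 * (⟪DtN.dirichletResolvent Ω Λ₀ (DtN.fn (U k)), DtN.fn (U k)⟫ +
            ∑' j : {j : ℕ+ // j ≠ k}, ⟪DtN.fn (U j), DtN.fn (U k)⟫ ^ 2 /
              (DtN.dtnEigenvalue Ω Λ₀ j - DtN.dtnEigenvalue Ω Λ₀ k))) Λ₀) ∧
    -- concavity of the principal eigenvalue below the first Dirichlet eigenvalue
    ConcaveOn ℝ (Set.Iio (DtN.firstDirichletEigenvalue Ω))
      (fun Λ => DtN.dtnEigenvalue Ω Λ 1) := by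
  have hne := hΩ.compl_nonempty (by omega)
  have hev : ∀ k : ℕ+, (fun Λ => DtN.dtnEigenvalue Ω Λ k)
      = fun Λ => DtN.eigVal (DtN.fnL Ω) (DtN.traceL Ω) Λ k := fun k =>
    funext fun Λ => DtN.dtnEigenvalue_eq hΩ Λ k
  refine ⟨fun Λ₀ hΛ k hfin u U ho hu hU => ?_, ?_⟩
  · have hreg := DtN.regular_of_notMem_dirichletSpectrum hΩ hne hΛ
    rw [DtN.dtnEigenvalue_eq hΩ, DtN.finrank_dtnEigenspace hΩ] at hfin
    have hT : ∀ j, DtN.HasTrace (U j) (u j : DtN.L2Bdry Ω) := fun j => (hU j).2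
    have hpen : ∀ j, DtN.pencil (DtN.fnL Ω) (DtN.traceL Ω) Λ₀
        (DtN.eigVal (DtN.fnL Ω) (DtN.traceL Ω) Λ₀ j) (DtN.ofHasTrace (hT j)) = 0 := fun j => by
      have h1 := (DtN.mem_dtnEigenspace_iff hΩ (u j)).1 (hu j)
      rw [DtN.dtnEigenvalue_eq hΩ, DtN.mem_eigSpace] at h1
      obtain ⟨x, hx, hxu⟩ := h1
      rwa [hreg.ofHasTrace_eq hΩ hne (hU j) hx hxu]
    -- The Dirichlet resolvent applied to U k supplies the element D of zero trace in
    -- `eigVal_derivatives_series`.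
    obtain ⟨W, hW, hWV, hWe⟩ := DtN.dirichletEq_dirichletResolvent hΛ (DtN.fn (U k))
    have hWT := DtN.hasTrace_zero_of_mem_H10 hΩ.isOpen hW
    have ho' : Orthonormal ℝ fun j => DtN.traceL Ω (DtN.ofHasTrace (hT j)) := by
      simpa only [DtN.traceL_ofHasTrace] using ho
    have hD : ∀ y, DtN.traceL Ω y = 0 →
        ⟪DtN.ofHasTrace hWT, y⟫ - (1 + Λ₀) * ⟪DtN.fnL Ω (DtN.ofHasTrace hWT), DtN.fnL Ω y⟫
          = ⟪DtN.fnL Ω (DtN.ofHasTrace (hT k)), DtN.fnL Ω y⟫ := fun y hy => by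
      have h1 := hWe _ (DtN.toH1L_mem_H10 hΩ hne hy)
      have h2 : ⟪DtN.grad W, DtN.grad (DtN.toH1L Ω y)⟫ = ⟪DtN.grad W, DtN.gradL Ω y⟫ := rfl
      rw [inner_add_left, real_inner_smul_left, DtN.fn_toH1L, ← hWV, h2] at h1
      rw [DtN.inner_traceSpace, hy, inner_zero_right, DtN.fnL_ofHasTrace, DtN.fnL_ofHasTrace,
        DtN.gradL_ofHasTrace]
      linarith
    have key := DtN.eigVal_derivatives_series hΩ.cc_fnL hΩ.cc_traceL hreg hfin ho' hpen
      (DtN.traceL_ofHasTrace hWT) hD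
    simp only [DtN.fnL_ofHasTrace, hWV] at key
    rw [hev]
    simp only [DtN.dtnEigenvalue_eq hΩ]
    exact key
  · rw [hev]
    exact DtN.concaveOn_eigVal_one hΩ.cc_fnL hΩ.cc_traceL fun Λ hΛ =>
      DtN.regular_of_lt_firstDirichletEigenvalue hΩ hne hΛ
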